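/- **Conventions.** A *signal* is a finitely supported sequence $f:\mathbb Z\to\mathbb R$. Its autocorrelation is $a_i=\sum_j f_jf_{j+i}$ ($i\in\mathbb Z$; linear, i.e. zero-padded), and its Fourier magnitude is $\omega\mapsto\bigl|\sum_j f_je^{-i\omega j}\bigr|$ ($\omega\in\mathbb R$). Two signals $f,g$ are *equivalent* if they agree up to a global sign, a shift and time reversal: for some $\varepsilon=\pm1$ and $c\in\mathbb Z$, either $g_j=\varepsilon f_{j+c}$ for all $j$ or $g_j=\varepsilon f_{c-j}$ for all $j$. For a finite set $I\subset\mathbb Z$ the signals with support $I$ (the set of locations where a non-zero entry is allowed) are identified with $\mathbb R^I$, with Lebesgue measure; $k=|I|$ is their sparsity. The set $I$ is *uniform* if its elements form an arithmetic progression, and non-uniform otherwise. A signal $f\in\mathbb R^I$ is *uniquely recoverable* from its autocorrelation (or from its Fourier magnitude) if every signal $g$ with at most $k$ non-zero entries and the same autocorrelation (Fourier magnitude) is equivalent to $f$. **Theorem.** 1. Two signals have the same autocorrelation if and only if they have the same Fourier magnitude. 2. Let $|I|\ge 3$. Almost every $f\in\mathbb R^I$ is uniquely recoverable from its autocorrelation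 if and only if $I$ is non-uniform. The same holds for recovery from the Fourier magnitude. 3. If $I$ is non-uniform and $|I|=k$, the set of $f\in\mathbb R^I$ that are not uniquely recoverable from their autocorrelation has Hausdorff dimension less than $k$. 4. If $I$ is non-uniform, $|I|=k$, and the differences of elements of $I$ have greatest common divisor $1$, then the set of $f\in\mathbb R^I$ for which there is a signal $g$ of any sparsity whose set of non-zero locations is non-uniform, with the same autocorrelation as $f$ and not equivalent to $f$, has Hausdorff dimension less than $k$. 5. If $I$ is uniform and $|I|\ge4$, almost every $f\in\mathbb R^I$ is not uniquely recoverable from its autocorrelation. 6. Within the class of signals with non-uniform support, of whatever sparsity, the autocorrelation is almost surely one-to-one: there are Lebesgue-null sets $N_I\subset\mathbb R^I$, one for each non-uniform $I$, such that for all non-uniform $I,J$, any $f\in\mathbb R^I\setminus N_I$ and $g\in\mathbb R^J\setminus N_J$ with the same autocorrelation are equivalent. -/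

import Mathlib

open MeasureTheory

noncomputable section

namespace PhaseRetrieval

/-- A finite-length real one-dimensional signal, indexed by the integers (zero outside a finite
set of locations). -/
abbrev Signal : Type := ℤ →₀ ℝ

/-- The autocorrelation `a_i = ∑ j, x_j * x_{j+i}`, `i ∈ ℤ`, i.e. the coefficient sequence of
`X(z) X(z⁻¹)`. -/
def autocorr (f : Signal) : ℤ → ℝ := fun i => f.sum fun j a => a * f (j + i)

/-- The Fourier transform `ω ↦ ∑ j, x_j e^{-i ω j}`. -/
def fourier (f : Signal) : ℝ → ℂ := fun ω =>
  f.sum fun j a => (a : ℂ) * Complex.exp (-(Complex.I * (ω : ℂ) * (j : ℂ)))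

/-- The magnitude of the Fourier transform. -/
def fourierMagnitude (f : Signal) : ℝ → ℝ := fun ω => ‖fourier f ω‖

/-- Equality up to the trivial ambiguities: a global sign, a shift, and time reversal. -/
def TriviallyEquivalent (f g : Signal) : Prop :=
  ∃ ε c : ℤ, (ε = 1 ∨ ε = -1) ∧
    ((∀ j, g j = ε * f (j + c)) ∨ (∀ j, g j = ε * f (c - j)))

/-- A finite set of locations is uniform if its elements form an arithmetic progression. -/
def IsUniform (I : Finset ℤ) : Prop :=
  ∃ a d : ℤ, I = (Finset.range I.card).image fun j : ℕ => a + (j : ℤ) * d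

/-- The signal with entry `x i` at the location `i ∈ I` and zero elsewhere. As `x` runs through
`ℝ^I`, these are the signals with support set `I` (the locations where a non-zero entry is
allowed). -/
def signalOn (I : Finset ℤ) (x : I → ℝ) : Signal := ∑ i : I, Finsupp.single (i : ℤ) (x i)

/-- `f` is determined by its measurement `m f`, up to the trivial ambiguities, among all signals
with at most `k` non-zero entries. -/
def UniquelyRecoverable {β : Type} (m : Signal → β) (k : ℕ) (f : Signal) : Prop :=
  ∀ g : Signal, g.support.card ≤ k → m g = m f → TriviallyEquivalent f g

/-- Lebesgue-almost every signal with support set `I`, which has sparsity `|I|`, can be uniquely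
recovered from its measurement among the signals of sparsity at most `|I|`. -/
def AlmostSurelyRecoverable {β : Type} (m : Signal → β) (I : Finset ℤ) : Prop :=
  ∀ᵐ x : I → ℝ, UniquelyRecoverable m I.card (signalOn I x)

end PhaseRetrieval

end

/-! Call a signal on `I` generic if its entries are algebraically independent over ℚ. The other
signals lie in countably many zero sets of non-zero rational polynomials, so they have Hausdorff
dimension at most k - 1 (`dimH_not_algebraicIndependent_le`) and measure zero. It remains to treat a
single generic signal.

The autocorrelation is the coefficient sequence of X(z) X(1/z), which on the unit circle is the
squared Fourier magnitude. After a shift and a rescaling of exponents, f becomes p = ∑ x_i X^(e_i)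
with smallest exponent 0 and exponents of gcd 1, and a competitor g becomes q with `p * p.reverse =
q * q.reverse`. Hence q arises from p by inverting the roots in some set S, up to a scalar. If S is
empty or contains all roots, g is equivalent to f. For every other S, no coefficient of q from
degree 0 to deg p vanishes (`coeff_flipProd_ne_zero`). As `I` has a gap, the support of g is then
uniform and larger than `I`.

The non-vanishing holds because the roots of p can be permuted arbitrarily by field endomorphisms
fixing the x_i (`exists_ringHom_perm`): a coefficient that is zero for one S is zero for all S of
the same size, and taking differences over these S leads to a contradiction. All permutations occur
because the action is doubly transitive (two roots can replace two coefficients in a transcendence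
basis, `exists_ringEquiv_map_pair`) and contains a transposition. The transposition comes from a
degeneration to a polynomial whose only multiple root is a double root at 1: by Hensel's lemma all
but two of the roots are power series in the deformation parameter (`exists_field_transposition`).

The rescaling of g requires its support to lie in the same residue class structure as `I`. This is
automatic for gcd 1. It also holds if the entries of g are algebraically independent, which a
transcendence degree count forces when g has at most k non-zero entries
(`card_le_card_support_of_autocorr_eq`).

If `I` is uniform, any real factorization p = A B yields the competitor A · B.reverse of the same
sparsity. Such a factorization exists in degree at least 3, and in degree 2 on the open set of
positive discriminant. -/

namespace PhaseRetrieval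

/-! ### Hausdorff dimension of real zero sets and of the non-generic points. -/

section Dimension

variable {ι : Type*}

theorem exists_pderiv_ne_zero {P : MvPolynomial ι ℝ} (hP : P.totalDegree ≠ 0) :
    ∃ i, MvPolynomial.pderiv i P ≠ 0 := by
  classical
  have hP0 : P ≠ 0 := by rintro rfl; simp at hP
  obtain ⟨s, hs, hsd⟩ := Finset.exists_mem_eq_sup P.support
    (MvPolynomial.support_nonempty.mpr hP0) fun s => s.sum fun _ e => e
  have hs0 : s ≠ 0 := by
    rintro rfl
    rw [MvPolynomial.totalDegree, hsd] at hP
    simp at hP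
  obtain ⟨i, hi⟩ := Finsupp.ne_iff.mp hs0
  refine ⟨i, fun h => ?_⟩
  have := congrArg (MvPolynomial.coeff (s - Finsupp.single i 1)) h
  rw [MvPolynomial.coeff_pderiv, MvPolynomial.coeff_zero] at this
  have hle : Finsupp.single i 1 ≤ s := by
    simpa [Finsupp.single_le_iff, Nat.one_le_iff_ne_zero] using hi
  rw [tsub_add_cancel_of_le hle] at this
  rcases mul_eq_zero.mp this with h | h
  · exact MvPolynomial.mem_support_iff.mp hs h
  · exact (by positivity : ((s - Finsupp.single i 1 : ι →₀ ℕ) i : ℝ) + 1 ≠ 0) h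

theorem totalDegree_pderiv_lt {P : MvPolynomial ι ℝ} (hP : P.totalDegree ≠ 0) (i : ι) :
    (MvPolynomial.pderiv i P).totalDegree < P.totalDegree := by
  classical
  rw [MvPolynomial.totalDegree, Finset.sup_lt_iff (Nat.pos_of_ne_zero hP)]
  intro s hs
  rw [MvPolynomial.mem_support_iff, MvPolynomial.coeff_pderiv] at hs
  have := MvPolynomial.le_totalDegree (MvPolynomial.mem_support_iff.mpr (left_ne_zero_of_mul hs))
  rw [Finsupp.sum_add_index' (fun _ => rfl) (fun _ _ _ => rfl),
    Finsupp.sum_single_index rfl] at this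
  omega

variable [Fintype ι]

theorem hasStrictFDerivAt_eval_mvPolynomial (P : MvPolynomial ι ℝ) (x : ι → ℝ) :
    HasStrictFDerivAt (fun y : ι → ℝ => MvPolynomial.eval y P)
      (∑ j, MvPolynomial.eval x (MvPolynomial.pderiv j P) •
        (ContinuousLinearMap.proj j : (ι → ℝ) →L[ℝ] ℝ)) x := by
  classical
  induction P using MvPolynomial.induction_on with
  | C a => simpa using hasStrictFDerivAt_const (𝕜 := ℝ) a x
  | add p q hp hq =>
    simp only [map_add, add_smul, Finset.sum_add_distrib]
    exact hp.add hq
  | mul_X p i hp =>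
    have hX : HasStrictFDerivAt (fun y : ι → ℝ => y i)
        (ContinuousLinearMap.proj i : (ι → ℝ) →L[ℝ] ℝ) x :=
      (ContinuousLinearMap.proj i : (ι → ℝ) →L[ℝ] ℝ).hasStrictFDerivAt
    have h := hp.mul hX
    simp only [map_mul, MvPolynomial.eval_X]
    refine h.congr_fderiv ?_
    simp only [Derivation.leibniz, MvPolynomial.pderiv_X, smul_eq_mul, map_add, map_mul,
      MvPolynomial.eval_X, add_smul, Finset.sum_add_distrib, Finset.smul_sum, smul_smul,
      Pi.single_apply]
    congr 1
    simp [apply_ite, ite_smul]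

theorem add_le_of_mul_le_half {A C u δ : ℝ} (hA : 0 < A)
    (h : A * u ≤ C * δ + A / 2 * (u + δ)) : u + δ ≤ (2 * C / A + 2) * δ := by
  have h1 : A * (u + δ) ≤ A * ((2 * C / A + 2) * δ) := by
    have : A * ((2 * C / A + 2) * δ) = 2 * C * δ + 2 * A * δ := by field_simp
    rw [this]; linarith
  exact le_of_mul_le_mul_left h1 hA

/-- A linear form that almost annihilates `v` determines the coordinate `v i` up to the other
coordinates; the factor 1/2 lets the error be absorbed on the left. -/
theorem norm_le_of_abs_sum_mul_le [DecidableEq ι] {c v : ι → ℝ} {i : ι} {δ : ℝ} (hc : c i ≠ 0)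
    (hδ : 0 ≤ δ) (hv : ∀ j, j ≠ i → |v j| ≤ δ) (h : |∑ j, c j * v j| ≤ |c i| / 2 * ‖v‖) :
    ‖v‖ ≤ (2 * (∑ j ∈ Finset.univ.erase i, |c j|) / |c i| + 2) * δ := by
  have hvn : ‖v‖ ≤ |v i| + δ := by
    refine (pi_norm_le_iff_of_nonneg (by positivity)).mpr fun j => ?_
    by_cases hj : j = i
    · subst hj; simpa using hδ
    · exact (hv j hj).trans (le_add_of_nonneg_left (abs_nonneg _))
  have hrest : |∑ j ∈ Finset.univ.erase i, c j * v j| ≤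
      (∑ j ∈ Finset.univ.erase i, |c j|) * δ := by
    refine (Finset.abs_sum_le_sum_abs _ _).trans ?_
    rw [Finset.sum_mul]
    refine Finset.sum_le_sum fun j hj => ?_
    rw [abs_mul]
    exact mul_le_mul_of_nonneg_left (hv j (Finset.ne_of_mem_erase hj)) (abs_nonneg _)
  have hsum := Finset.add_sum_erase Finset.univ (fun j => c j * v j) (Finset.mem_univ i)
  refine hvn.trans (add_le_of_mul_le_half (abs_pos.mpr hc) ?_)
  rw [← abs_mul, eq_sub_of_add_eq hsum]
  refine (abs_sub _ _).trans ?_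
  rw [add_comm]
  exact add_le_add hrest (h.trans (mul_le_mul_of_nonneg_left hvn (by positivity)))

/-- Quantitative implicit function theorem: between two nearby zeros of `P` the gradient at `x`
almost annihilates the difference, so forgetting coordinate `i` loses no distance beyond a constant
factor. -/
theorem exists_nhds_antilipschitzWith [DecidableEq ι] (P : MvPolynomial ι ℝ) (i : ι) {x : ι → ℝ}
    (hx : MvPolynomial.eval x (MvPolynomial.pderiv i P) ≠ 0) :
    ∃ V ∈ nhds x, ∃ K, AntilipschitzWith K
      fun (y : {y : ι → ℝ | MvPolynomial.eval y P = 0 ∧ y ∈ V}) (j : {j // j ≠ i}) => y.1 j := by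
  have hlit := (hasStrictFDerivAt_eval_mvPolynomial P x).isLittleO.def
    (half_pos (abs_pos.mpr hx))
  rw [nhds_prod_eq] at hlit
  obtain ⟨V, hV, hVb⟩ := Filter.mem_prod_self_iff.mp hlit
  refine ⟨V, hV, Real.toNNReal (2 * (∑ j ∈ Finset.univ.erase i,
    |MvPolynomial.eval x (MvPolynomial.pderiv j P)|) /
      |MvPolynomial.eval x (MvPolynomial.pderiv i P)| + 2),
    AntilipschitzWith.of_le_mul_dist fun y z => ?_⟩
  have hpos : ∀ {A B : ℝ}, 0 ≤ A → 0 ≤ B → 0 ≤ 2 * A / B + 2 := fun _ _ => by positivity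
  rw [Real.coe_toNNReal _ (hpos (Finset.sum_nonneg fun _ _ => abs_nonneg _) (abs_nonneg _))]
  refine norm_le_of_abs_sum_mul_le (v := y.1 - z.1)
    (c := fun j => MvPolynomial.eval x (MvPolynomial.pderiv j P)) hx dist_nonneg
    (fun j hj => ?_) ?_
  · have := dist_le_pi_dist (fun j : {j // j ≠ i} => y.1 j) (fun j : {j // j ≠ i} => z.1 j)
      ⟨j, hj⟩
    rwa [Real.dist_eq] at this
  · have h1 := hVb (Set.mk_mem_prod y.2.2 z.2.2)
    rw [Set.mem_ofPred_eq, y.2.1, z.2.1, sub_zero, zero_sub, norm_neg, Real.norm_eq_abs] at h1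
    simpa using h1

theorem dimH_zeroLocus_inter_pderiv_ne_zero_le (P : MvPolynomial ι ℝ) (i : ι) :
    dimH {x : ι → ℝ | MvPolynomial.eval x P = 0 ∧
      MvPolynomial.eval x (MvPolynomial.pderiv i P) ≠ 0} ≤
        ((Fintype.card ι - 1 : ℕ) : ENNReal) := by
  classical
  by_contra! hlt
  -- Hausdorff dimension is local: a set of too large a dimension has a point all of whose relative
  -- neighbourhoods are too large.
  obtain ⟨x, hxS, hx⟩ := exists_mem_nhdsWithin_lt_dimH_of_lt_dimH hlt
  obtain ⟨V, hV, K, hK⟩ := exists_nhds_antilipschitzWith P i hxS.2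
  refine absurd (hx {y : ι → ℝ | MvPolynomial.eval y P = 0 ∧ y ∈ V} ?_) (not_lt.mpr ?_)
  · filter_upwards [self_mem_nhdsWithin, mem_nhdsWithin_of_mem_nhds hV] with y hy hyV
    exact ⟨hy.1, hyV⟩
  · rw [← Subtype.range_coe (s := {y : ι → ℝ | MvPolynomial.eval y P = 0 ∧ y ∈ V}),
      ← Set.image_univ, isometry_subtype_coe.dimH_image]
    refine (hK.le_dimH_image Set.univ).trans ((dimH_mono (Set.subset_univ _)).trans ?_)
    rw [Real.dimH_univ_pi, Fintype.card_subtype_compl, Fintype.card_subtype_eq]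

/-- Induction on the degree: a non-zero partial derivative either vanishes too, which is covered by
smaller degree, or does not, and then the zero set is locally a Lipschitz graph. -/
theorem dimH_zeroLocus_le {P : MvPolynomial ι ℝ} (hP : P ≠ 0) :
    dimH {x : ι → ℝ | MvPolynomial.eval x P = 0} ≤ ((Fintype.card ι - 1 : ℕ) : ENNReal) := by
  induction hn : P.totalDegree using Nat.strong_induction_on generalizing P with
  | _ n ih =>
    by_cases h0 : P.totalDegree = 0
    · rw [MvPolynomial.totalDegree_eq_zero_iff_eq_C] at h0
      have : {x : ι → ℝ | MvPolynomial.eval x P = 0} = ∅ := by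
        have hc : MvPolynomial.coeff 0 P ≠ 0 := fun h => hP (by rw [h0, h, map_zero])
        rw [h0]
        simpa [Set.eq_empty_iff_forall_notMem] using hc
      simp [this]
    · obtain ⟨i, hi⟩ := exists_pderiv_ne_zero h0
      have h1 := ih _ (hn ▸ totalDegree_pderiv_lt h0 i) hi rfl
      have h2 := dimH_zeroLocus_inter_pderiv_ne_zero_le P i
      refine (dimH_mono (t := {x : ι → ℝ | MvPolynomial.eval x (MvPolynomial.pderiv i P) = 0} ∪
        {x : ι → ℝ | MvPolynomial.eval x P = 0 ∧
          MvPolynomial.eval x (MvPolynomial.pderiv i P) ≠ 0}) fun x hx => ?_).trans ?_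
      · by_cases h : MvPolynomial.eval x (MvPolynomial.pderiv i P) = 0
        · exact Or.inl h
        · exact Or.inr ⟨hx, h⟩
      · rw [dimH_union]
        exact max_le h1 h2

theorem dimH_not_algebraicIndependent_le :
    dimH {x : ι → ℝ | ¬ AlgebraicIndependent ℚ x} ≤ ((Fintype.card ι - 1 : ℕ) : ENNReal) := by
  have hsub : {x : ι → ℝ | ¬ AlgebraicIndependent ℚ x} ⊆
      ⋃ P ∈ {P : MvPolynomial ι ℚ | P ≠ 0},
        {x : ι → ℝ | MvPolynomial.eval x (MvPolynomial.map (algebraMap ℚ ℝ) P) = 0} := by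
    intro x hx
    rw [Set.mem_ofPred_eq, algebraicIndependent_iff] at hx
    push Not at hx
    obtain ⟨P, hP, hP0⟩ := hx
    refine Set.mem_biUnion (x := P) hP0 ?_
    rw [Set.mem_ofPred_eq, MvPolynomial.eval_map, ← MvPolynomial.aeval_def]
    exact hP
  refine (dimH_mono hsub).trans ?_
  have : Countable (MvPolynomial ι ℚ) := by
    rw [← Cardinal.mk_le_aleph0_iff]
    exact MvPolynomial.cardinalMk_le_max_lift.trans (by simp)
  rw [dimH_bUnion (Set.to_countable _)]
  refine iSup₂_le fun P hP => dimH_zeroLocus_le ?_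
  exact (map_ne_zero_iff _ (MvPolynomial.map_injective _ (algebraMap ℚ ℝ).injective)).mpr hP

theorem dimH_not_algebraicIndependent_lt [Nonempty ι] :
    dimH {x : ι → ℝ | ¬ AlgebraicIndependent ℚ x} < (Fintype.card ι : ENNReal) :=
  dimH_not_algebraicIndependent_le.trans_lt
    (by exact_mod_cast Nat.sub_lt Fintype.card_pos one_pos)

theorem volume_eq_zero_of_dimH_lt {s : Set (ι → ℝ)} (h : dimH s < (Fintype.card ι : ENNReal)) :
    volume s = 0 := by
  rw [← hausdorffMeasure_pi_real]
  exact_mod_cast hausdorffMeasure_of_dimH_lt (d := (Fintype.card ι : NNReal)) (by simpa using h)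

theorem ae_algebraicIndependent [Nonempty ι] : ∀ᵐ x : ι → ℝ, AlgebraicIndependent ℚ x :=
  volume_eq_zero_of_dimH_lt dimH_not_algebraicIndependent_lt

end Dimension

/-! ### Relative algebraic closure and exchange of transcendence bases. -/

section RelativeAlgebraicClosure

variable {Ω : Type*} [Field Ω] [CharZero Ω]

/-- The elements algebraic over the field generated by `s`. -/
def algCl (s : Set Ω) : IntermediateField ℚ Ω :=
  (algebraicClosure (IntermediateField.adjoin ℚ s) Ω).restrictScalars ℚ

theorem mem_algCl {s : Set Ω} {a : Ω} :
    a ∈ algCl s ↔ IsAlgebraic (IntermediateField.adjoin ℚ s) a := by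
  rw [algCl, IntermediateField.mem_restrictScalars, mem_algebraicClosure_iff]

theorem subset_algCl (s : Set Ω) : s ⊆ algCl s := fun a ha =>
  mem_algCl.mpr (isAlgebraic_algebraMap
    (⟨a, IntermediateField.subset_adjoin ℚ s ha⟩ : IntermediateField.adjoin ℚ s))

theorem mem_algCl_of_eval_eq_zero {s : Set Ω} {q : Polynomial Ω} (hq : q ≠ 0)
    (hc : ∀ i, q.coeff i ∈ algCl s) {a : Ω} (ha : q.eval a = 0) : a ∈ algCl s := by
  let F := IntermediateField.adjoin ℚ s
  let M := algebraicClosure F Ω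
  have hl : q ∈ Polynomial.lifts (algebraMap M Ω) :=
    (Polynomial.lifts_iff_coeff_lifts q).mpr fun i => ⟨⟨q.coeff i, hc i⟩, rfl⟩
  obtain ⟨q', rfl⟩ := (Polynomial.mem_lifts _).mp hl
  have h : IsAlgebraic M a := ⟨q', fun h => hq (by rw [h, Polynomial.map_zero]), by
    rwa [Polynomial.aeval_def, ← Polynomial.eval_map]⟩
  exact mem_algCl.mpr (h.restrictScalars F)

theorem mem_algCl_iff_adjoin {s : Set Ω} {a : Ω} :
    a ∈ algCl s ↔ IsAlgebraic (Algebra.adjoin ℚ s) a :=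
  mem_algCl.trans IntermediateField.isAlgebraic_adjoin_iff

/-- Makes the rank function of the algebraic independence matroid available for counting. -/
theorem coe_algCl (s : Set Ω) :
    (algCl s : Set Ω) = (AlgebraicIndependent.matroid ℚ Ω).closure s := by
  ext a
  rw [AlgebraicIndependent.matroid_closure_eq, SetLike.mem_coe, mem_algCl_iff_adjoin,
    SetLike.mem_coe, Subalgebra.mem_algebraicClosure]

theorem algCl_le {s t : Set Ω} (h : s ⊆ algCl t) : algCl s ≤ algCl t := by
  rw [← SetLike.coe_subset_coe, coe_algCl, coe_algCl]
  rw [coe_algCl] at h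
  exact Matroid.closure_subset_closure_of_subset_closure h

theorem algCl_mono {s t : Set Ω} (h : s ⊆ t) : algCl s ≤ algCl t :=
  algCl_le (h.trans (subset_algCl t))

/-- Rank count in the matroid. It is the tool for trading coefficients against roots: a family of
the same size over which the `x i` are algebraic is again independent. -/
theorem card_le_of_forall_mem_algCl {ι κ : Type*} [Fintype ι] [Fintype κ]
    {x : ι → Ω} (hx : AlgebraicIndependent ℚ x) {y : κ → Ω} (hxy : ∀ i, x i ∈ algCl (Set.range y)) :
    Fintype.card ι ≤ Fintype.card κ ∧
      (Fintype.card κ ≤ Fintype.card ι → AlgebraicIndependent ℚ y) := by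
  have hxr : (AlgebraicIndependent.matroid ℚ Ω).Indep (Set.range x) :=
    AlgebraicIndependent.matroid_indep_iff.mpr hx.to_subtype_range
  have h1 : (Set.range x).encard = Fintype.card ι := by
    rw [← Set.image_univ, hx.injective.encard_image, Set.encard_univ, ENat.card_eq_coe_fintype_card]
  have h2 : (Set.range y).encard ≤ Fintype.card κ := by
    rw [← Set.image_univ, ← ENat.card_eq_coe_fintype_card, ← Set.encard_univ]
    exact Set.encard_image_le y Set.univ
  have hsub : Set.range x ⊆ (AlgebraicIndependent.matroid ℚ Ω).closure (Set.range y) := by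
    rw [← coe_algCl]
    rintro _ ⟨i, rfl⟩
    exact hxy i
  have h3 : (Set.range x).encard ≤ (AlgebraicIndependent.matroid ℚ Ω).eRk (Set.range y) := by
    rw [← hxr.eRk_eq_encard, ← Matroid.eRk_closure_eq _ (Set.range y)]
    exact Matroid.eRk_mono _ hsub
  have h4 := Matroid.eRk_le_encard (AlgebraicIndependent.matroid ℚ Ω) (Set.range y)
  refine ⟨by exact_mod_cast h1 ▸ h3.trans (h4.trans h2), fun hcard => ?_⟩
  have hcard' : (Fintype.card κ : ℕ∞) ≤ Fintype.card ι := by exact_mod_cast hcard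
  rw [h1] at h3
  have h5 : (Set.range y).encard = Fintype.card κ :=
    le_antisymm h2 (hcard'.trans (h3.trans h4))
  have hyi : Function.Injective y := by
    rw [← Set.injOn_univ]
    refine Set.Finite.injOn_of_encard_image_eq Set.finite_univ ?_
    rw [Set.image_univ, h5, Set.encard_univ, ENat.card_eq_coe_fintype_card]
  have hyr : (AlgebraicIndependent.matroid ℚ Ω).Indep (Set.range y) :=
    (Matroid.indep_iff_eRk_eq_encard_of_finite (Set.finite_range y)).mpr
      (le_antisymm h4 (h2.trans (hcard'.trans h3)))
  exact (algebraicIndependent_subtype_range hyi).mp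
    (AlgebraicIndependent.matroid_indep_iff.mp hyr)

theorem algCl_range_eq_top {ι : Type*} {x : ι → Ω} (hx : IsTranscendenceBasis ℚ x) :
    algCl (Set.range x) = ⊤ := by
  have := hx.isAlgebraic
  exact eq_top_iff.mpr fun _ _ => mem_algCl_iff_adjoin.mpr (Algebra.IsAlgebraic.isAlgebraic _)

theorem isTranscendenceBasis_of_algCl_eq_top {ι : Type*} {x : ι → Ω}
    (hx : AlgebraicIndependent ℚ x) (h : algCl (Set.range x) = ⊤) : IsTranscendenceBasis ℚ x :=
  hx.isTranscendenceBasis_iff_isAlgebraic.mpr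
    ⟨fun _ => mem_algCl_iff_adjoin.mp (h ▸ IntermediateField.mem_top)⟩

theorem notMem_algCl_of_algebraicIndependent {ι : Type*} {x : ι → Ω}
    (hx : AlgebraicIndependent ℚ x) (i : ι) : x i ∉ algCl (x '' {i}ᶜ) := fun h =>
  hx.transcendental_adjoin (s := {i}ᶜ) (by simp) (mem_algCl_iff_adjoin.mp h)

/-- Both fields are algebraic closures of polynomial rings in the same variables. -/
theorem exists_ringEquiv_of_isTranscendenceBasis {Ω' : Type*} [Field Ω'] [CharZero Ω']
    [IsAlgClosed Ω] [IsAlgClosed Ω'] {ι : Type*} {v : ι → Ω} {w : ι → Ω'}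
    (hv : IsTranscendenceBasis ℚ v) (hw : IsTranscendenceBasis ℚ w) :
    ∃ σ : Ω ≃+* Ω', ∀ i, σ (v i) = w i := by
  let := IsAlgClosed.isAlgClosure_of_transcendence_basis v hv
  let := IsAlgClosed.isAlgClosure_of_transcendence_basis w hw
  let e : Algebra.adjoin ℚ (Set.range v) ≃+* Algebra.adjoin ℚ (Set.range w) :=
    (hv.1.aevalEquiv.symm.trans hw.1.aevalEquiv).toRingEquiv
  refine ⟨IsAlgClosure.equivOfEquiv Ω Ω' e, fun i => ?_⟩
  have h1 : v i = algebraMap (Algebra.adjoin ℚ (Set.range v)) Ω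
      (hv.1.aevalEquiv (MvPolynomial.X i)) := by
    simp
  have h2 : w i = algebraMap (Algebra.adjoin ℚ (Set.range w)) Ω'
      (hw.1.aevalEquiv (MvPolynomial.X i)) := by
    simp
  rw [h1, IsAlgClosure.equivOfEquiv_algebraMap, h2]
  simp [e]

end RelativeAlgebraicClosure

/-! ### Generic sparse polynomials: simple roots and double transitivity. -/

section SparsePolynomial

open Polynomial

/-- Otherwise the order of a / b divides every exponent. -/
theorem exists_pow_ne_pow {Ω κ : Type*} [Field Ω] {e : κ → ℕ}
    (hgcd : ∀ d : ℕ, (∀ i, d ∣ e i) → d = 1) {a b : Ω} (hb : b ≠ 0)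
    (hab : a ≠ b) : ∃ i, a ^ e i ≠ b ^ e i := by
  by_contra! h
  have h1 : orderOf (a / b) = 1 := hgcd _ fun i => orderOf_dvd_of_pow_eq_one (by
    rw [div_pow, h i, div_self (pow_ne_zero _ hb)])
  rw [orderOf_eq_one_iff, div_eq_one_iff_eq hb] at h1
  exact hab h1

variable {ι : Type*} [Fintype ι]

/-- The polynomial `∑ i, x i * X ^ e i`. -/
noncomputable def sparsePoly {R : Type*} [CommRing R] (e : ι → ℕ) (x : ι → R) : R[X] :=
  ∑ i, C (x i) * X ^ e i

variable {R : Type*} [CommRing R]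

theorem map_sparsePoly {S : Type*} [CommRing S] (f : R →+* S) (e : ι → ℕ) (x : ι → R) :
    (sparsePoly e x).map f = sparsePoly e fun i => f (x i) := by
  simp [sparsePoly, Polynomial.map_sum]

theorem eval_sparsePoly (e : ι → ℕ) (x : ι → R) (a : R) :
    (sparsePoly e x).eval a = ∑ i, a ^ e i * x i := by
  simp only [sparsePoly, eval_finsetSum, eval_mul, eval_C, eval_pow, eval_X]
  exact Finset.sum_congr rfl fun i _ => mul_comm _ _

theorem eval_derivative_sparsePoly (e : ι → ℕ) (x : ι → R) (a : R) :
    (derivative (sparsePoly e x)).eval a = ∑ i, (e i * a ^ (e i - 1)) * x i := by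
  simp only [sparsePoly, derivative_sum, derivative_C_mul_X_pow, eval_finsetSum, eval_mul,
    eval_C, eval_pow, eval_X]
  exact Finset.sum_congr rfl fun i _ => by ring

theorem coeff_sparsePoly_apply {e : ι → ℕ} (he : Function.Injective e) (x : ι → R) (i : ι) :
    (sparsePoly e x).coeff (e i) = x i := by
  classical
  simp [sparsePoly, finsetSum_coeff, coeff_C_mul, coeff_X_pow, he.eq_iff]

theorem natDegree_sparsePoly_le {e : ι → ℕ} (x : ι → R) {n : ℕ} (hn : ∀ i, e i ≤ n) :
    (sparsePoly e x).natDegree ≤ n :=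
  natDegree_sum_le_of_forall_le _ _ fun i _ => (natDegree_C_mul_X_pow_le _ _).trans (hn i)

theorem natDegree_sparsePoly {e : ι → ℕ} (he : Function.Injective e) {x : ι → R} {t : ι}
    (hx : x t ≠ 0) (ht : ∀ i, e i ≤ e t) : (sparsePoly e x).natDegree = e t :=
  le_antisymm (natDegree_sparsePoly_le x ht)
    (le_natDegree_of_ne_zero (by rwa [coeff_sparsePoly_apply he]))

variable {Ω : Type*} [Field Ω]

variable {e : ι → ℕ} {x : ι → Ω} {i₀ t : ι}

theorem eval_zero_sparsePoly_ne_zero (he : Function.Injective e) (h0 : e i₀ = 0) (hx : x i₀ ≠ 0) :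
    (sparsePoly e x).eval 0 ≠ 0 := by
  rwa [← coeff_zero_eq_eval_zero, ← h0, coeff_sparsePoly_apply he]

theorem sum_sub_pow_mul_eq_zero {a b : Ω} (ha : (sparsePoly e x).eval a = 0)
    (hb : (sparsePoly e x).eval b = 0) : ∑ i, (a ^ e i - b ^ e i) * x i = 0 := by
  rw [eval_sparsePoly] at ha hb
  simp [sub_mul, Finset.sum_sub_distrib, ha, hb]

variable [CharZero Ω]

/-- Solves a linear relation for one unknown. Only the products are assumed to lie in `M`, so a `u
j` outside `M` does no harm when its coefficient is zero. -/
theorem mem_of_sum_mul_eq_zero {M : IntermediateField ℚ Ω} {c u : ι → Ω} {i : ι}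
    (h : ∑ j, c j * u j = 0) (hu : ∀ j, j ≠ i → c j * u j ∈ M) (hc : c i ∈ M) (hc0 : c i ≠ 0) :
    u i ∈ M := by
  classical
  rw [← Finset.add_sum_erase _ _ (Finset.mem_univ i)] at h
  have h1 : c i * u i ∈ M := by
    rw [eq_neg_of_add_eq_zero_left h]
    exact neg_mem (sum_mem fun j hj => hu j (Finset.ne_of_mem_erase hj))
  have h2 := mul_mem (inv_mem hc) h1
  rwa [inv_mul_cancel_left₀ hc0] at h2

theorem root_sparsePoly_ne_zero (he : Function.Injective e) (h0 : e i₀ = 0)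
    (hx : AlgebraicIndependent ℚ x) {a : Ω} (ha : (sparsePoly e x).eval a = 0) : a ≠ 0 := by
  rintro rfl
  exact eval_zero_sparsePoly_ne_zero he h0 (hx.ne_zero i₀) ha

/-- At a double root `a` the two linear equations for value and derivative express `x t` and `x i₀`
through `a` and the other coefficients, so all the `x i` would be algebraic over one element fewer.
-/
theorem derivative_sparsePoly_eval_ne_zero (he : Function.Injective e) (h0 : e i₀ = 0)
    (hx : AlgebraicIndependent ℚ x) (ht : e t ≠ 0) {a : Ω}
    (ha : (sparsePoly e x).eval a = 0) : (derivative (sparsePoly e x)).eval a ≠ 0 := by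
  classical
  intro hd
  have ha0 := root_sparsePoly_ne_zero he h0 hx ha
  -- The slot `i₀` is dropped and `a` takes the place of `x t`.
  let y : {i // i ≠ i₀} → Ω := fun i => if i.1 = t then a else x i
  have hti : t ≠ i₀ := fun h => ht (h ▸ h0)
  set M := algCl (Set.range y) with hM
  have haM : a ∈ M := subset_algCl _ ⟨⟨t, hti⟩, if_pos rfl⟩
  have hother : ∀ i, i ≠ i₀ → i ≠ t → x i ∈ M := fun i hi hit =>
    subset_algCl _ ⟨⟨i, hi⟩, if_neg hit⟩
  have hxt : x t ∈ M := by
    rw [eval_derivative_sparsePoly] at hd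
    refine mem_of_sum_mul_eq_zero hd (fun j hj => ?_)
      (mul_mem (natCast_mem M _) (pow_mem haM _))
      (mul_ne_zero (Nat.cast_ne_zero.mpr ht) (pow_ne_zero _ ha0))
    by_cases hj0 : j = i₀
    · subst hj0; simp [h0]
    · exact mul_mem (mul_mem (natCast_mem M _) (pow_mem haM _)) (hother j hj0 hj)
  have hall : ∀ i, i ≠ i₀ → x i ∈ M := fun i hi => by
    by_cases hit : i = t
    · exact hit ▸ hxt
    · exact hother i hi hit
  have hx0 : x i₀ ∈ M := by
    rw [eval_sparsePoly] at ha
    exact mem_of_sum_mul_eq_zero ha (fun j hj => mul_mem (pow_mem haM _) (hall j hj))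
      (pow_mem haM _) (pow_ne_zero _ ha0)
  have h1 := (card_le_of_forall_mem_algCl hx (y := y) fun i => by
    by_cases hi : i = i₀
    · rw [hi]; exact hx0
    · exact hall i hi).1
  rw [Fintype.card_subtype_compl, Fintype.card_subtype_eq] at h1
  have := Fintype.card_pos_iff.mpr ⟨t⟩
  omega

/-- The roots `a`, `b` can replace the coefficients `x i₀`, `x m`. The difference of the two root
equations has no constant term and yields `x m`; either equation then yields `x i₀`. -/
theorem forall_mem_algCl_update_pair [DecidableEq ι] (h0 : e i₀ = 0) {m : ι} (hm : m ≠ i₀)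
    {a b : Ω} (ha0 : a ≠ 0) (ha : (sparsePoly e x).eval a = 0) (hb : (sparsePoly e x).eval b = 0)
    (hab : a ^ e m ≠ b ^ e m) (i : ι) :
    x i ∈ algCl (Set.range (Function.update (Function.update x i₀ a) m b)) := by
  set y := Function.update (Function.update x i₀ a) m b with hy
  have haM : a ∈ algCl (Set.range y) := subset_algCl _ ⟨i₀, by simp [hy, hm.symm]⟩
  have hbM : b ∈ algCl (Set.range y) := subset_algCl _ ⟨m, by simp [hy]⟩
  have hother : ∀ i, i ≠ i₀ → i ≠ m → x i ∈ algCl (Set.range y) := fun i hi hit =>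
    subset_algCl _ ⟨i, by simp [hy, hi, hit]⟩
  have hxm : x m ∈ algCl (Set.range y) := by
    refine mem_of_sum_mul_eq_zero (sum_sub_pow_mul_eq_zero ha hb) (fun j hj => ?_)
      (sub_mem (pow_mem haM _) (pow_mem hbM _)) (sub_ne_zero.mpr hab)
    by_cases hj0 : j = i₀
    · subst hj0; simp [h0]
    · exact mul_mem (sub_mem (pow_mem haM _) (pow_mem hbM _)) (hother j hj0 hj)
  have hall : ∀ i, i ≠ i₀ → x i ∈ algCl (Set.range y) := fun i hi => by
    by_cases hit : i = m
    · exact hit ▸ hxm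
    · exact hother i hi hit
  by_cases hi : i = i₀
  · subst hi
    rw [eval_sparsePoly] at ha
    exact mem_of_sum_mul_eq_zero ha (fun j hj => mul_mem (pow_mem haM _) (hall j hj))
      (pow_mem haM _) (pow_ne_zero _ ha0)
  · exact hall i hi

/-- The gcd condition gives one exponent at which the powers differ; trading there makes `a` and `b`
algebraically independent, which excludes every relation `a ^ n = b ^ n`. -/
theorem pow_ne_pow_of_roots (he : Function.Injective e) (h0 : e i₀ = 0)
    (hgcd : ∀ d : ℕ, (∀ i, d ∣ e i) → d = 1) (hx : AlgebraicIndependent ℚ x) {a b : Ω}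
    (ha : (sparsePoly e x).eval a = 0) (hb : (sparsePoly e x).eval b = 0) (hab : a ≠ b)
    {n : ℕ} (hn : n ≠ 0) : a ^ n ≠ b ^ n := by
  classical
  have ha0 := root_sparsePoly_ne_zero he h0 hx ha
  have hb0 := root_sparsePoly_ne_zero he h0 hx hb
  obtain ⟨m, hm⟩ := exists_pow_ne_pow hgcd hb0 hab
  have hmi : m ≠ i₀ := by
    rintro rfl
    simp [h0] at hm
  have hy := (card_le_of_forall_mem_algCl hx
    (forall_mem_algCl_update_pair h0 hmi ha0 ha hb hm)).2 le_rfl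
  intro habn
  have hnot := notMem_algCl_of_algebraicIndependent hy i₀
  set y := Function.update (Function.update x i₀ a) m b with hyd
  have hyi : y i₀ = a := by simp [hyd, hmi.symm]
  rw [hyi] at hnot
  have hbM : b ∈ algCl (y '' {i₀}ᶜ) := subset_algCl _ ⟨m, hmi, by simp [hyd]⟩
  refine hnot (mem_algCl_of_eval_eq_zero (q := X ^ n - C (b ^ n))
    (X_pow_sub_C_ne_zero (Nat.pos_of_ne_zero hn) _) (fun i => ?_) (by simp [habn]))
  rw [coeff_sub, coeff_X_pow, coeff_C]
  refine sub_mem ?_ ?_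
  · split_ifs
    exacts [one_mem _, zero_mem _]
  · split_ifs
    exacts [pow_mem hbM _, zero_mem _]

/-- Double transitivity. Each pair of distinct roots completes the untouched coefficients to a
transcendence basis. An isomorphism matching the two bases also fixes the two traded coefficients,
because they solve the same linear equations. -/
theorem exists_ringEquiv_map_pair [IsAlgClosed Ω] (he : Function.Injective e) (h0 : e i₀ = 0)
    (ht : e t ≠ 0)
    (hgcd : ∀ d : ℕ, (∀ i, d ∣ e i) → d = 1) (hx : IsTranscendenceBasis ℚ x) {a b a' b' : Ω}
    (ha : (sparsePoly e x).eval a = 0) (hb : (sparsePoly e x).eval b = 0) (hab : a ≠ b)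
    (ha' : (sparsePoly e x).eval a' = 0) (hb' : (sparsePoly e x).eval b' = 0) (hab' : a' ≠ b') :
    ∃ σ : Ω ≃+* Ω, (∀ i, σ (x i) = x i) ∧ σ a = a' ∧ σ b = b' := by
  classical
  have hti : t ≠ i₀ := fun h => ht (h ▸ h0)
  have basis : ∀ {a b : Ω}, (sparsePoly e x).eval a = 0 → (sparsePoly e x).eval b = 0 → a ≠ b →
      IsTranscendenceBasis ℚ (Function.update (Function.update x i₀ a) t b) := by
    intro a b ha hb hab
    have hmem := forall_mem_algCl_update_pair h0 hti (root_sparsePoly_ne_zero he h0 hx.1 ha) ha hb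
      (pow_ne_pow_of_roots he h0 hgcd hx.1 ha hb hab ht)
    refine isTranscendenceBasis_of_algCl_eq_top
      ((card_le_of_forall_mem_algCl hx.1 hmem).2 le_rfl) ?_
    rw [eq_top_iff, ← algCl_range_eq_top hx]
    exact algCl_le (by rintro _ ⟨i, rfl⟩; exact hmem i)
  obtain ⟨σ, hσ⟩ := exists_ringEquiv_of_isTranscendenceBasis (basis ha hb hab) (basis ha' hb' hab')
  have hσa : σ a = a' := by simpa [hti.symm] using hσ i₀
  have hσb : σ b = b' := by simpa using hσ t
  have hother : ∀ i, i ≠ i₀ → i ≠ t → σ (x i) = x i := fun i hi hit => by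
    simpa [hi, hit] using hσ i
  have hxt : σ (x t) = x t := by
    have h1 := congrArg σ (sum_sub_pow_mul_eq_zero ha hb)
    simp only [map_sum, map_mul, map_sub, map_pow, hσa, hσb, map_zero] at h1
    rw [← sub_eq_zero, ← sum_sub_pow_mul_eq_zero ha' hb', ← Finset.sum_sub_distrib,
      Finset.sum_eq_single t] at h1
    · rw [sum_sub_pow_mul_eq_zero ha' hb', ← mul_sub] at h1
      exact sub_eq_zero.mp ((mul_eq_zero.mp h1).resolve_left
        (sub_ne_zero.mpr (pow_ne_pow_of_roots he h0 hgcd hx.1 ha' hb' hab' ht)))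
    · intro j _ hj
      by_cases hj0 : j = i₀
      · subst hj0; simp [h0]
      · rw [hother j hj0 hj, sub_self]
    · simp
  have hall : ∀ i, i ≠ i₀ → σ (x i) = x i := fun i hi => by
    by_cases hit : i = t
    · exact hit ▸ hxt
    · exact hother i hi hit
  refine ⟨σ, fun i => ?_, hσa, hσb⟩
  by_cases hi : i = i₀
  · subst hi
    have h1 := congrArg σ ha
    rw [eval_sparsePoly] at h1
    rw [eval_sparsePoly] at ha'
    simp only [map_sum, map_mul, map_pow, hσa, map_zero] at h1
    rw [← sub_eq_zero, ← ha', ← Finset.sum_sub_distrib, Finset.sum_eq_single i] at h1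
    · rw [ha', ← mul_sub] at h1
      exact sub_eq_zero.mp ((mul_eq_zero.mp h1).resolve_left
        (pow_ne_zero _ (root_sparsePoly_ne_zero he h0 hx.1 (by rwa [eval_sparsePoly]))))
    · intro j _ hj
      rw [hall j hj, sub_self]
    · simp
  · exact hall i hi

end SparsePolynomial

/-! ### The generic polynomial with a double root at 1 has no other multiple root. -/

section DoubleRoot

open Polynomial

variable {ι : Type*} [Fintype ι] {k : Type*} [Field k] {e : ι → ℕ} {s : ι → k} {i₀ t : ι}

/-- The combination of `1`, `X ^ m` and `X ^ n` with leading coefficient one at `X ^ m` that has a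
double root at `1`. -/
noncomputable def doubleRootTrinomial (k : Type*) [Field k] (m n : ℕ) : k[X] :=
  X ^ m - C ((m : k) / n) * X ^ n - C (1 - (m : k) / n)

theorem eval_doubleRootTrinomial (m n : ℕ) (b : k) :
    (doubleRootTrinomial k m n).eval b = b ^ m - (m : k) / n * b ^ n - (1 - (m : k) / n) := by
  simp [doubleRootTrinomial]

/-- A generic polynomial with exponents `e i` among those with a double root at `1`. -/
noncomputable def doubleRootPoly (e : ι → ℕ) (s : ι → k) (t : ι) : k[X] :=
  ∑ i, C (s i) * doubleRootTrinomial k (e i) (e t)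

theorem eval_doubleRootPoly (b : k) : (doubleRootPoly e s t).eval b =
    ∑ i, (doubleRootTrinomial k (e i) (e t)).eval b * s i := by
  simp only [doubleRootPoly, eval_finsetSum, eval_mul, eval_C]
  exact Finset.sum_congr rfl fun i _ => mul_comm _ _

theorem derivative_doubleRootPoly : derivative (doubleRootPoly e s t) =
    ∑ i, C (s i) * derivative (doubleRootTrinomial k (e i) (e t)) := by
  simp [doubleRootPoly]

theorem eval_derivative_doubleRootPoly (b : k) : (derivative (doubleRootPoly e s t)).eval b =
    ∑ i, (derivative (doubleRootTrinomial k (e i) (e t))).eval b * s i := by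
  simp only [derivative_doubleRootPoly, eval_finsetSum, eval_mul, eval_C]
  exact Finset.sum_congr rfl fun i _ => mul_comm _ _

variable [CharZero k]

/-- Algebraically independent elements are linearly independent over the algebraic numbers. -/
theorem eq_zero_of_sum_mul_eq_zero {s c : ι → k} (hs : AlgebraicIndependent ℚ s)
    (hc : ∀ i, c i ∈ algCl (∅ : Set k)) (h : ∑ i, c i * s i = 0) (i : ι) : c i = 0 := by
  by_contra hi
  have hle : algCl (∅ : Set k) ≤ algCl (s '' {i}ᶜ) := algCl_mono (Set.empty_subset _)
  exact notMem_algCl_of_algebraicIndependent hs i (mem_of_sum_mul_eq_zero h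
    (fun j hj => mul_mem (hle (hc j)) (subset_algCl _ ⟨j, hj, rfl⟩)) (hle (hc i)) hi)

theorem derivative_doubleRootTrinomial (m : ℕ) {n : ℕ} (hn : n ≠ 0) :
    derivative (doubleRootTrinomial k m n) = C (m : k) * (X ^ (m - 1) - X ^ (n - 1)) := by
  have hn' : (n : k) ≠ 0 := Nat.cast_ne_zero.mpr hn
  rw [doubleRootTrinomial, derivative_sub, derivative_sub, derivative_X_pow, derivative_C,
    derivative_C_mul_X_pow, div_mul_cancel₀ _ hn']
  ring

theorem eval_one_doubleRootTrinomial (m n : ℕ) : (doubleRootTrinomial k m n).eval 1 = 0 := by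
  rw [eval_doubleRootTrinomial]; ring

theorem eval_one_derivative_doubleRootTrinomial (m : ℕ) {n : ℕ} (hn : n ≠ 0) :
    (derivative (doubleRootTrinomial k m n)).eval 1 = 0 := by
  simp [derivative_doubleRootTrinomial m hn]

theorem eval_one_derivative_derivative_doubleRootTrinomial (m : ℕ) {n : ℕ} (hn : n ≠ 0) :
    (derivative (derivative (doubleRootTrinomial k m n))).eval 1 = m * ((m : k) - n) := by
  rw [derivative_doubleRootTrinomial m hn]
  rcases Nat.eq_zero_or_pos m with rfl | hm
  · simp
  · simp only [derivative_mul, derivative_C, derivative_sub, derivative_X_pow, eval_mul,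
      eval_sub, eval_C, eval_pow, eval_X, one_pow, zero_mul, zero_add, mul_one]
    rw [Nat.cast_sub hm, Nat.cast_sub (Nat.pos_of_ne_zero hn)]
    ring

theorem coeff_doubleRootTrinomial_mem (m n i : ℕ) (M : IntermediateField ℚ k) :
    (doubleRootTrinomial k m n).coeff i ∈ M := by
  have h : (m : k) / n ∈ M := div_mem (natCast_mem M _) (natCast_mem M _)
  simp only [doubleRootTrinomial, coeff_sub, coeff_X_pow, coeff_C_mul, coeff_C]
  refine sub_mem (sub_mem ?_ (mul_mem h ?_)) ?_
  · split_ifs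
    exacts [one_mem _, zero_mem _]
  · split_ifs
    exacts [one_mem _, zero_mem _]
  · split_ifs
    exacts [sub_mem (one_mem _) h, zero_mem _]

theorem coeff_zero_doubleRootTrinomial_ne_zero {m n : ℕ} (hm : m ≠ 0) (hmn : m < n) :
    (doubleRootTrinomial k m n).coeff 0 ≠ 0 := by
  have hn : (n : k) ≠ 0 := Nat.cast_ne_zero.mpr (by omega)
  simp only [doubleRootTrinomial, coeff_sub, coeff_X_pow, coeff_C_mul, coeff_C, if_true]
  rw [if_neg hm.symm, if_neg (by omega), mul_zero, sub_zero, zero_sub, neg_ne_zero, sub_ne_zero,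
    ne_comm, Ne, div_eq_one_iff_eq hn]
  exact_mod_cast hmn.ne

/-- After division by `X ^ (l - 1)` only the first product has a constant term, namely l times the
non-zero constant term of the second trinomial. -/
theorem wronskian_doubleRootTrinomial_ne_zero {l m n : ℕ} (hl : l ≠ 0) (hlm : l < m) (hmn : m < n) :
    derivative (doubleRootTrinomial k l n) * doubleRootTrinomial k m n -
      doubleRootTrinomial k l n * derivative (doubleRootTrinomial k m n) ≠ 0 := by
  intro h
  have hn : n ≠ 0 := by omega
  have h1 : derivative (doubleRootTrinomial k l n) * doubleRootTrinomial k m n =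
      X ^ (l - 1) * (C (l : k) * (1 - X ^ (n - l)) * doubleRootTrinomial k m n) := by
    rw [derivative_doubleRootTrinomial l hn, show n - 1 = (l - 1) + (n - l) by omega, pow_add]
    ring
  have h2 : doubleRootTrinomial k l n * derivative (doubleRootTrinomial k m n) =
      X ^ (l - 1) * (X ^ (m - l) * (C (m : k) * (1 - X ^ (n - m)) *
        doubleRootTrinomial k l n)) := by
    rw [derivative_doubleRootTrinomial m hn, show n - 1 = (l - 1) + (m - l) + (n - m) by omega,
      show m - 1 = (l - 1) + (m - l) by omega, pow_add, pow_add]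
    ring
  rw [h1, h2, ← mul_sub, mul_eq_zero] at h
  have h3 := congrArg (coeff · 0) (h.resolve_left (pow_ne_zero _ X_ne_zero))
  simp only [coeff_sub, mul_coeff_zero, coeff_C_zero, coeff_one_zero, coeff_zero, coeff_X_pow] at h3
  rw [if_neg (by omega), if_neg (by omega)] at h3
  simp [coeff_zero_doubleRootTrinomial_ne_zero (show m ≠ 0 by omega) hmn, hl] at h3

/-- Together with the case of exponent 0 below, this shows that the parameters at exponents `e t`
and 0 do not enter `doubleRootPoly`. -/
theorem doubleRootTrinomial_self {n : ℕ} (hn : n ≠ 0) : doubleRootTrinomial k n n = 0 := by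
  simp [doubleRootTrinomial, div_self (Nat.cast_ne_zero.mpr hn : (n : k) ≠ 0)]

theorem doubleRootTrinomial_zero (n : ℕ) : doubleRootTrinomial k 0 n = 0 := by
  simp [doubleRootTrinomial]

/-- A Bertini argument: a further double root of a generic member of a linear system is a base
point. If the trinomial φ i does not vanish at `b`, then `b` is a root of the Wronskian of the
polynomial with φ i, which does not involve `s i`. So `b` is algebraic over the other parameters,
and the vanishing at `b` makes `s i` algebraic over them. -/
theorem eval_doubleRootTrinomial_eq_zero_of_double_root (he : Function.Injective e)
    (ht : ∀ i, e i ≤ e t) (ht0 : e t ≠ 0) (hs : AlgebraicIndependent ℚ s) {b : k}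
    (hb : (doubleRootPoly e s t).eval b = 0) (hb' : (derivative (doubleRootPoly e s t)).eval b = 0)
    (i : ι) : (doubleRootTrinomial k (e i) (e t)).eval b = 0 := by
  by_contra hi
  have hi0 : e i ≠ 0 := fun h => hi (by rw [h, doubleRootTrinomial_zero, eval_zero])
  have hit : e i < e t := lt_of_le_of_ne (ht i) fun h => hi (by
    rw [h, doubleRootTrinomial_self ht0, eval_zero])
  set φ := fun j => doubleRootTrinomial k (e j) (e t) with hφ
  set M := algCl (s '' {i}ᶜ) with hM
  have hsM : ∀ j, j ≠ i → s j ∈ M := fun j hj => subset_algCl _ ⟨j, hj, rfl⟩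
  by_cases hbM : b ∈ M
  · rw [eval_doubleRootPoly] at hb
    have hev : ∀ j, (φ j).eval b ∈ M := fun j => by
      rw [eval_eq_sum_range]
      exact sum_mem fun l _ => mul_mem (coeff_doubleRootTrinomial_mem _ _ _ M) (pow_mem hbM _)
    exact notMem_algCl_of_algebraicIndependent hs i (mem_of_sum_mul_eq_zero hb
      (fun j hj => mul_mem (hev j) (hsM j hj)) (hev i) hi)
  set W := derivative (doubleRootPoly e s t) * φ i - doubleRootPoly e s t * derivative (φ i) with hW
  have hWsum : W = ∑ j, C (s j) * (derivative (φ j) * φ i - φ j * derivative (φ i)) := by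
    rw [hW, derivative_doubleRootPoly, doubleRootPoly, Finset.sum_mul, Finset.sum_mul,
      ← Finset.sum_sub_distrib]
    exact Finset.sum_congr rfl fun j _ => by simp only [hφ]; ring
  have hwc : ∀ (N : IntermediateField ℚ k) j l,
      (derivative (φ j) * φ i - φ j * derivative (φ i)).coeff l ∈ N := fun N j l => by
    have hd : ∀ j l, (derivative (φ j)).coeff l ∈ N := fun j l => by
      rw [coeff_derivative]
      exact mul_mem (coeff_doubleRootTrinomial_mem _ _ _ N)
        (add_mem (natCast_mem N _) (one_mem _))
    rw [coeff_sub, coeff_mul, coeff_mul]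
    exact sub_mem
      (sum_mem fun p _ => mul_mem (hd _ _) (coeff_doubleRootTrinomial_mem _ _ _ N))
      (sum_mem fun p _ => mul_mem (coeff_doubleRootTrinomial_mem _ _ _ N) (hd _ _))
  -- The remaining case is a Wronskian that is identically zero. By genericity the Wronskian of each
  -- φ j with φ i is then zero, which leaves φ i as the only non-zero trinomial.
  have hW0 : W = 0 := by
    by_contra hW0
    refine hbM (mem_algCl_of_eval_eq_zero hW0 (fun l => ?_) (by simp [hW, hb, hb']))
    rw [hWsum, finsetSum_coeff]
    refine sum_mem fun j _ => ?_
    rw [coeff_C_mul]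
    by_cases hj : j = i
    · subst hj
      rw [mul_comm (derivative _), sub_self, coeff_zero, mul_zero]
      exact zero_mem _
    · exact mul_mem (hsM j hj) (hwc M j l)
  have hw0 : ∀ j, derivative (φ j) * φ i - φ j * derivative (φ i) = 0 := fun j => by
    ext l
    refine eq_zero_of_sum_mul_eq_zero (c := fun j =>
      (derivative (φ j) * φ i - φ j * derivative (φ i)).coeff l) hs (fun j => hwc _ j l) ?_ j
    have := congrArg (coeff · l) hWsum
    simp only [hW0, coeff_zero, finsetSum_coeff, coeff_C_mul] at this
    rw [this]
    exact Finset.sum_congr rfl fun j _ => mul_comm _ _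
  have hφ0 : ∀ j, j ≠ i → φ j = 0 := fun j hj => by
    by_contra h0
    have hj0 : e j ≠ 0 := fun h => h0 (by simp only [hφ, h, doubleRootTrinomial_zero])
    have hjt : e j < e t := lt_of_le_of_ne (ht j) fun h => h0 (by
      simp only [hφ, h, doubleRootTrinomial_self ht0])
    rcases lt_or_gt_of_ne (he.ne hj) with h | h
    · exact wronskian_doubleRootTrinomial_ne_zero hj0 h hit (hw0 j)
    · refine wronskian_doubleRootTrinomial_ne_zero (k := k) hi0 h hjt ?_
      have := hw0 j
      simp only [hφ] at this
      rw [← neg_eq_zero, ← this]; ring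
  rw [eval_doubleRootPoly, Finset.sum_eq_single i
    (fun j _ hj => by simp only [hφ] at hφ0; rw [hφ0 j hj, eval_zero, zero_mul]) (by simp)] at hb
  exact (mul_ne_zero hi (hs.ne_zero i)) hb

/-- All trinomials vanish at `b`, so `b` is an algebraic number. Independence of the parameters then
makes each derivative vanish at `b` as well, so the powers of `b` at all non-zero exponents agree.
The trinomial at `m` makes the common value 1, and gcd 1 gives `b = 1`. -/
theorem eq_one_of_double_root (he : Function.Injective e)
    (ht : ∀ i, e i ≤ e t) (ht0 : e t ≠ 0) (hgcd : ∀ d : ℕ, (∀ i, d ∣ e i) → d = 1)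
    {m : ι} (hm0 : e m ≠ 0) (hmt : e m < e t) (hs : AlgebraicIndependent ℚ s) {b : k}
    (hb : (doubleRootPoly e s t).eval b = 0)
    (hb' : (derivative (doubleRootPoly e s t)).eval b = 0) : b = 1 := by
  have h1 := eval_doubleRootTrinomial_eq_zero_of_double_root he ht ht0 hs hb hb'
  have hbM : b ∈ algCl (∅ : Set k) := mem_algCl_of_eval_eq_zero
    (fun h => coeff_zero_doubleRootTrinomial_ne_zero (k := k) hm0 hmt (by rw [h, coeff_zero]))
    (fun i => coeff_doubleRootTrinomial_mem _ _ _ _) (h1 m)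
  rw [eval_derivative_doubleRootPoly] at hb'
  have h2 := eq_zero_of_sum_mul_eq_zero hs (fun i => by
    rw [derivative_doubleRootTrinomial _ ht0]
    simp only [eval_mul, eval_C, eval_sub, eval_pow, eval_X]
    exact mul_mem (natCast_mem _ _) (sub_mem (pow_mem hbM _) (pow_mem hbM _))) hb'
  have h3 : ∀ i, e i ≠ 0 → b ^ e i = b ^ e t := fun i hi => by
    have := h2 i
    rw [derivative_doubleRootTrinomial _ ht0] at this
    simp only [eval_mul, eval_C, eval_sub, eval_pow, eval_X] at this
    have := sub_eq_zero.mp ((mul_eq_zero.mp this).resolve_left (Nat.cast_ne_zero.mpr hi))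
    rw [← Nat.sub_add_cancel (Nat.one_le_iff_ne_zero.mpr hi), pow_succ, this,
      ← pow_succ, Nat.sub_add_cancel (Nat.one_le_iff_ne_zero.mpr ht0)]
  have hn : (e t : k) ≠ 0 := Nat.cast_ne_zero.mpr ht0
  have h4 : b ^ e t = 1 := by
    have := h1 m
    rw [eval_doubleRootTrinomial, h3 m hm0] at this
    have hne : (1 - (e m : k) / e t) ≠ 0 := by
      rw [sub_ne_zero, ne_comm, Ne, div_eq_one_iff_eq hn]
      exact_mod_cast hmt.ne
    have h5 : (1 - (e m : k) / e t) * (b ^ e t - 1) = 0 := by rw [← this]; ring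
    exact sub_eq_zero.mp ((mul_eq_zero.mp h5).resolve_left hne)
  by_contra hb1
  obtain ⟨i, hi⟩ := exists_pow_ne_pow hgcd one_ne_zero hb1
  rw [one_pow] at hi
  by_cases hi0 : e i = 0
  · exact hi (by rw [hi0, pow_zero])
  · exact hi (by rw [h3 i hi0, h4])

end DoubleRoot

/-! ### Roots of a first-order deformation in power series and Laurent series. -/

section Deformation

open Polynomial

variable {k : Type*} [Field k]

/-- The first-order deformation `F + t E` over the power series ring in `t`. -/
noncomputable def deformation (F E : k[X]) : (PowerSeries k)[X] :=
  F.map PowerSeries.C + C PowerSeries.X * E.map PowerSeries.C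

variable {F E : k[X]}

theorem map_constantCoeff_deformation (F E : k[X]) :
    (deformation F E).map (PowerSeries.constantCoeff (R := k)) = F := by
  have h : (PowerSeries.constantCoeff (R := k)).comp PowerSeries.C = RingHom.id k := by
    ext; simp
  simp [deformation, Polynomial.map_map, h]

theorem constantCoeff_eval_deformation (a : PowerSeries k) :
    PowerSeries.constantCoeff ((deformation F E).eval a) =
      F.eval (PowerSeries.constantCoeff a) := by
  rw [← Polynomial.eval_map_apply, map_constantCoeff_deformation]

theorem constantCoeff_eval_derivative_deformation (a : PowerSeries k) :
    PowerSeries.constantCoeff ((derivative (deformation F E)).eval a) =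
      (derivative F).eval (PowerSeries.constantCoeff a) := by
  rw [← Polynomial.eval_map_apply, ← derivative_map, map_constantCoeff_deformation]

theorem natDegree_deformation (hE : E.natDegree ≤ F.natDegree) (hF : F ≠ 0) :
    (deformation F E).natDegree = F.natDegree ∧
      PowerSeries.constantCoeff (deformation F E).leadingCoeff ≠ 0 := by
  have h1 : PowerSeries.constantCoeff ((deformation F E).coeff F.natDegree) = F.leadingCoeff := by
    rw [← coeff_map, map_constantCoeff_deformation]; rfl
  have h0 : F.leadingCoeff ≠ 0 := leadingCoeff_ne_zero.mpr hF
  have h2 : (deformation F E).natDegree = F.natDegree := by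
    refine le_antisymm ?_ (le_natDegree_of_ne_zero fun h => h0 (by rw [← h1, h, map_zero]))
    refine (natDegree_add_le _ _).trans (max_le natDegree_map_le ?_)
    exact (natDegree_C_mul_le _ _).trans (natDegree_map_le.trans hE)
  refine ⟨h2, ?_⟩
  rwa [leadingCoeff, h2, h1]

theorem isUnit_leadingCoeff_deformation (hE : E.natDegree ≤ F.natDegree) (hF : F ≠ 0) :
    IsUnit (deformation F E).leadingCoeff :=
  PowerSeries.isUnit_iff_constantCoeff.mpr (natDegree_deformation hE hF).2.isUnit

/-- Hensel's lemma for the ideal generated by the power series variable, after scaling the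
deformation to be monic. -/
theorem exists_root_deformation (hE : E.natDegree ≤ F.natDegree) {α : k} (hα : F.eval α = 0)
    (hα' : (derivative F).eval α ≠ 0) :
    ∃ a : PowerSeries k, (deformation F E).eval a = 0 ∧ PowerSeries.constantCoeff a = α := by
  have hF : F ≠ 0 := by rintro rfl; simp at hα'
  obtain ⟨u, hu⟩ := isUnit_leadingCoeff_deformation hE hF
  have hmonic : (C (↑u⁻¹ : PowerSeries k) * deformation F E).Monic := by
    rw [Monic, leadingCoeff_C_mul_of_isUnit u⁻¹.isUnit, ← hu, Units.inv_mul]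
  obtain ⟨a, ha, ha'⟩ := HenselianRing.is_henselian
    (I := Ideal.span {(PowerSeries.X : PowerSeries k)}) _ hmonic (PowerSeries.C α) (by
      rw [Ideal.mem_span_singleton, PowerSeries.X_dvd_iff, eval_mul, map_mul,
        constantCoeff_eval_deformation]
      simp [hα]) (by
      refine IsUnit.map _ (PowerSeries.isUnit_iff_constantCoeff.mpr ?_)
      rw [derivative_C_mul, eval_mul, eval_C, map_mul, constantCoeff_eval_derivative_deformation,
        PowerSeries.constantCoeff_C]
      exact (u⁻¹.isUnit.map _).mul hα'.isUnit)
  refine ⟨a, ?_, ?_⟩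
  · rw [IsRoot.def, eval_mul, eval_C] at ha
    exact (u⁻¹.isUnit.mul_right_eq_zero).mp ha
  · rw [Ideal.mem_span_singleton, PowerSeries.X_dvd_iff, map_sub, PowerSeries.constantCoeff_C,
      sub_eq_zero] at ha'
    exact ha'

theorem eval_one_deformation (h1 : F.eval 1 = 0) :
    (deformation F E).eval 1 = PowerSeries.X * PowerSeries.C (E.eval 1) := by
  have h : ∀ P : k[X], (P.map PowerSeries.C).eval 1 = PowerSeries.C (P.eval 1) := fun P => by
    rw [← map_one PowerSeries.C, Polynomial.eval_map_apply]
  simp [deformation, h, h1]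

/-- At 1 + tη the deformation is t E(1) modulo t², since the value and the derivative of `F` vanish
at 1. The double root therefore does not lift to a power series. -/
theorem constantCoeff_ne_one_of_root_deformation (h1 : F.eval 1 = 0)
    (h1' : (derivative F).eval 1 = 0) (hE1 : E.eval 1 ≠ 0) {a : PowerSeries k}
    (ha : (deformation F E).eval a = 0) : PowerSeries.constantCoeff a ≠ 1 := by
  intro hc
  have hdvd : PowerSeries.X ∣ a - 1 := by
    rw [PowerSeries.X_dvd_iff, map_sub, hc, map_one, sub_self]
  obtain ⟨η, hη⟩ := hdvd
  have hd : PowerSeries.X ∣ (derivative (deformation F E)).eval 1 := by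
    rw [PowerSeries.X_dvd_iff, constantCoeff_eval_derivative_deformation, map_one, h1']
  obtain ⟨ζ, hζ⟩ := hd
  obtain ⟨c, hc'⟩ := exists_mul_sq_add_linear_part_eq_eval_add (deformation F E) 1
    (PowerSeries.X * η)
  rw [← hη, add_sub_cancel, ha, hη, hζ, eval_one_deformation h1] at hc'
  have h2 : (PowerSeries.X : PowerSeries k) *
      (PowerSeries.X * (c * η ^ 2 + ζ * η) + PowerSeries.C (E.eval 1)) = 0 := by
    rw [← hc']; ring
  have h3 := congrArg PowerSeries.constantCoeff
    ((mul_eq_zero.mp h2).resolve_left PowerSeries.X_ne_zero)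
  simp only [map_add, map_mul, PowerSeries.constantCoeff_X, zero_mul, zero_add,
    PowerSeries.constantCoeff_C, map_zero] at h3
  exact hE1 h3

/-- Reduction at t = 0 is a bijection onto the roots of `F` other than 1: each of these is simple
and lifts uniquely. -/
theorem card_roots_deformation [DecidableEq k] [DecidableEq (PowerSeries k)]
    (hE : E.natDegree ≤ F.natDegree) (hF : F ≠ 0) (h1 : F.eval 1 = 0)
    (h1' : (derivative F).eval 1 = 0) (hE1 : E.eval 1 ≠ 0)
    (hsimple : ∀ α, α ≠ 1 → F.eval α = 0 → (derivative F).eval α ≠ 0) :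
    (deformation F E).roots.toFinset.card = (F.roots.toFinset.erase 1).card := by
  have hD : deformation F E ≠ 0 := fun h => (isUnit_leadingCoeff_deformation hE hF).ne_zero (by
    rw [h, leadingCoeff_zero])
  have hres : ∀ a, (deformation F E).eval a = 0 → F.eval (PowerSeries.constantCoeff a) = 0 :=
    fun a ha => by rw [← constantCoeff_eval_deformation (E := E), ha, map_zero]
  refine Finset.card_bij (fun a _ => PowerSeries.constantCoeff a) ?_ ?_ ?_
  · intro a ha
    rw [Multiset.mem_toFinset, mem_roots hD, IsRoot.def] at ha
    rw [Finset.mem_erase, Multiset.mem_toFinset, mem_roots hF, IsRoot.def]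
    exact ⟨constantCoeff_ne_one_of_root_deformation h1 h1' hE1 ha, hres a ha⟩
  · intro a ha b hb hab
    rw [Multiset.mem_toFinset, mem_roots hD, IsRoot.def] at ha hb
    refine IsLocalRing.eq_of_eval_eq_zero_of_not_isUnit_sub ha hb ?_ ?_
    · rw [PowerSeries.isUnit_iff_constantCoeff, map_sub, hab, sub_self]
      exact not_isUnit_zero
    · rw [PowerSeries.isUnit_iff_constantCoeff, constantCoeff_eval_derivative_deformation]
      exact (hsimple _ (constantCoeff_ne_one_of_root_deformation h1 h1' hE1 ha)
        (hres a ha)).isUnit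
  · intro α hα
    rw [Finset.mem_erase, Multiset.mem_toFinset, mem_roots hF, IsRoot.def] at hα
    obtain ⟨a, ha, ha'⟩ := exists_root_deformation hE hα.2 (hsimple α hα.1 hα.2)
    exact ⟨a, by rw [Multiset.mem_toFinset, mem_roots hD, IsRoot.def, ha], ha'⟩

/-- The leading coefficient is a unit, so a root in the fraction field is integral over the
integrally closed power series ring. -/
theorem exists_powerSeries_of_root (hE : E.natDegree ≤ F.natDegree) (hF : F ≠ 0)
    {r : LaurentSeries k}
    (hr : ((deformation F E).map (algebraMap (PowerSeries k) (LaurentSeries k))).eval r = 0) :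
    ∃ a : PowerSeries k, algebraMap (PowerSeries k) (LaurentSeries k) a = r ∧
      (deformation F E).eval a = 0 := by
  obtain ⟨u, hu⟩ := isUnit_leadingCoeff_deformation hE hF
  have hmonic : (C (↑u⁻¹ : PowerSeries k) * deformation F E).Monic := by
    rw [Monic, leadingCoeff_C_mul_of_isUnit u⁻¹.isUnit, ← hu, Units.inv_mul]
  obtain ⟨a, ha⟩ := isInteger_of_is_root_of_monic (K := LaurentSeries k) hmonic (r := r) (by
    rw [aeval_def, eval₂_mul, ← eval_map (p := deformation F E), hr, mul_zero])
  refine ⟨a, ha, ?_⟩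
  rw [← ha, Polynomial.eval_map_apply] at hr
  exact (map_eq_zero_iff _ (IsFractionRing.injective (PowerSeries k) (LaurentSeries k))).mp hr

end Deformation

/-! ### Two conjugate roots over the Laurent series field. -/

section Transposition

open Polynomial

/-- Since `u` is transcendental over `k`, a relation among the perturbed elements is an identity in
`u`; setting `u = 0` gives a relation among the `s i`. -/
theorem algebraicIndependent_add_mul {ι k Ω : Type*} [Field k] [CharZero k] [Field Ω] [CharZero Ω]
    (f : k →+* Ω) {s : ι → k} (hs : AlgebraicIndependent ℚ s) (c : ι → k) {u : Ω}
    (hu : ∀ q : k[X], q.eval₂ f u = 0 → q = 0) :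
    AlgebraicIndependent ℚ fun i => f (s i) + u * f (c i) := by
  rw [algebraicIndependent_iff]
  intro P hP
  let w : ι → k[X] := fun i => C (s i) + X * C (c i)
  have h1 : (eval₂RingHom f u) (MvPolynomial.aeval w P) = 0 := by
    rw [MvPolynomial.map_aeval, ← hP, MvPolynomial.aeval_def, MvPolynomial.coe_eval₂Hom]
    congr 1
    · exact Subsingleton.elim _ _
    · ext i
      simp only [w, coe_eval₂RingHom, eval₂_add, eval₂_mul, eval₂_C, eval₂_X]
  have h2 := congrArg (evalRingHom 0) (hu _ h1)
  rw [MvPolynomial.map_aeval, map_zero] at h2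
  refine algebraicIndependent_iff.mp hs P ?_
  rw [← h2, MvPolynomial.aeval_def, MvPolynomial.coe_eval₂Hom]
  congr 1
  · exact Subsingleton.elim _ _
  · ext i; simp [w]

theorem sparsePoly_add {ι R : Type*} [Fintype ι] [CommRing R] (e : ι → ℕ) (x y : ι → R) :
    sparsePoly e (fun i => x i + y i) = sparsePoly e x + sparsePoly e y := by
  simp [sparsePoly, add_mul, Finset.sum_add_distrib]

theorem sparsePoly_mul {ι R : Type*} [Fintype ι] [CommRing R] (e : ι → ℕ) (a : R) (x : ι → R) :
    sparsePoly e (fun i => a * x i) = C a * sparsePoly e x := by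
  simp [sparsePoly, Finset.mul_sum, mul_assoc]

theorem card_toFinset_roots {Ω : Type*} [Field Ω] [IsAlgClosed Ω] [DecidableEq Ω] {p : Polynomial Ω}
    (hp : p ≠ 0) (h : ∀ a, p.eval a = 0 → (derivative p).eval a ≠ 0) :
    p.roots.toFinset.card = p.natDegree := by
  rw [Multiset.toFinset_card_of_nodup, splits_iff_card_roots.mp (IsAlgClosed.splits p)]
  rw [Multiset.nodup_iff_count_le_one]
  intro a
  rw [count_roots]
  by_contra! hlt
  have := (one_lt_rootMultiplicity_iff_isRoot hp).mp hlt
  exact h a this.1 this.2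

/-- The inverse of the series variable is transcendental over `k`. The inverse appears because
dividing F + tE by t gives the coefficients of `E` perturbed by those of `F`. -/
theorem eval₂_inv_X_laurentSeries_ne_zero {k Ω : Type*} [Field k] [Field Ω]
    (g : LaurentSeries k →+* Ω)
    (q : k[X])
    (hq : q.eval₂ ((g.comp (algebraMap (PowerSeries k) (LaurentSeries k))).comp PowerSeries.C)
      (g (algebraMap (PowerSeries k) (LaurentSeries k) PowerSeries.X))⁻¹ = 0) : q = 0 := by
  set h := g.comp (algebraMap (PowerSeries k) (LaurentSeries k)) with hh
  have hinj : Function.Injective h :=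
    g.injective.comp (IsFractionRing.injective (PowerSeries k) (LaurentSeries k))
  have hX : h PowerSeries.X ≠ 0 := (map_ne_zero_iff _ hinj).mpr PowerSeries.X_ne_zero
  change q.eval₂ (h.comp PowerSeries.C) (h PowerSeries.X)⁻¹ = 0 at hq
  let := invertibleOfNonzero (inv_ne_zero hX)
  rw [← eval₂_reverse_eq_zero_iff, invOf_eq_inv, inv_inv, ← hom_eval₂,
    map_eq_zero_iff _ hinj, eval₂_C_X_eq_coe, coe_eq_zero_iff, reverse_eq_zero] at hq
  exact hq

theorem exists_doubleRootPoly_eq_sparsePoly {ι k : Type*} [Fintype ι] [Field k]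
    {e : ι → ℕ} {s : ι → k} {i₀ t : ι} (h0 : e i₀ = 0) :
    ∃ c : ι → k, doubleRootPoly e s t = sparsePoly e c := by
  classical
  refine ⟨fun i => s i + ((if i = t then -∑ j, s j * ((e j : k) / e t) else 0) +
    (if i = i₀ then -∑ j, s j * (1 - (e j : k) / e t) else 0)), ?_⟩
  rw [sparsePoly_add, sparsePoly_add]
  have h : ∀ (l : ι) (A : k), sparsePoly e (fun i => if i = l then A else 0) = C A * X ^ e l :=
    fun l A => by
      rw [sparsePoly, Finset.sum_eq_single l (fun j _ hj => by simp [hj]) (by simp), if_pos rfl]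
  rw [h, h, h0, pow_zero, mul_one, C_neg, C_neg, map_sum, map_sum, neg_mul, Finset.sum_mul,
    doubleRootPoly, sparsePoly, ← neg_add, ← sub_eq_add_neg, ← Finset.sum_add_distrib,
    ← Finset.sum_sub_distrib]
  refine Finset.sum_congr rfl fun i _ => ?_
  rw [doubleRootTrinomial, C_mul, C_mul]
  ring

variable {ι : Type*} [Fintype ι] {k : Type*} [Field k] [CharZero k]
  {e : ι → ℕ} {s : ι → k} {t m : ι}

theorem natDegree_doubleRootPoly (ht : ∀ i, e i ≤ e t) (hm0 : e m ≠ 0) (hmt : e m < e t)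
    (hs : AlgebraicIndependent ℚ s) : (doubleRootPoly e s t).natDegree = e t := by
  have ht0 : (e t : k) ≠ 0 := Nat.cast_ne_zero.mpr (by omega)
  refine le_antisymm (natDegree_sum_le_of_forall_le _ _ fun i _ =>
    (natDegree_C_mul_le _ _).trans ?_) (le_natDegree_of_ne_zero fun h => ?_)
  · rw [doubleRootTrinomial]
    refine (natDegree_sub_le _ _).trans (max_le ((natDegree_sub_le _ _).trans (max_le ?_ ?_)) ?_)
    · exact (natDegree_X_pow_le _).trans (ht i)
    · exact natDegree_C_mul_X_pow_le _ _
    · simp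
  · simp only [doubleRootPoly, finsetSum_coeff, coeff_C_mul] at h
    have h1 := eq_zero_of_sum_mul_eq_zero hs
      (c := fun i => (doubleRootTrinomial k (e i) (e t)).coeff (e t))
      (fun i => coeff_doubleRootTrinomial_mem _ _ _ _)
      ((Finset.sum_congr rfl fun i _ => mul_comm _ _).trans h) m
    simp only [doubleRootTrinomial, coeff_sub, coeff_X_pow, coeff_C_mul, coeff_C, if_true] at h1
    rw [if_neg hmt.ne', if_neg (by omega), zero_sub, sub_zero, mul_one, neg_eq_zero] at h1
    exact (div_ne_zero (Nat.cast_ne_zero.mpr hm0) ht0) h1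

/-- The multiplicity of 1 is exactly two, as the second derivative at 1 is a non-trivial linear form
in the parameters; all other roots are simple. -/
theorem card_erase_one_roots_doubleRootPoly [IsAlgClosed k] [DecidableEq k]
    (he : Function.Injective e) (ht : ∀ i, e i ≤ e t)
    (hgcd : ∀ d : ℕ, (∀ i, d ∣ e i) → d = 1) (hm0 : e m ≠ 0) (hmt : e m < e t)
    (hs : AlgebraicIndependent ℚ s) :
    ((doubleRootPoly e s t).roots.toFinset.erase 1).card + 2 = e t := by
  have ht0 : e t ≠ 0 := by omega
  set F := doubleRootPoly e s t with hF
  have hdeg := natDegree_doubleRootPoly ht hm0 hmt hs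
  have hF0 : F ≠ 0 := fun h => by
    rw [← hF, h, natDegree_zero] at hdeg
    exact ht0 hdeg.symm
  have h1 : F.eval 1 = 0 := by simp [hF, eval_doubleRootPoly, eval_one_doubleRootTrinomial]
  have h1' : (derivative F).eval 1 = 0 := by
    simp [hF, eval_derivative_doubleRootPoly, eval_one_derivative_doubleRootTrinomial _ ht0]
  have h2 : (derivative (derivative F)).eval 1 ≠ 0 := fun h => by
    rw [hF, derivative_doubleRootPoly, derivative_sum] at h
    simp only [derivative_C_mul, eval_finsetSum, eval_mul, eval_C,
      eval_one_derivative_derivative_doubleRootTrinomial _ ht0] at h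
    have h3 := eq_zero_of_sum_mul_eq_zero hs (c := fun i => (e i : k) * ((e i : k) - e t))
      (fun i => mul_mem (natCast_mem _ _) (sub_mem (natCast_mem _ _) (natCast_mem _ _)))
      ((Finset.sum_congr rfl fun i _ => mul_comm _ _).trans h) m
    refine mul_ne_zero (Nat.cast_ne_zero.mpr hm0) (sub_ne_zero.mpr ?_) h3
    exact_mod_cast hmt.ne
  have hc1 : F.roots.count 1 = 2 := by
    rw [count_roots]
    refine le_antisymm (not_lt.mp fun h => h2 ?_)
      ((one_lt_rootMultiplicity_iff_isRoot hF0).mpr ⟨h1, h1'⟩)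
    exact (lt_rootMultiplicity_iff_isRoot_iterate_derivative hF0).mp h 2 le_rfl
  have hmem : (1 : k) ∈ F.roots.toFinset := by
    rw [Multiset.mem_toFinset, mem_roots hF0]; exact h1
  have hsum := Multiset.toFinset_sum_count_eq F.roots
  rw [splits_iff_card_roots.mp (IsAlgClosed.splits F), hdeg, ← Finset.sum_erase_add _ _ hmem, hc1,
    Finset.sum_congr rfl (g := fun _ => 1), Finset.sum_const, smul_eq_mul, mul_one] at hsum
  · exact hsum
  · intro a ha
    rw [Finset.mem_erase, Multiset.mem_toFinset] at ha
    refine le_antisymm ?_ (Multiset.one_le_count_iff_mem.mpr ha.2)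
    rw [count_roots]
    by_contra! hlt
    have := (one_lt_rootMultiplicity_iff_isRoot hF0).mp hlt
    exact ha.1 (eq_one_of_double_root he ht ht0 hgcd hm0 hmt hs this.1 this.2)

/-- Exactly two roots lie outside the base field. One of them is moved by some automorphism, which
can only send it to the other and fixes all the rest. -/
theorem exists_transposition {F : Type*} {Ω : Type*} [Field F] [Field Ω] [Algebra F Ω]
    [IsGalois F Ω] [DecidableEq Ω] {p : F[X]} {R : Finset Ω}
    (hR : ∀ r, r ∈ R ↔ (p.map (algebraMap F Ω)).eval r = 0) {T : Finset Ω} (hTR : T ⊆ R)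
    (hT : ∀ r ∈ R, r ∈ T ↔ r ∈ (algebraMap F Ω).range) (hcard : T.card + 2 = R.card) :
    ∃ (σ : Ω ≃ₐ[F] Ω) (a b : Ω), a ∈ R ∧ b ∈ R ∧ a ≠ b ∧ σ a = b ∧ σ b = a ∧
      ∀ r ∈ R, r ≠ a → r ≠ b → σ r = r := by
  have h2 : (R \ T).card = 2 := by rw [Finset.card_sdiff_of_subset hTR]; omega
  obtain ⟨a, b, hab, hRT⟩ := Finset.card_eq_two.mp h2
  have hmaps : ∀ (σ : Ω ≃ₐ[F] Ω), ∀ r ∈ R \ T, σ r ∈ R \ T := by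
    intro σ r hr
    rw [Finset.mem_sdiff] at hr ⊢
    have h1 : σ r ∈ R := by
      have hr1 := (hR r).mp hr.1
      rw [hR, eval_map_algebraMap] at *
      rw [aeval_algHom_apply σ r p, hr1, map_zero]
    refine ⟨h1, fun h => hr.2 ((hT r hr.1).mpr ?_)⟩
    obtain ⟨y, hy⟩ := (hT _ h1).mp h
    exact ⟨y, σ.injective (by rw [← hy, AlgEquiv.commutes])⟩
  have ha : a ∈ R \ T := by rw [hRT]; simp
  have hb : b ∈ R \ T := by rw [hRT]; simp
  have haF : a ∉ (⊥ : IntermediateField F Ω) := fun h =>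
    (Finset.mem_sdiff.mp ha).2 ((hT a (Finset.mem_sdiff.mp ha).1).mpr h)
  rw [InfiniteGalois.mem_bot_iff_fixed] at haF
  push Not at haF
  obtain ⟨σ, hσ⟩ := haF
  have hσa : σ a = b := by
    have := hmaps σ a ha
    rw [hRT, Finset.mem_insert, Finset.mem_singleton] at this
    exact this.resolve_left hσ
  have hσb : σ b = a := by
    have := hmaps σ b hb
    rw [hRT, Finset.mem_insert, Finset.mem_singleton] at this
    exact this.resolve_right fun h => hab (σ.injective (hσa.trans h.symm))
  refine ⟨σ, a, b, (Finset.mem_sdiff.mp ha).1, (Finset.mem_sdiff.mp hb).1, hab, hσa, hσb,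
    fun r hr hra hrb => ?_⟩
  have hrT : r ∈ T := by
    by_contra h
    have : r ∈ R \ T := Finset.mem_sdiff.mpr ⟨hr, h⟩
    rw [hRT, Finset.mem_insert, Finset.mem_singleton] at this
    exact this.elim hra hrb
  obtain ⟨y, rfl⟩ := (hT r hr).mp hrT
  exact σ.commutes y

end Transposition

/-! ### Every permutation of the roots of a generic sparse polynomial is realized. -/

section SymmetricGroup

open Polynomial

universe u

/-- In Laurent series over `k`, the deformation of `doubleRootPoly` divided by t has algebraically
independent coefficients and `e t` distinct roots, of which exactly `e t - 2` are Laurent series. -/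
theorem exists_field_transposition {ι : Type*} [Fintype ι] {k : Type u} [Field k] [CharZero k]
    [IsAlgClosed k] {e : ι → ℕ} {s : ι → k} {i₀ t m : ι} (he : Function.Injective e)
    (h0 : e i₀ = 0) (ht : ∀ i, e i ≤ e t) (hgcd : ∀ d : ℕ, (∀ i, d ∣ e i) → d = 1)
    (hm0 : e m ≠ 0) (hmt : e m < e t) (hs : AlgebraicIndependent ℚ s) :
    ∃ (Ω : Type u) (_ : Field Ω) (_ : CharZero Ω) (_ : IsAlgClosed Ω) (x : ι → Ω) (σ : Ω →+* Ω)
      (a b : Ω), AlgebraicIndependent ℚ x ∧ (∀ i, σ (x i) = x i) ∧ (sparsePoly e x).eval a = 0 ∧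
      (sparsePoly e x).eval b = 0 ∧ a ≠ b ∧ σ a = b ∧ σ b = a ∧
      ∀ r, (sparsePoly e x).eval r = 0 → r ≠ a → r ≠ b → σ r = r := by
  classical
  let K := LaurentSeries k
  let ak := (algebraMap (PowerSeries k) K).comp PowerSeries.C
  have : CharZero K := charZero_of_injective_ringHom ak.injective
  let Ω := AlgebraicClosure K
  have : CharZero Ω := charZero_of_injective_ringHom (algebraMap K Ω).injective
  let g : K →+* Ω := algebraMap K Ω
  let f : k →+* Ω := (g.comp (algebraMap (PowerSeries k) K)).comp PowerSeries.C
  obtain ⟨c, hc⟩ := exists_doubleRootPoly_eq_sparsePoly (s := s) (t := t) h0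
  have ht0 : e t ≠ 0 := by omega
  set F := doubleRootPoly e s t with hF
  set E := sparsePoly e s with hE
  let τ : Ω := g (algebraMap (PowerSeries k) K PowerSeries.X)
  have hτ : τ ≠ 0 := by
    refine (map_ne_zero g).mpr ?_
    exact (map_ne_zero_iff _ (IsFractionRing.injective (PowerSeries k) K)).mpr PowerSeries.X_ne_zero
  let x : ι → Ω := fun i => f (s i) + τ⁻¹ * f (c i)
  have hx : AlgebraicIndependent ℚ x := algebraicIndependent_add_mul f hs c fun q hq =>
    eval₂_inv_X_laurentSeries_ne_zero g q hq
  set D := deformation F E with hD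
  set p := D.map (algebraMap (PowerSeries k) K) with hp
  have hpx : p.map g = C τ * sparsePoly e x := by
    have h1 : p.map g = F.map f + C τ * E.map f := by
      rw [hp, hD, deformation, Polynomial.map_map, Polynomial.map_add, Polynomial.map_mul, map_C,
        Polynomial.map_map, Polynomial.map_map]
      rfl
    rw [h1, hc, hE, map_sparsePoly, map_sparsePoly, sparsePoly_add, sparsePoly_mul, mul_add,
      ← mul_assoc, ← C_mul, mul_inv_cancel₀ hτ, C_1, one_mul, add_comm]
  have hroot : ∀ r, (p.map g).eval r = 0 ↔ (sparsePoly e x).eval r = 0 := fun r => by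
    rw [hpx, eval_mul, eval_C, mul_eq_zero, or_iff_right hτ]
  have hdegx : (sparsePoly e x).natDegree = e t := natDegree_sparsePoly he (hx.ne_zero t) ht
  have hx0 : sparsePoly e x ≠ 0 := fun h => ht0 (by rw [← hdegx, h, natDegree_zero])
  have hcardx := card_toFinset_roots hx0 fun a ha =>
    derivative_sparsePoly_eval_ne_zero he h0 hx ht0 ha
  have hdegF := natDegree_doubleRootPoly ht hm0 hmt hs
  have hF0 : F ≠ 0 := fun h => ht0 (by rw [← hdegF, ← hF, h, natDegree_zero])
  have hEF : E.natDegree ≤ F.natDegree := by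
    rw [hdegF]; exact natDegree_sparsePoly_le s ht
  have h1 : F.eval 1 = 0 := by simp [hF, eval_doubleRootPoly, eval_one_doubleRootTrinomial]
  have h1' : (derivative F).eval 1 = 0 := by
    simp [hF, eval_derivative_doubleRootPoly, eval_one_derivative_doubleRootTrinomial _ ht0]
  have hE1 : E.eval 1 ≠ 0 := fun h => by
    rw [hE, eval_sparsePoly] at h
    have := eq_zero_of_sum_mul_eq_zero hs (fun i => pow_mem (one_mem _) _) h t
    simp at this
  have hcardD := card_roots_deformation hEF hF0 h1 h1' hE1 fun α hα hα0 hα' =>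
    hα (eq_one_of_double_root he ht ht0 hgcd hm0 hmt hs hα0 hα')
  have hcardF := card_erase_one_roots_doubleRootPoly he ht hgcd hm0 hmt hs
  have hD0 : D ≠ 0 := fun h => (isUnit_leadingCoeff_deformation hEF hF0).ne_zero (by
    rw [← hD, h, leadingCoeff_zero])
  have hinj : Function.Injective fun a : PowerSeries k => g (algebraMap (PowerSeries k) K a) :=
    g.injective.comp (IsFractionRing.injective (PowerSeries k) K)
  have heval : ∀ a : PowerSeries k, (p.map g).eval (g (algebraMap (PowerSeries k) K a)) =
      g (algebraMap (PowerSeries k) K (D.eval a)) := fun a => by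
    rw [Polynomial.eval_map_apply, hp, Polynomial.eval_map_apply]
  obtain ⟨σ, a, b, ha, hb, hab, hσa, hσb, hσ⟩ := exists_transposition (F := K) (Ω := Ω) (p := p)
    (R := (sparsePoly e x).roots.toFinset)
    (T := D.roots.toFinset.image fun a => g (algebraMap (PowerSeries k) K a))
    (fun r => by rw [Multiset.mem_toFinset, mem_roots hx0, IsRoot.def]; exact (hroot r).symm)
    (fun r hr => by
      obtain ⟨a, ha, rfl⟩ := Finset.mem_image.mp hr
      rw [Multiset.mem_toFinset, mem_roots hD0, IsRoot.def] at ha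
      rw [Multiset.mem_toFinset, mem_roots hx0, IsRoot.def, ← hroot, heval, ha, map_zero, map_zero])
    (fun r hr => by
      rw [Multiset.mem_toFinset, mem_roots hx0, IsRoot.def, ← hroot] at hr
      constructor
      · intro h
        obtain ⟨a, ha, rfl⟩ := Finset.mem_image.mp h
        exact ⟨_, rfl⟩
      · rintro ⟨y, rfl⟩
        change (p.map g).eval (g y) = 0 at hr
        rw [Polynomial.eval_map_apply, map_eq_zero] at hr
        obtain ⟨a, rfl, ha⟩ := exists_powerSeries_of_root hEF hF0 hr
        refine Finset.mem_image.mpr ⟨a, ?_, rfl⟩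
        rw [Multiset.mem_toFinset, mem_roots hD0, IsRoot.def, ha])
    (by rw [Finset.card_image_of_injective _ hinj, hcardD, hcardF, hcardx, hdegx])
  rw [Multiset.mem_toFinset, mem_roots hx0, IsRoot.def] at ha hb
  refine ⟨Ω, inferInstance, inferInstance, inferInstance, x, σ.toRingEquiv.toRingHom, a, b, hx,
    fun i => ?_, ha, hb, hab, hσa, hσb, fun r hr => hσ r ?_⟩
  · have h2 : x i = g (ak (s i) + (algebraMap (PowerSeries k) K PowerSeries.X)⁻¹ * ak (c i)) := by
      simp only [x, f, τ, ak, RingHom.comp_apply, map_add, map_mul, map_inv₀]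
    rw [h2]
    exact σ.commutes _
  · rw [Multiset.mem_toFinset, mem_roots hx0, IsRoot.def, hr]

theorem exists_ringHom_of_isTranscendenceBasis {ι Ω Ω' : Type*} [Field Ω] [CharZero Ω] [Field Ω']
    [CharZero Ω'] [IsAlgClosed Ω'] {x : ι → Ω} (hx : IsTranscendenceBasis ℚ x) {x' : ι → Ω'}
    (hx' : AlgebraicIndependent ℚ x') : ∃ ψ : Ω →+* Ω', ∀ i, ψ (x i) = x' i := by
  let A := Algebra.adjoin ℚ (Set.range x)
  let j : A →+* Ω' := (MvPolynomial.aeval x').toRingHom.comp hx.1.aevalEquiv.symm.toRingHom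
  have hj : Function.Injective j :=
    (algebraicIndependent_iff_injective_aeval.mp hx').comp hx.1.aevalEquiv.symm.injective
  let := j.toAlgebra
  have : Algebra.IsAlgebraic A Ω := hx.isAlgebraic
  have : FaithfulSMul A Ω' := (faithfulSMul_iff_algebraMap_injective A Ω').mpr hj
  let ψ : Ω →ₐ[A] Ω' := IsAlgClosed.lift
  refine ⟨ψ.toRingHom, fun i => ?_⟩
  have h1 : x i = algebraMap A Ω (hx.1.aevalEquiv (MvPolynomial.X i)) := by simp [A]
  change ψ (x i) = x' i
  rw [h1, ψ.commutes]
  change j _ = _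
  simp [j]

/-- The image of ψ is algebraically closed and algebraic over the fixed elements ψ (x i), so σ maps
it into itself and can be pulled back. -/
theorem exists_ringHom_comp_eq {ι Ω Ω' : Type*} [Field Ω] [CharZero Ω] [IsAlgClosed Ω] [Field Ω']
    [CharZero Ω'] {x : ι → Ω} (hx : IsTranscendenceBasis ℚ x) (ψ : Ω →+* Ω') (σ : Ω' →+* Ω')
    (hσ : ∀ i, σ (ψ (x i)) = ψ (x i)) : ∃ τ : Ω →+* Ω, ∀ b, ψ (τ b) = σ (ψ b) := by
  have hagree : ∀ b ∈ IntermediateField.adjoin ℚ (Set.range x), σ (ψ b) = ψ b := by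
    intro b hb
    induction hb using IntermediateField.adjoin_induction with
    | mem b hb => obtain ⟨i, rfl⟩ := hb; exact hσ i
    | algebraMap q => simp
    | add a b _ _ ha hb => simp [ha, hb]
    | inv a _ ha => simp [ha]
    | mul a b _ _ ha hb => simp [ha, hb]
  have hrange : ∀ b, σ (ψ b) ∈ ψ.range := by
    intro b
    have hb : b ∈ algCl (Set.range x) := by
      rw [algCl_range_eq_top hx]; exact IntermediateField.mem_top
    obtain ⟨q, hq0, hq⟩ := mem_algCl.mp hb
    let q' := q.map (algebraMap _ Ω)
    have hq' : q' ≠ 0 :=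
      (Polynomial.map_ne_zero_iff (FaithfulSMul.algebraMap_injective _ Ω)).mpr hq0
    have h1 : (q'.map ψ).map σ = q'.map ψ := by
      ext l
      simp only [q', coeff_map]
      exact hagree _ (q.coeff l).2
    have hqb : q'.eval b = 0 := by rwa [aeval_def, ← eval_map] at hq
    have h2 : (q'.map ψ).eval (σ (ψ b)) = 0 := by
      rw [← h1, Polynomial.eval_map_apply, Polynomial.eval_map_apply, hqb, map_zero, map_zero]
    have h3 : σ (ψ b) ∈ (q'.map ψ).roots := by
      rwa [mem_roots ((Polynomial.map_ne_zero_iff ψ.injective).mpr hq')]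
    rw [(IsAlgClosed.splits q').roots_map ψ, Multiset.mem_map] at h3
    obtain ⟨a, _, ha⟩ := h3
    exact ⟨a, ha⟩
  let ψ' : Ω ≃+* ψ.range := RingEquiv.ofBijective ψ.rangeRestrict
    ⟨fun a b h => ψ.injective (congrArg Subtype.val h), ψ.rangeRestrict_surjective⟩
  refine ⟨ψ'.symm.toRingHom.comp ((σ.comp ψ).codRestrict ψ.range hrange), fun b => ?_⟩
  have := congrArg Subtype.val (ψ'.apply_symm_apply ⟨σ (ψ b), hrange b⟩)
  exact this

variable {ι : Type*} [Fintype ι] {Ω : Type*} [Field Ω] [CharZero Ω] [IsAlgClosed Ω] {e : ι → ℕ}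
  {x : ι → Ω} {i₀ t m : ι}

theorem exists_ringHom_transposition (he : Function.Injective e)
    (h0 : e i₀ = 0) (ht : ∀ i, e i ≤ e t) (hgcd : ∀ d : ℕ, (∀ i, d ∣ e i) → d = 1)
    (hm0 : e m ≠ 0) (hmt : e m < e t) (hx : IsTranscendenceBasis ℚ x) :
    ∃ (σ : Ω →+* Ω) (a b : Ω), (∀ i, σ (x i) = x i) ∧ (sparsePoly e x).eval a = 0 ∧
      (sparsePoly e x).eval b = 0 ∧ a ≠ b ∧ σ a = b ∧ σ b = a ∧
      ∀ r, (sparsePoly e x).eval r = 0 → r ≠ a → r ≠ b → σ r = r := by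
  obtain ⟨Ω', _, _, _, x', σ, a, b, hx', hσx, ha, hb, hab, hσa, hσb, hσ⟩ :=
    exists_field_transposition he h0 ht hgcd hm0 hmt hx.1
  obtain ⟨ψ, hψ⟩ := exists_ringHom_of_isTranscendenceBasis hx hx'
  obtain ⟨τ, hτ⟩ := exists_ringHom_comp_eq hx ψ σ fun i => by rw [hψ, hσx]
  have hmap : sparsePoly e x' = (sparsePoly e x).map ψ := by
    rw [map_sparsePoly]; congr; ext i; exact (hψ i).symm
  have hx0 : sparsePoly e x' ≠ 0 := fun h => by
    have := coeff_sparsePoly_apply he x' i₀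
    rw [h, coeff_zero] at this
    exact hx'.ne_zero i₀ this.symm
  have hlift : ∀ r, (sparsePoly e x').eval r = 0 →
      ∃ a, ψ a = r ∧ (sparsePoly e x).eval a = 0 := by
    intro r hr
    have h3 : r ∈ (sparsePoly e x').roots := by rwa [mem_roots hx0]
    rw [hmap, (IsAlgClosed.splits _).roots_map ψ, Multiset.mem_map] at h3
    obtain ⟨a, ha, rfl⟩ := h3
    exact ⟨a, rfl, isRoot_of_mem_roots ha⟩
  obtain ⟨a, rfl, ha'⟩ := hlift a ha
  obtain ⟨b, rfl, hb'⟩ := hlift b hb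
  refine ⟨τ, a, b, fun i => ψ.injective ?_, ha', hb', fun h => hab (congrArg ψ h),
    ψ.injective ?_, ψ.injective ?_, fun r hr hra hrb => ψ.injective ?_⟩
  · rw [hτ, hψ, hσx]
  · rw [hτ, hσa]
  · rw [hτ, hσb]
  · rw [hτ]
    refine hσ _ ?_ (fun h => hra (ψ.injective h)) (fun h => hrb (ψ.injective h))
    rw [hmap, Polynomial.eval_map_apply, hr, map_zero]

/-- Transpositions generate the symmetric group, and by double transitivity each of them is
conjugate to the one already found. -/
theorem exists_ringHom_perm (he : Function.Injective e)
    (h0 : e i₀ = 0) (ht : ∀ i, e i ≤ e t) (hgcd : ∀ d : ℕ, (∀ i, d ∣ e i) → d = 1)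
    (hm0 : e m ≠ 0) (hmt : e m < e t) (hx : IsTranscendenceBasis ℚ x) {R : Finset Ω}
    (hR : ∀ r, r ∈ R ↔ (sparsePoly e x).eval r = 0) (π : Equiv.Perm R) :
    ∃ σ : Ω →+* Ω, (∀ i, σ (x i) = x i) ∧ ∀ r : R, σ r = π r := by
  classical
  induction π using Equiv.Perm.swap_induction_on with
  | one => exact ⟨RingHom.id Ω, fun _ => rfl, fun _ => rfl⟩
  | swap_mul π a b hab ih =>
    obtain ⟨σ, hσx, hσ⟩ := ih
    obtain ⟨τ, a', b', hτx, ha', hb', hab', hτa, hτb, hτ⟩ :=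
      exists_ringHom_transposition he h0 ht hgcd hm0 hmt hx
    -- ρ carries the pair to be swapped to the pair swapped by τ, so ρ⁻¹τρ acts on the roots as the
    -- desired swap.
    obtain ⟨ρ, hρx, hρa, hρb⟩ := exists_ringEquiv_map_pair he h0 (show e t ≠ 0 by omega) hgcd hx
      ((hR a).mp a.2) ((hR b).mp b.2) (fun h => hab (Subtype.ext h)) ha' hb' hab'
    have hρx' : ∀ i, ρ.symm (x i) = x i := fun i => by rw [RingEquiv.symm_apply_eq, hρx]
    have hswap : ∀ r : R, ρ.symm (τ (ρ r)) = Equiv.swap a b r := by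
      intro r
      rw [RingEquiv.symm_apply_eq]
      rcases eq_or_ne r a with rfl | hra
      · rw [hρa, hτa, Equiv.swap_apply_left, hρb]
      rcases eq_or_ne r b with rfl | hrb
      · rw [hρb, hτb, Equiv.swap_apply_right, hρa]
      rw [Equiv.swap_apply_of_ne_of_ne hra hrb]
      refine hτ _ ?_ (fun h => hra (Subtype.ext (ρ.injective (h.trans hρa.symm))))
        (fun h => hrb (Subtype.ext (ρ.injective (h.trans hρb.symm))))
      have h1 : sparsePoly e x = (sparsePoly e x).map (ρ : Ω →+* Ω) := by
        rw [map_sparsePoly]; congr; ext i; exact (hρx i).symm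
      have h2 := Polynomial.eval_map_apply (p := sparsePoly e x) (ρ : Ω →+* Ω) (r : Ω)
      rw [← h1, (hR r).mp r.2, map_zero] at h2
      exact h2
    refine ⟨(ρ.symm : Ω →+* Ω).comp (τ.comp ((ρ : Ω →+* Ω).comp σ)), fun i => ?_, fun r => ?_⟩
    · simp [hσx, hρx, hτx, hρx']
    · simp [hσ, hswap]

end SymmetricGroup

/-! ### Non-vanishing of the coefficients after inverting some of the roots. -/

section FlipCoefficients

open Polynomial

variable {Ω : Type*} [Field Ω]

/-- The polynomial with roots `r⁻¹`, `r ∈ S`, and `r`, `r ∈ T`. -/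
noncomputable def flipProd (S T : Finset Ω) : Polynomial Ω :=
  (∏ r ∈ S, (1 - C r * X)) * ∏ r ∈ T, (X - C r)

theorem map_flipProd {Ω' : Type*} [Field Ω'] [DecidableEq Ω'] (σ : Ω →+* Ω') (S T : Finset Ω) :
    (flipProd S T).map σ = flipProd (S.image σ) (T.image σ) := by
  rw [flipProd, flipProd, Finset.prod_image fun _ _ _ _ h => σ.injective h,
    Finset.prod_image fun _ _ _ _ h => σ.injective h]
  simp [Polynomial.map_prod]

theorem flipProd_insert_left [DecidableEq Ω] {S : Finset Ω} {a : Ω} (ha : a ∉ S) (T : Finset Ω) :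
    flipProd (insert a S) T = flipProd S T * (1 - C a * X) := by
  rw [flipProd, flipProd, Finset.prod_insert ha]; ring

theorem flipProd_insert_right [DecidableEq Ω] (S : Finset Ω) {T : Finset Ω} {a : Ω} (ha : a ∉ T) :
    flipProd S (insert a T) = flipProd S T * (X - C a) := by
  rw [flipProd, flipProd, Finset.prod_insert ha]; ring

theorem coeff_eq_zero_of_coeff_mul_X_sub_C {V : Polynomial Ω} {a b : Ω} (hab : a ≠ b) {j : ℕ}
    (ha : (V * (X - C a)).coeff j = 0) (hb : (V * (X - C b)).coeff j = 0) :
    V.coeff j = 0 ∧ (1 ≤ j → V.coeff (j - 1) = 0) := by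
  rw [mul_sub, coeff_sub, coeff_mul_C] at ha hb
  have h1 : V.coeff j = 0 := by
    have : V.coeff j * (b - a) = 0 := by linear_combination ha - hb
    exact (mul_eq_zero.mp this).resolve_right (sub_ne_zero.mpr hab.symm)
  refine ⟨h1, fun hj => ?_⟩
  obtain ⟨j, rfl⟩ := Nat.exists_eq_add_of_le' hj
  rwa [h1, coeff_mul_X, zero_mul, sub_zero] at ha

theorem coeff_eq_zero_of_coeff_mul_one_sub {V : Polynomial Ω} {a b : Ω} (hab : a ≠ b) {j : ℕ}
    (ha : (V * (1 - C a * X)).coeff j = 0) (hb : (V * (1 - C b * X)).coeff j = 0) :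
    V.coeff j = 0 ∧ (1 ≤ j → V.coeff (j - 1) = 0) := by
  rw [mul_sub, mul_one, mul_left_comm, coeff_sub, coeff_C_mul] at ha hb
  obtain _ | j := j
  · simpa using ha
  rw [coeff_mul_X] at ha hb
  have h1 : V.coeff j = 0 := by
    have : V.coeff j * (b - a) = 0 := by linear_combination ha - hb
    exact (mul_eq_zero.mp this).resolve_right (sub_ne_zero.mpr hab.symm)
  rw [h1, mul_zero, sub_zero] at ha
  exact ⟨ha, fun _ => h1⟩

theorem exists_pair_notMem {α : Type*} [DecidableEq α] {R U : Finset α} (h : U.card + 2 ≤ R.card) :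
    ∃ a ∈ R, ∃ b ∈ R, a ≠ b ∧ a ∉ U ∧ b ∉ U := by
  have : 1 < (R \ U).card := by
    have := Finset.le_card_sdiff U R
    omega
  obtain ⟨a, ha, b, hb, hab⟩ := Finset.one_lt_card.mp this
  rw [Finset.mem_sdiff] at ha hb
  exact ⟨a, ha.1, b, hb.1, hab, ha.2, hb.2⟩

/-- Comparing two choices of one root removes its factor, and both coefficients `j` and `j - 1` of
what remains vanish. The size condition always leaves two unused roots to compare. Removing all s +
t factors lowers the index by any chosen amount up to s + t. -/
theorem coeff_eq_zero_of_flipProd [DecidableEq Ω] {R : Finset Ω} {W : Polynomial Ω} {s t : ℕ}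
    (hst : s + t + 1 ≤ R.card) {j : ℕ} (h : ∀ S ⊆ R, ∀ T ⊆ R, Disjoint S T → S.card = s →
      T.card = t → (W * flipProd S T).coeff j = 0) {i : ℕ} (hi : i ≤ s + t) (hij : i ≤ j) :
    W.coeff (j - i) = 0 := by
  induction t generalizing i j with
  | succ t ih =>
    have key : ∀ S ⊆ R, ∀ T ⊆ R, Disjoint S T → S.card = s → T.card = t →
        (W * flipProd S T).coeff j = 0 ∧ (1 ≤ j → (W * flipProd S T).coeff (j - 1) = 0) := by
      intro S hS T hT hd hs ht
      have hc : (S ∪ T).card + 2 ≤ R.card := by rw [Finset.card_union_of_disjoint hd]; omega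
      obtain ⟨a, haR, b, hbR, hab, ha, hb⟩ := exists_pair_notMem hc
      rw [Finset.mem_union, not_or] at ha hb
      refine coeff_eq_zero_of_coeff_mul_X_sub_C hab ?_ ?_
      · rw [mul_assoc, ← flipProd_insert_right _ ha.2]
        exact h S hS _ (Finset.insert_subset haR hT)
          (Finset.disjoint_insert_right.mpr ⟨ha.1, hd⟩) hs
          (by rw [Finset.card_insert_of_notMem ha.2, ht])
      · rw [mul_assoc, ← flipProd_insert_right _ hb.2]
        exact h S hS _ (Finset.insert_subset hbR hT)
          (Finset.disjoint_insert_right.mpr ⟨hb.1, hd⟩) hs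
          (by rw [Finset.card_insert_of_notMem hb.2, ht])
    rcases Nat.lt_or_ge (s + t) i with hlt | hle
    · have := ih (by omega) (j := j - 1) (i := i - 1)
        (fun S hS T hT hd hs ht => (key S hS T hT hd hs ht).2 (by omega)) (by omega) (by omega)
      rwa [show j - 1 - (i - 1) = j - i by omega] at this
    · exact ih (by omega) (fun S hS T hT hd hs ht => (key S hS T hT hd hs ht).1) hle hij
  | zero =>
    induction s generalizing i j with
    | zero =>
      obtain rfl : i = 0 := by omega
      simpa [flipProd] using h ∅ (Finset.empty_subset _) ∅ (Finset.empty_subset _)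
        (Finset.disjoint_empty_left _) rfl rfl
    | succ s ih =>
      have key : ∀ S ⊆ R, ∀ T ⊆ R, Disjoint S T → S.card = s → T.card = 0 →
          (W * flipProd S T).coeff j = 0 ∧ (1 ≤ j → (W * flipProd S T).coeff (j - 1) = 0) := by
        intro S hS T hT hd hs ht
        have hc : (S ∪ T).card + 2 ≤ R.card := by rw [Finset.card_union_of_disjoint hd]; omega
        obtain ⟨a, haR, b, hbR, hab, ha, hb⟩ := exists_pair_notMem hc
        rw [Finset.mem_union, not_or] at ha hb
        refine coeff_eq_zero_of_coeff_mul_one_sub hab ?_ ?_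
        · rw [mul_assoc, ← flipProd_insert_left ha.1]
          exact h _ (Finset.insert_subset haR hS) T hT (Finset.disjoint_insert_left.mpr ⟨ha.2, hd⟩)
            (by rw [Finset.card_insert_of_notMem ha.1, hs]) ht
        · rw [mul_assoc, ← flipProd_insert_left hb.1]
          exact h _ (Finset.insert_subset hbR hS) T hT (Finset.disjoint_insert_left.mpr ⟨hb.2, hd⟩)
            (by rw [Finset.card_insert_of_notMem hb.1, hs]) ht
      rcases Nat.lt_or_ge (s + 0) i with hlt | hle
      · have := ih (by omega) (j := j - 1) (i := i - 1)
          (fun S hS T hT hd hs ht => (key S hS T hT hd hs ht).2 (by omega)) (by omega) (by omega)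
        rwa [show j - 1 - (i - 1) = j - i by omega] at this
      · exact ih (by omega) (fun S hS T hT hd hs ht => (key S hS T hT hd hs ht).1) hle hij

theorem exists_perm_image_eq {α : Type*} [DecidableEq α] {R S S' : Finset α} (hS : S ⊆ R)
    (hS' : S' ⊆ R)
    (h : S.card = S'.card) : ∃ π : Equiv.Perm R, ∀ r : R, (π r : α) ∈ S' ↔ (r : α) ∈ S := by
  have h1 : ∀ S ⊆ R, Fintype.card {r : R // (r : α) ∈ S} = S.card := fun S hS => by
    rw [← Fintype.card_coe]
    exact Fintype.card_congr ⟨fun r => ⟨r.1, r.2⟩, fun r => ⟨⟨r.1, hS r.2⟩, r.2⟩,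
      fun _ => rfl, fun _ => rfl⟩
  let e : {r : R // (r : α) ∈ S} ≃ {r : R // (r : α) ∈ S'} :=
    Fintype.equivOfCardEq (by rw [h1 S hS, h1 S' hS', h])
  exact ⟨e.extendSubtype, fun r => ⟨fun hr => by
    by_contra hn
    exact e.extendSubtype_not_mem r hn hr, fun hr => e.extendSubtype_mem r hr⟩⟩

/-- By symmetry a zero coefficient for one `S` is zero for every set of that size. Repeated
differences strip off all linear factors and leave a coefficient of 1 - X² that would have to
vanish. -/
theorem coeff_flipProd_ne_zero [DecidableEq Ω] {R : Finset Ω}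
    (hR : ∀ π : Equiv.Perm R, ∃ σ : Ω →+* Ω, ∀ r : R, σ r = π r) (hcard : 3 ≤ R.card)
    {S : Finset Ω} (hS : S ⊂ R) (hne : S.Nonempty) {j : ℕ} (hj : j ≤ R.card) :
    (flipProd S (R \ S)).coeff j ≠ 0 := by
  intro h0
  have hall : ∀ S' ⊆ R, S'.card = S.card → (flipProd S' (R \ S')).coeff j = 0 := by
    intro S' hS' hc
    obtain ⟨π, hπ⟩ := exists_perm_image_eq hS.1 hS' hc.symm
    obtain ⟨σ, hσ⟩ := hR π
    have hmap := congrArg (fun p => coeff p j) (map_flipProd σ S (R \ S))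
    simp only [coeff_map, h0, map_zero] at hmap
    have h1 : S.image σ = S' := by
      ext r
      rw [Finset.mem_image]
      constructor
      · rintro ⟨a, ha, rfl⟩
        have := (hπ ⟨a, hS.1 ha⟩).mpr ha
        rwa [← hσ] at this
      · intro hr
        have h2 := hσ (π.symm ⟨r, hS' hr⟩)
        rw [Equiv.apply_symm_apply] at h2
        refine ⟨_, (hπ (π.symm ⟨r, hS' hr⟩)).mp ?_, h2⟩
        rwa [Equiv.apply_symm_apply]
    have h2 : R.image σ = R := by
      refine Finset.eq_of_subset_of_card_le (fun r hr => ?_) ?_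
      · obtain ⟨a, ha, rfl⟩ := Finset.mem_image.mp hr
        rw [hσ ⟨a, ha⟩]
        exact (π _).2
      · rw [Finset.card_image_of_injective _ σ.injective]
    rwa [Finset.image_sdiff_of_injOn (f := σ) σ.injective.injOn hS.1, h1, h2, eq_comm] at hmap
  have hsc : 1 ≤ S.card := hne.card_pos
  have hsr : S.card < R.card := Finset.card_lt_card hS
  -- `A` and `B` omit exactly two roots a, b. Exchanging their roles changes the product by (1 -
  -- aX)(X - b) - (1 - bX)(X - a) = (a - b)(1 - X²).
  have hZ : ∀ A ⊆ R, ∀ B ⊆ R, Disjoint A B → A.card = S.card - 1 → B.card = R.card - S.card - 1 →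
      ((1 - X ^ 2 : Polynomial Ω) * flipProd A B).coeff j = 0 := by
    intro A hA B hB hd hAc hBc
    have hc : (A ∪ B).card + 2 ≤ R.card := by rw [Finset.card_union_of_disjoint hd]; omega
    obtain ⟨a, haR, b, hbR, hab, ha, hb⟩ := exists_pair_notMem hc
    have hUc : (A ∪ B).card = R.card - 2 := by rw [Finset.card_union_of_disjoint hd]; omega
    rw [Finset.mem_union, not_or] at ha hb
    have hcompl : ∀ {a b : Ω}, a ∈ R → b ∈ R → a ≠ b → a ∉ A → a ∉ B → b ∉ A → b ∉ B →
        (flipProd A B * (1 - C a * X) * (X - C b)).coeff j = 0 := by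
      intro a b haR hbR hab haA haB hbA hbB
      rw [← flipProd_insert_left haA, ← flipProd_insert_right _ hbB]
      have hsub : insert a A ⊆ R := Finset.insert_subset haR hA
      have hBe : insert b B = R \ insert a A := by
        refine Finset.eq_of_subset_of_card_le (fun r hr => ?_) ?_
        · rw [Finset.mem_sdiff, Finset.mem_insert, not_or]
          rcases Finset.mem_insert.mp hr with rfl | hr
          · exact ⟨hbR, hab.symm, hbA⟩
          · exact ⟨hB hr, fun h => haB (h ▸ hr), Finset.disjoint_right.mp hd hr⟩
        · rw [Finset.card_sdiff_of_subset hsub, Finset.card_insert_of_notMem haA,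
            Finset.card_insert_of_notMem hbB]
          omega
      rw [hBe]
      exact hall _ hsub (by rw [Finset.card_insert_of_notMem haA]; omega)
    have h1 := hcompl haR hbR hab ha.1 ha.2 hb.1 hb.2
    have h2 := hcompl hbR haR hab.symm hb.1 hb.2 ha.1 ha.2
    have h3 : C (a - b) * ((1 - X ^ 2 : Polynomial Ω) * flipProd A B) =
        flipProd A B * (1 - C a * X) * (X - C b) - flipProd A B * (1 - C b * X) * (X - C a) := by
      rw [C_sub]; ring
    have h4 := congrArg (fun p => coeff p j) h3
    simp only [coeff_sub, h1, h2, sub_zero, coeff_C_mul] at h4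
    exact (mul_eq_zero.mp h4).resolve_left (sub_ne_zero.mpr hab)
  -- The index can be lowered by at most `R.card - 2`. The target is coefficient 0 or 2, since the
  -- coefficient of 1 - X² at 1 is zero.
  rcases le_or_gt j (R.card - 2) with hle | hgt
  · have := coeff_eq_zero_of_flipProd (by omega) hZ (i := j) (by omega) le_rfl
    simp at this
  · have := coeff_eq_zero_of_flipProd (by omega) hZ (i := j - 2) (by omega) (by omega)
    rw [show j - (j - 2) = 2 by omega] at this
    simp [coeff_one] at this

end FlipCoefficients

/-! ### Transfer to an arbitrary algebraically closed field, and absence of inverse pairs of roots.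
-/

section Flips

open Polynomial

universe u

/-- A model field in which the generic coefficients are a whole transcendence basis, as the symmetry
argument needs; they are not one in ℂ. -/
theorem exists_isTranscendenceBasis_isAlgClosed (ι : Type u) :
    ∃ (Ω : Type u) (_ : Field Ω) (_ : CharZero Ω) (_ : IsAlgClosed Ω) (x : ι → Ω),
      IsTranscendenceBasis ℚ x := by
  let K := FractionRing (MvPolynomial ι ℚ)
  have : Algebra.IsAlgebraic (MvPolynomial ι ℚ) K :=
    IsLocalization.isAlgebraic _ (nonZeroDivisors (MvPolynomial ι ℚ))
  have : CharZero (AlgebraicClosure K) :=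
    charZero_of_injective_ringHom (algebraMap K (AlgebraicClosure K)).injective
  exact ⟨AlgebraicClosure K, inferInstance, inferInstance, inferInstance, _,
    ((IsTranscendenceBasis.mvPolynomial ι ℚ).algebraMap_comp (A := K)).algebraMap_comp⟩

variable {ι : Type*} [Fintype ι] {Ω : Type*} [Field Ω] [CharZero Ω] {e : ι → ℕ}
  {x : ι → Ω} {i₀ t m : ι}

theorem coeff_flipProd_roots_ne_zero [IsAlgClosed Ω] [DecidableEq Ω] (he : Function.Injective e)
    (h0 : e i₀ = 0) (ht : ∀ i, e i ≤ e t) (hgcd : ∀ d : ℕ, (∀ i, d ∣ e i) → d = 1)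
    (hm0 : e m ≠ 0) (hmt : e m < e t) (h3 : 3 ≤ e t) (hx : AlgebraicIndependent ℚ x) {S : Finset Ω}
    (hS : S ⊂ (sparsePoly e x).roots.toFinset) (hne : S.Nonempty) {j : ℕ} (hj : j ≤ e t) :
    (flipProd S ((sparsePoly e x).roots.toFinset \ S)).coeff j ≠ 0 := by
  classical
  obtain ⟨Ω₀, _, _, _, y, hy⟩ := exists_isTranscendenceBasis_isAlgClosed ι
  obtain ⟨ψ, hψ⟩ := exists_ringHom_of_isTranscendenceBasis hy hx
  have hmap : sparsePoly e x = (sparsePoly e y).map ψ := by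
    rw [map_sparsePoly]; congr; ext i; exact (hψ i).symm
  have hy0 : sparsePoly e y ≠ 0 := fun h => by
    have := coeff_sparsePoly_apply he y i₀
    rw [h, coeff_zero] at this
    exact hy.1.ne_zero i₀ this.symm
  have hroots : (sparsePoly e x).roots.toFinset = (sparsePoly e y).roots.toFinset.image ψ := by
    rw [hmap, (IsAlgClosed.splits _).roots_map ψ, Finset.image_toFinset]
  have hcard : (sparsePoly e y).roots.toFinset.card = e t := by
    rw [card_toFinset_roots hy0 fun a ha =>
      derivative_sparsePoly_eval_ne_zero he h0 hy.1 (by omega : e t ≠ 0) ha,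
      natDegree_sparsePoly he (hy.1.ne_zero t) ht]
  rw [hroots] at hS ⊢
  obtain ⟨S, hS', rfl⟩ := Finset.subset_image_iff.mp hS.1
  rw [← Finset.image_sdiff_of_injOn (f := ψ) ψ.injective.injOn (by exact_mod_cast hS'),
    ← map_flipProd, coeff_map]
  refine (map_ne_zero ψ).mpr (coeff_flipProd_ne_zero (fun π => ?_) (by omega) ⟨hS', ?_⟩
    (Finset.image_nonempty.mp hne) (by omega))
  · obtain ⟨σ, _, hσ⟩ := exists_ringHom_perm he h0 ht hgcd hm0 hmt hy
      (fun r => by rw [Multiset.mem_toFinset, mem_roots hy0, IsRoot.def]) π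
    exact ⟨σ, hσ⟩
  · exact fun h => hS.2 (Finset.image_subset_image h)

/-- Distinct roots are algebraically independent after a trade. A root with square 1 is ±1, which
would be a rational linear relation between the coefficients. -/
theorem mul_ne_one_of_roots (he : Function.Injective e)
    (h0 : e i₀ = 0) (hgcd : ∀ d : ℕ, (∀ i, d ∣ e i) → d = 1) (hm0 : e m ≠ 0)
    (hx : AlgebraicIndependent ℚ x) {a b : Ω} (ha : (sparsePoly e x).eval a = 0)
    (hb : (sparsePoly e x).eval b = 0) : a * b ≠ 1 := by
  classical
  intro h
  have ha0 := root_sparsePoly_ne_zero he h0 hx ha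
  by_cases hab : a = b
  · subst hab
    have ha1 : a ∈ algCl (x '' {i₀}ᶜ) := by
      rcases mul_self_eq_one_iff.mp h with rfl | rfl
      · exact one_mem _
      · exact neg_mem (one_mem _)
    refine notMem_algCl_of_algebraicIndependent hx i₀ ?_
    rw [eval_sparsePoly] at ha
    exact mem_of_sum_mul_eq_zero ha (fun j hj => mul_mem (pow_mem ha1 _)
      (subset_algCl _ ⟨j, hj, rfl⟩)) (pow_mem ha1 _) (pow_ne_zero _ ha0)
  · have hmi : m ≠ i₀ := fun h => hm0 (h ▸ h0)
    have hy := (card_le_of_forall_mem_algCl hx (forall_mem_algCl_update_pair h0 hmi ha0 ha hb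
      (pow_ne_pow_of_roots he h0 hgcd hx ha hb hab hm0))).2 le_rfl
    refine notMem_algCl_of_algebraicIndependent hy m ?_
    rw [Function.update_self, eq_inv_of_mul_eq_one_right h]
    refine inv_mem (subset_algCl _ ⟨i₀, hmi.symm, ?_⟩)
    rw [Function.update_of_ne hmi.symm, Function.update_self]

end Flips

/-! ### Polynomials with the same product with their reverse. -/

section Reverse

open Polynomial

variable {R : Type*} [Field R]

theorem natDegree_reverse_of_coeff_zero_ne_zero {p : Polynomial R} (hp : p.coeff 0 ≠ 0) :
    p.reverse.natDegree = p.natDegree := by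
  rw [reverse_natDegree, natTrailingDegree_eq_zero.mpr (Or.inr hp), Nat.sub_zero]

theorem reverse_reverse_of_coeff_zero_ne_zero {p : Polynomial R} (hp : p.coeff 0 ≠ 0) :
    p.reverse.reverse = p := by
  rw [reverse, natDegree_reverse_of_coeff_zero_ne_zero hp, reverse, reflect_reflect]

theorem eval_reverse_eq_zero_iff (p : Polynomial R) {r : R} (hr : r ≠ 0) :
    p.reverse.eval r = 0 ↔ p.eval r⁻¹ = 0 := by
  let := invertibleOfNonzero (inv_ne_zero hr)
  have := eval₂_reverse_eq_zero_iff (RingHom.id R) r⁻¹ p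
  rwa [invOf_eq_inv, inv_inv] at this

theorem natDegree_eq_of_mul_reverse_eq {p q : Polynomial R} (hp : p.coeff 0 ≠ 0)
    (hq : q.coeff 0 ≠ 0) (h : p * p.reverse = q * q.reverse) : q.natDegree = p.natDegree := by
  have hp0 : p ≠ 0 := fun h => hp (by simp [h])
  have hq0 : q ≠ 0 := fun h => hq (by simp [h])
  have := congrArg natDegree h
  rw [natDegree_mul hp0 (by simpa using hp0), natDegree_mul hq0 (by simpa using hq0),
    natDegree_reverse_of_coeff_zero_ne_zero hp, natDegree_reverse_of_coeff_zero_ne_zero hq] at this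
  omega

theorem eq_or_eq_neg_of_mul_reverse_eq {p q : Polynomial R} (hp : p ≠ 0) {c : R} (hq : q = C c * p)
    (h : p * p.reverse = q * q.reverse) : q = p ∨ q = -p := by
  subst hq
  have h1 : p * p.reverse ≠ 0 := mul_ne_zero hp (by simpa using hp)
  have h2 : C (c * c) * (p * p.reverse) = 1 * (p * p.reverse) := by
    rw [reverse_mul_of_domain, reverse_C] at h
    rw [C_mul]
    linear_combination -h
  have h3 := mul_right_cancel₀ h1 h2
  rw [← C_1, C_inj] at h3
  rcases mul_self_eq_one_iff.mp h3 with rfl | rfl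
  · left; simp
  · right; simp

theorem eq_C_mul_prod_of_injOn [IsAlgClosed R] {q : Polynomial R} (hq : q ≠ 0) {U : Finset R}
    {ρ : R → R} (hρ : Set.InjOn ρ U) (hroot : ∀ r ∈ U, q.eval (ρ r) = 0)
    (hcard : U.card = q.natDegree) : q = C q.leadingCoeff * ∏ r ∈ U, (X - C (ρ r)) := by
  classical
  have h1 : q.roots = (U.image ρ).val := by
    symm
    refine Multiset.eq_of_le_of_card_le ?_ ?_
    · rw [Finset.val_le_iff_val_subset]
      intro a ha
      obtain ⟨r, hr, rfl⟩ := Finset.mem_image.mp ha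
      exact (mem_roots hq).mpr (hroot r hr)
    · rw [Finset.card_val, Finset.card_image_of_injOn hρ, hcard]
      exact card_roots' q
  conv_lhs => rw [(IsAlgClosed.splits q).eq_prod_roots, h1]
  rw [← Finset.prod_image (g := ρ) hρ (f := fun a => X - C a)]
  rfl

/-- Each root of `p` is a root of `q` or of `q.reverse`. Inverting those of the second kind gives
distinct roots of `q`, because no two roots of `p` are mutually inverse, and their number is the
degree of `q`. -/
theorem eq_C_mul_flipProd [IsAlgClosed R] [DecidableEq R] {p q : Polynomial R} (hp : p.coeff 0 ≠ 0)
    (hq : q.coeff 0 ≠ 0) (hs : p.roots.toFinset.card = p.natDegree)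
    (hr : ∀ a b, p.eval a = 0 → p.eval b = 0 → a * b ≠ 1) (h : p * p.reverse = q * q.reverse) :
    ∃ S ⊆ p.roots.toFinset, (∀ r ∈ S, q.reverse.eval r = 0) ∧
      (∀ r ∈ p.roots.toFinset, r ∉ S → q.eval r = 0) ∧
      ∃ c : R, c ≠ 0 ∧ q = C c * flipProd S (p.roots.toFinset \ S) := by
  have hp0 : p ≠ 0 := fun h => hp (by simp [h])
  have hq0 : q ≠ 0 := fun h => hq (by simp [h])
  set U := p.roots.toFinset with hU
  have hmem : ∀ r, r ∈ U ↔ p.eval r = 0 := fun r => by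
    rw [hU, Multiset.mem_toFinset, mem_roots hp0, IsRoot.def]
  have hne : ∀ r ∈ U, r ≠ 0 := by
    rintro r hr rfl
    rw [hmem, ← coeff_zero_eq_eval_zero] at hr
    exact hp hr
  let S := U.filter fun r => q.eval r ≠ 0
  have hSU : S ⊆ U := Finset.filter_subset _ _
  have hSq : ∀ r ∈ S, q.reverse.eval r = 0 := by
    intro r hr
    obtain ⟨hr, hqr⟩ := Finset.mem_filter.mp hr
    have := congrArg (eval r) h
    rw [eval_mul, eval_mul, (hmem r).mp hr, zero_mul, eq_comm, mul_eq_zero] at this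
    exact this.resolve_left hqr
  have hTq : ∀ r ∈ U, r ∉ S → q.eval r = 0 := fun r hr hrS => by
    by_contra hn
    exact hrS (Finset.mem_filter.mpr ⟨hr, hn⟩)
  let ρ : R → R := fun r => if r ∈ S then r⁻¹ else r
  have hρ : Set.InjOn ρ U := by
    intro a ha b hb hab
    simp only [ρ] at hab
    have hanb := hr a b ((hmem a).mp ha) ((hmem b).mp hb)
    split_ifs at hab
    · exact inv_injective hab
    · rw [← hab, mul_inv_cancel₀ (hne a ha)] at hanb; exact absurd rfl hanb
    · rw [hab, inv_mul_cancel₀ (hne b hb)] at hanb; exact absurd rfl hanb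
    · exact hab
  have hroot : ∀ r ∈ U, q.eval (ρ r) = 0 := by
    intro r hr
    by_cases hrS : r ∈ S
    · simp only [ρ, if_pos hrS]
      exact (eval_reverse_eq_zero_iff q (hne r hr)).mp (hSq r hrS)
    · simp only [ρ, if_neg hrS]
      exact hTq r hr hrS
  have hq1 := eq_C_mul_prod_of_injOn hq0 hρ hroot
    (by rw [hs, natDegree_eq_of_mul_reverse_eq hp hq h])
  -- The scalar comes from X - r⁻¹ = -r⁻¹ (1 - rX).
  refine ⟨S, hSU, hSq, hTq, q.leadingCoeff * ∏ r ∈ S, (-r⁻¹), mul_ne_zero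
    (leadingCoeff_ne_zero.mpr hq0) (Finset.prod_ne_zero_iff.mpr fun r hr =>
      neg_ne_zero.mpr (inv_ne_zero (hne r (hSU hr)))), ?_⟩
  conv_lhs => rw [hq1]
  rw [C_mul, mul_assoc, flipProd, ← mul_assoc (C (∏ r ∈ S, (-r⁻¹))), map_prod,
    ← Finset.prod_mul_distrib, ← Finset.prod_sdiff hSU, mul_comm (∏ r ∈ U \ S, (X - C (ρ r)))]
  congr 2
  · refine Finset.prod_congr rfl fun r hr => ?_
    have h1 : (C r⁻¹ : Polynomial R) * C r = 1 := by
      rw [← C_mul, inv_mul_cancel₀ (hne r (hSU hr)), C_1]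
    simp only [ρ, if_pos hr, C_neg]
    linear_combination (-X) * h1
  · refine Finset.prod_congr rfl fun r hr => ?_
    simp only [ρ, if_neg (Finset.mem_sdiff.mp hr).2]

theorem eq_or_eq_neg_of_roots [IsAlgClosed R] [DecidableEq R] {p q : Polynomial R}
    (hp : p.coeff 0 ≠ 0) (hq : q.coeff 0 ≠ 0) (hs : p.roots.toFinset.card = p.natDegree)
    (hroot : ∀ r ∈ p.roots.toFinset, q.eval r = 0) (h : p * p.reverse = q * q.reverse) :
    q = p ∨ q = -p := by
  have hp0 : p ≠ 0 := fun h => hp (by simp [h])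
  have hq0 : q ≠ 0 := fun h => hq (by simp [h])
  have h1 := eq_C_mul_prod_of_injOn (ρ := id) hp0 (Set.injOn_id _)
    (fun r hr => isRoot_of_mem_roots (Multiset.mem_toFinset.mp hr)) hs
  have h2 := eq_C_mul_prod_of_injOn (ρ := id) hq0 (Set.injOn_id _) hroot
    (by rw [hs, natDegree_eq_of_mul_reverse_eq hp hq h])
  refine eq_or_eq_neg_of_mul_reverse_eq hp0 (c := q.leadingCoeff * p.leadingCoeff⁻¹) ?_ h
  have h3 : (C p.leadingCoeff⁻¹ : Polynomial R) * C p.leadingCoeff = 1 := by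
    rw [← C_mul, inv_mul_cancel₀ (leadingCoeff_ne_zero.mpr hp0), C_1]
  rw [C_mul]
  linear_combination h2 - C q.leadingCoeff * C p.leadingCoeff⁻¹ * h1 -
    C q.leadingCoeff * (∏ r ∈ p.roots.toFinset, (X - C (id r))) * h3

end Reverse

/-! ### The dichotomy for generic polynomials: trivial solution or full support. -/

section Recovery

open Polynomial

variable {ι : Type*} [Fintype ι] {Ω : Type*} [Field Ω] [CharZero Ω] {e : ι → ℕ}
  {x : ι → Ω} {i₀ t m : ι}

theorem eq_or_coeff_ne_zero_of_mul_reverse_eq [IsAlgClosed Ω] (he : Function.Injective e)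
    (h0 : e i₀ = 0) (ht : ∀ i, e i ≤ e t) (hgcd : ∀ d : ℕ, (∀ i, d ∣ e i) → d = 1)
    (hm0 : e m ≠ 0) (hmt : e m < e t) (h3 : 3 ≤ e t) (hx : AlgebraicIndependent ℚ x)
    {q : Polynomial Ω} (hq : q.coeff 0 ≠ 0)
    (h : sparsePoly e x * (sparsePoly e x).reverse = q * q.reverse) :
    q = sparsePoly e x ∨ q = -sparsePoly e x ∨ q = (sparsePoly e x).reverse ∨
      q = -(sparsePoly e x).reverse ∨ ∀ j ≤ e t, q.coeff j ≠ 0 := by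
  classical
  set p := sparsePoly e x with hp
  have hp0 : p.coeff 0 ≠ 0 := by
    rw [← h0, hp, coeff_sparsePoly_apply he]; exact hx.ne_zero i₀
  have hpz : p ≠ 0 := fun h => hp0 (by simp [h])
  have hs : p.roots.toFinset.card = p.natDegree := card_toFinset_roots hpz fun a ha =>
      derivative_sparsePoly_eval_ne_zero he h0 hx (by omega : e t ≠ 0) ha
  obtain ⟨S, hSU, hSq, hTq, c, hc, hqc⟩ := eq_C_mul_flipProd hp0 hq hs
    (fun a b ha hb => mul_ne_one_of_roots he h0 hgcd hm0 hx ha hb) h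
  rcases S.eq_empty_or_nonempty with rfl | hne
  · rcases eq_or_eq_neg_of_roots hp0 hq hs (fun r hr => hTq r hr (by simp)) h with h | h <;>
      simp [h]
  by_cases hSe : S = p.roots.toFinset
  · subst hSe
    have hq1 : q.reverse.coeff 0 ≠ 0 := by
      rw [coeff_zero_reverse]
      exact leadingCoeff_ne_zero.mpr fun h => hq (by simp [h])
    have h2 := eq_or_eq_neg_of_roots hp0 hq1 hs hSq (by
      rw [reverse_reverse_of_coeff_zero_ne_zero hq, h, mul_comm])
    rw [← reverse_reverse_of_coeff_zero_ne_zero hq]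
    rcases h2 with h | h
    · simp [h]
    · simp [h, reverse_neg]
  · refine Or.inr (Or.inr (Or.inr (Or.inr fun j hj => ?_)))
    rw [hqc, coeff_C_mul]
    exact mul_ne_zero hc (coeff_flipProd_roots_ne_zero he h0 ht hgcd hm0 hmt h3 hx
      (hSU.ssubset_of_ne hSe) hne hj)

end Recovery

/-! ### Signals as Laurent polynomials, and equivalence in terms of polynomials. -/

section LaurentPolynomials

open LaurentPolynomial

/-- The `z`-transform of a signal. -/
noncomputable def laurent (f : Signal) : LaurentPolynomial ℝ := .ofCoeff f

theorem coeff_laurent (f : Signal) (i : ℤ) : (laurent f).coeff i = f i := rfl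

theorem laurent_injective : Function.Injective laurent := AddMonoidAlgebra.ofCoeff_injective

theorem coeff_mul_T (L : LaurentPolynomial ℝ) (a i : ℤ) : (L * T a).coeff i = L.coeff (i - a) := by
  rw [T, AddMonoidAlgebra.coeff_mul_single_apply, mul_one, sub_eq_add_neg]

theorem coeff_mul_invert_laurent (f : Signal) (i : ℤ) :
    (laurent f * invert (laurent f)).coeff (-i) = autocorr f i := by
  rw [AddMonoidAlgebra.coeff_mul_apply_left, autocorr]
  refine Finsupp.sum_congr fun j _ => ?_
  rw [invert_apply, coeff_laurent, coeff_laurent]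
  congr 2
  ring

theorem autocorr_eq_iff {f g : Signal} : autocorr f = autocorr g ↔
    laurent f * invert (laurent f) = laurent g * invert (laurent g) := by
  constructor
  · intro h
    ext i
    rw [← neg_neg i, coeff_mul_invert_laurent, coeff_mul_invert_laurent, h]
  · intro h
    ext i
    rw [← coeff_mul_invert_laurent, h, coeff_mul_invert_laurent]

theorem coeff_toLaurent_natCast (P : Polynomial ℝ) (n : ℕ) :
    (Polynomial.toLaurent P).coeff (n : ℤ) = P.coeff n := by
  rw [LaurentPolynomial.coeff_toLaurent]
  exact Finsupp.mapDomain_apply Nat.castEmbedding.injective _ _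

theorem coeff_toLaurent_of_neg (P : Polynomial ℝ) {i : ℤ} (hi : i < 0) :
    (Polynomial.toLaurent P).coeff i = 0 := by
  rw [LaurentPolynomial.coeff_toLaurent]
  refine Finsupp.mapDomain_of_notMem_range _ _ ?_
  rintro ⟨n, hn⟩
  have : (n : ℤ) = i := hn
  omega

theorem exists_laurent_eq {f : Signal} (hf : f ≠ 0) : ∃ (P : Polynomial ℝ) (a : ℤ),
    P.coeff 0 ≠ 0 ∧ laurent f = Polynomial.toLaurent P * T a := by
  obtain ⟨n, P', hP'⟩ := exists_T_pow (laurent f)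
  have hP0 : P' ≠ 0 := by
    rintro rfl
    rw [map_zero, eq_comm, (isUnit_T _).mul_left_eq_zero] at hP'
    exact hf (laurent_injective (by rw [hP']; rfl))
  obtain ⟨P, hP, hdvd⟩ := Polynomial.exists_eq_pow_rootMultiplicity_mul_and_not_dvd P' hP0 0
  rw [Polynomial.C_0, sub_zero] at hP hdvd
  rw [Polynomial.X_dvd_iff] at hdvd
  refine ⟨P, P'.rootMultiplicity 0 - n, hdvd, ?_⟩
  have h1 : laurent f = Polynomial.toLaurent P' * T (-n) := by
    rw [hP', mul_T_assoc, add_neg_cancel, T_zero, mul_one]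
  rw [h1]
  conv_lhs => rw [hP, map_mul, Polynomial.toLaurent_X_pow, T_mul, mul_T_assoc]
  rfl

variable {f g : Signal} {P Q : Polynomial ℝ} {a b : ℤ}

theorem apply_add_of_laurent_eq (h : laurent f = Polynomial.toLaurent P * T a) (n : ℕ) :
    f (a + n) = P.coeff n := by
  rw [← coeff_laurent, h, coeff_mul_T, ← coeff_toLaurent_natCast]
  congr 1
  ring

theorem support_of_laurent_eq (h : laurent f = Polynomial.toLaurent P * T a) :
    f.support = P.support.image fun n : ℕ => a + (n : ℤ) := by
  ext i
  rw [Finset.mem_image, Finsupp.mem_support_iff]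
  constructor
  · intro hi
    rw [← coeff_laurent, h, coeff_mul_T] at hi
    have h1 : 0 ≤ i - a := by
      by_contra! hn
      exact hi (coeff_toLaurent_of_neg P hn)
    obtain ⟨n, hn⟩ := Int.eq_ofNat_of_zero_le h1
    rw [hn, coeff_toLaurent_natCast] at hi
    exact ⟨n, Polynomial.mem_support_iff.mpr hi, by omega⟩
  · rintro ⟨n, hn, rfl⟩
    rw [apply_add_of_laurent_eq h]
    exact Polynomial.mem_support_iff.mp hn

theorem laurent_mul_invert_of_eq (h : laurent f = Polynomial.toLaurent P * T a) :
    laurent f * invert (laurent f) * T P.natDegree = Polynomial.toLaurent (P * P.reverse) := by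
  rw [h, map_mul, map_mul, invert_T, toLaurent_reverse]
  have : (T a * T (-a) : LaurentPolynomial ℝ) = 1 := by rw [← T_add, add_neg_cancel, T_zero]
  linear_combination (Polynomial.toLaurent P * invert (Polynomial.toLaurent P) *
    T P.natDegree) * this

theorem autocorr_eq_iff_mul_reverse_eq (hf : laurent f = Polynomial.toLaurent P * T a)
    (hg : laurent g = Polynomial.toLaurent Q * T b) (hP : P.coeff 0 ≠ 0) (hQ : Q.coeff 0 ≠ 0) :
    autocorr f = autocorr g ↔ P * P.reverse = Q * Q.reverse := by
  have hf' := laurent_mul_invert_of_eq hf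
  have hg' := laurent_mul_invert_of_eq hg
  rw [autocorr_eq_iff]
  constructor
  · intro h
    have h1 : P * P.reverse * Polynomial.X ^ Q.natDegree =
        Q * Q.reverse * Polynomial.X ^ P.natDegree := by
      apply Polynomial.toLaurent_injective
      rw [map_mul Polynomial.toLaurent (P * _), map_mul Polynomial.toLaurent (Q * _), ← hf',
        ← hg', h, Polynomial.toLaurent_X_pow, Polynomial.toLaurent_X_pow]
      exact mul_right_comm _ _ _
    have h0 : ∀ {P : Polynomial ℝ}, P.coeff 0 ≠ 0 → (P * P.reverse).coeff 0 ≠ 0 := by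
      intro P hP
      rw [Polynomial.mul_coeff_zero, Polynomial.coeff_zero_reverse]
      exact mul_ne_zero hP (Polynomial.leadingCoeff_ne_zero.mpr fun h => hP (by simp [h]))
    -- Both products have non-zero constant term, so the lowest powers of X on the two sides
    -- determine the degrees.
    have h2 : P.natDegree = Q.natDegree := by
      have key : ∀ {P Q : Polynomial ℝ}, P.coeff 0 ≠ 0 →
          P * P.reverse * Polynomial.X ^ Q.natDegree = Q * Q.reverse * Polynomial.X ^ P.natDegree →
          P.natDegree ≤ Q.natDegree := by
        intro P Q hP h
        by_contra! hlt
        have := congrArg (fun p => Polynomial.coeff p Q.natDegree) h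
        simp only [Polynomial.coeff_mul_X_pow', le_refl, if_true, Nat.sub_self,
          if_neg (not_le.mpr hlt)] at this
        exact h0 hP this
      exact le_antisymm (key hP h1) (key hQ h1.symm)
    rw [h2] at h1
    exact mul_right_cancel₀ (pow_ne_zero _ Polynomial.X_ne_zero) h1
  · intro h
    have hd := natDegree_eq_of_mul_reverse_eq hP hQ h
    rw [h, ← hg', hd] at hf'
    exact (isUnit_T _).mul_left_injective hf'

theorem triviallyEquivalent_iff : TriviallyEquivalent f g ↔
    ∃ (ε : ℝ) (c : ℤ), (ε = 1 ∨ ε = -1) ∧ (laurent g = C ε * laurent f * T c ∨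
      laurent g = C ε * invert (laurent f) * T c) := by
  have h1 : ∀ (L : LaurentPolynomial ℝ) (ε : ℝ) (c i : ℤ),
      (C ε * L * T c).coeff i = ε * L.coeff (i - c) := by
    intro L ε c i
    rw [coeff_mul_T, ← smul_eq_C_mul]
    rfl
  constructor
  · rintro ⟨ε, c, hε, h | h⟩
    · refine ⟨ε, -c, ?_, Or.inl ?_⟩
      · rcases hε with rfl | rfl <;> simp
      · ext i
        rw [h1, coeff_laurent, coeff_laurent, h, sub_neg_eq_add]
    · refine ⟨ε, c, ?_, Or.inr ?_⟩
      · rcases hε with rfl | rfl <;> simp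
      · ext i
        rw [h1, invert_apply, coeff_laurent, coeff_laurent, h, neg_sub]
  · rintro ⟨ε, c, hε, h⟩
    have hε' : ∃ δ : ℤ, (δ = 1 ∨ δ = -1) ∧ ε = δ := by
      rcases hε with rfl | rfl
      · exact ⟨1, by simp⟩
      · exact ⟨-1, by simp⟩
    obtain ⟨δ, hδ, rfl⟩ := hε'
    rcases h with h | h
    · refine ⟨δ, -c, hδ, Or.inl fun j => ?_⟩
      rw [← coeff_laurent g, h, h1, coeff_laurent, sub_eq_add_neg]
    · refine ⟨δ, c, hδ, Or.inr fun j => ?_⟩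
      rw [← coeff_laurent g, h, h1, invert_apply, coeff_laurent, neg_sub]

theorem triviallyEquivalent_of_eq (hf : laurent f = Polynomial.toLaurent P * T a)
    (hg : laurent g = Polynomial.toLaurent Q * T b)
    (h : Q = P ∨ Q = -P ∨ Q = P.reverse ∨ Q = -P.reverse) : TriviallyEquivalent f g := by
  rw [triviallyEquivalent_iff, hf, hg]
  rcases h with rfl | rfl | rfl | rfl
  · exact ⟨1, b - a, by simp, Or.inl (by rw [map_one, one_mul, mul_T_assoc, add_sub_cancel])⟩
  · exact ⟨-1, b - a, by simp, Or.inl (by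
      rw [map_neg, map_neg, map_one, neg_one_mul, neg_mul, neg_mul, mul_T_assoc, add_sub_cancel])⟩
  · refine ⟨1, P.natDegree + b + a, by simp, Or.inr ?_⟩
    rw [toLaurent_reverse, map_mul, invert_T, map_one, one_mul, mul_T_assoc, mul_T_assoc]
    congr 2; ring
  · refine ⟨-1, P.natDegree + b + a, by simp, Or.inr ?_⟩
    rw [map_neg, toLaurent_reverse, map_mul, invert_T, map_neg, map_one, ← mul_assoc, mul_T_assoc,
      neg_mul, mul_T_assoc, neg_mul, one_mul, neg_mul]
    congr 3; ring

theorem eq_of_toLaurent_mul_T_eq (hP : P.coeff 0 ≠ 0) (hQ : Q.coeff 0 ≠ 0) {c : ℤ}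
    (h : Polynomial.toLaurent Q = Polynomial.toLaurent P * T c) : Q = P := by
  have hc : c = 0 := by
    rcases lt_trichotomy c 0 with hc | hc | hc
    · have := congrArg (fun L => L.coeff c) h
      simp only [coeff_mul_T, sub_self, coeff_toLaurent_of_neg Q hc] at this
      exact absurd (this.symm.trans rfl) ((coeff_toLaurent_natCast P 0).trans_ne hP)
    · exact hc
    · have := congrArg (fun L => L.coeff 0) h
      simp only [coeff_mul_T, coeff_toLaurent_of_neg P (show 0 - c < 0 by omega)] at this
      exact absurd this ((coeff_toLaurent_natCast Q 0).trans_ne hQ)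
  rw [hc, T_zero, mul_one] at h
  exact Polynomial.toLaurent_injective h

theorem eq_of_triviallyEquivalent (hf : laurent f = Polynomial.toLaurent P * T a)
    (hg : laurent g = Polynomial.toLaurent Q * T b) (hP : P.coeff 0 ≠ 0) (hQ : Q.coeff 0 ≠ 0)
    (h : TriviallyEquivalent f g) : ∃ ε : ℝ, ε ≠ 0 ∧
      (Q = Polynomial.C ε * P ∨ Q = Polynomial.C ε * P.reverse) := by
  obtain ⟨ε, c, hε, h⟩ := triviallyEquivalent_iff.mp h
  have hε0 : ε ≠ 0 := by rcases hε with rfl | rfl <;> norm_num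
  have hP0 : P ≠ 0 := fun h => hP (by simp [h])
  have hb : (T b * T (-b) : LaurentPolynomial ℝ) = 1 := by rw [← T_add, add_neg_cancel, T_zero]
  refine ⟨ε, hε0, h.imp (fun h => ?_) fun h => ?_⟩
  · refine eq_of_toLaurent_mul_T_eq (c := a + c - b) ?_ hQ ?_
    · simpa using ⟨hε0, hP⟩
    · rw [hf, hg] at h
      rw [map_mul, Polynomial.toLaurent_C, T_sub, T_add]
      linear_combination T (-b) * h - Polynomial.toLaurent Q * hb
  · refine eq_of_toLaurent_mul_T_eq (c := -a + c - b - P.natDegree) ?_ hQ ?_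
    · simpa [Polynomial.coeff_zero_reverse] using ⟨hε0, hP0⟩
    · rw [hf, hg, map_mul, invert_T] at h
      have hn : (T P.natDegree * T (-P.natDegree) : LaurentPolynomial ℝ) = 1 := by
        rw [← T_add, add_neg_cancel, T_zero]
      rw [map_mul, Polynomial.toLaurent_C, toLaurent_reverse, T_sub, T_sub, T_add]
      linear_combination T (-b) * h - Polynomial.toLaurent Q * hb -
        C ε * invert (Polynomial.toLaurent P) * T (-a) * T c * T (-b) * hn

end LaurentPolynomials

/-! ### Autocorrelation and Fourier magnitude. -/

section FourierMagnitude

open LaurentPolynomial ComplexConjugate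

/-- The point `e^{-iω}` of the unit circle as a unit. -/
noncomputable def circleUnit (ω : ℝ) : ℂˣ :=
  Units.mk0 (Complex.exp (-(Complex.I * ω))) (Complex.exp_ne_zero _)

theorem fourier_eq_eval₂ (f : Signal) (ω : ℝ) :
    fourier f ω = eval₂ Complex.ofRealHom (circleUnit ω) (laurent f) := by
  have h : ∀ (j : ℤ) (a : ℝ), (a : ℂ) * Complex.exp (-(Complex.I * (ω : ℂ) * (j : ℂ))) =
      eval₂ Complex.ofRealHom (circleUnit ω) (C a * T j) := by
    intro j a
    rw [eval₂_C_mul_T, circleUnit, Units.val_zpow_eq_zpow_val, Units.val_mk0, ← Complex.exp_int_mul]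
    congr 2
    ring
  have h2 : laurent f = f.sum fun j a => C a * T j := by
    conv_lhs => rw [laurent, ← Finsupp.sum_single f, AddMonoidAlgebra.ofCoeff_finsuppSum]
    exact Finsupp.sum_congr fun j _ => single_eq_C_mul_T _ _
  rw [fourier, h2, map_finsuppSum]
  exact Finsupp.sum_congr fun j _ => h j _

theorem conj_eval₂ (L : LaurentPolynomial ℝ) (ω : ℝ) :
    conj (eval₂ Complex.ofRealHom (circleUnit ω) L) =
      eval₂ Complex.ofRealHom (circleUnit ω) (invert L) := by
  induction L using LaurentPolynomial.induction_on' with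
  | add p q hp hq => rw [map_add, map_add, hp, hq, map_add, map_add]
  | C_mul_T n a =>
    have hu : conj (circleUnit ω : ℂ) = ((circleUnit ω)⁻¹ : ℂˣ) := by
      rw [circleUnit, Units.val_inv_eq_inv_val, Units.val_mk0, ← Complex.exp_neg,
        ← Complex.exp_conj]
      simp
    have ha : conj (Complex.ofRealHom a) = Complex.ofRealHom a := Complex.conj_ofReal a
    rw [map_mul invert, invert_C, invert_T, eval₂_C_mul_T, eval₂_C_mul_T, map_mul, zpow_neg,
      ← inv_zpow, Units.val_zpow_eq_zpow_val, Units.val_zpow_eq_zpow_val, map_zpow₀, hu, ha]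

/-- Real coefficients and z̄ = z⁻¹ on the unit circle. -/
theorem sq_fourierMagnitude (f : Signal) (ω : ℝ) : ((fourierMagnitude f ω ^ 2 : ℝ) : ℂ) =
    eval₂ Complex.ofRealHom (circleUnit ω) (laurent f * invert (laurent f)) := by
  rw [map_mul, ← conj_eval₂, ← fourier_eq_eval₂, Complex.mul_conj, Complex.normSq_eq_norm_sq]
  rfl

theorem infinite_range_circleUnit : (Set.range fun ω => (circleUnit ω : ℂ)).Infinite := by
  refine Set.infinite_of_injective_forall_mem (f := fun n : ℕ =>
    (circleUnit (1 / ((n : ℝ) + 1)) : ℂ)) (fun m n h => ?_) fun n => ⟨_, rfl⟩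
  have him : ∀ n : ℕ, (-(Complex.I * ((1 / ((n : ℝ) + 1) : ℝ) : ℂ))).im = -(1 / ((n : ℝ) + 1)) := by
    intro n
    rw [Complex.neg_im, Complex.I_mul_im, Complex.ofReal_re]
  have hb : ∀ n : ℕ, -Real.pi < -(1 / ((n : ℝ) + 1)) ∧ -(1 / ((n : ℝ) + 1)) ≤ Real.pi := by
    intro n
    have h1 : (1 : ℝ) / ((n : ℝ) + 1) ≤ 1 :=
      (div_le_one (by positivity)).mpr (by linarith [n.cast_nonneg (α := ℝ)])
    have h2 : (0 : ℝ) < 1 / ((n : ℝ) + 1) := by positivity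
    constructor <;> linarith [Real.pi_gt_three]
  have h1 := Complex.exp_inj_of_neg_pi_lt_of_le_pi (by rw [him]; exact (hb m).1)
    (by rw [him]; exact (hb m).2) (by rw [him]; exact (hb n).1) (by rw [him]; exact (hb n).2) h
  have h2 := congrArg Complex.im h1
  rw [him, him, neg_inj, one_div, one_div, inv_inj, add_left_inj] at h2
  exact_mod_cast h2

theorem eq_zero_of_eval₂_circleUnit {L : LaurentPolynomial ℝ}
    (h : ∀ ω, eval₂ Complex.ofRealHom (circleUnit ω) L = 0) : L = 0 := by
  obtain ⟨n, P, hP⟩ := exists_T_pow L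
  have h1 : P.map Complex.ofRealHom = 0 := by
    refine Polynomial.eq_zero_of_infinite_isRoot _ (infinite_range_circleUnit.mono ?_)
    rintro _ ⟨ω, rfl⟩
    change (P.map Complex.ofRealHom).eval _ = 0
    rw [Polynomial.eval_map, ← eval₂_toLaurent, hP, map_mul, h ω, zero_mul]
  rw [Polynomial.map_eq_zero] at h1
  rw [h1, map_zero, eq_comm, (isUnit_T _).mul_left_eq_zero] at hP
  exact hP

theorem autocorr_eq_iff_fourierMagnitude_eq (f g : Signal) :
    autocorr f = autocorr g ↔ fourierMagnitude f = fourierMagnitude g := by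
  rw [autocorr_eq_iff]
  constructor
  · intro h
    ext ω
    have h1 := sq_fourierMagnitude f ω
    rw [h, ← sq_fourierMagnitude, Complex.ofReal_inj] at h1
    exact (pow_left_inj₀ (norm_nonneg _) (norm_nonneg _) two_ne_zero).mp h1
  · intro h
    rw [← sub_eq_zero]
    refine eq_zero_of_eval₂_circleUnit fun ω => ?_
    rw [map_sub, ← sq_fourierMagnitude, ← sq_fourierMagnitude, h, sub_self]

end FourierMagnitude

/-! ### Descent from ℂ to ℝ, and rescaling of exponents. -/

section RealRecovery

open Polynomial

variable {ι : Type*} [Fintype ι] {e : ι → ℕ} {x : ι → ℝ} {i₀ t m : ι}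

theorem map_ofReal_reverse (p : Polynomial ℝ) :
    (p.map Complex.ofRealHom).reverse = p.reverse.map Complex.ofRealHom := by
  rw [reverse, reverse, natDegree_map, reflect_map]

theorem map_ofReal_mul_reverse_eq {p q : Polynomial ℝ} (h : p * p.reverse = q * q.reverse) :
    p.map Complex.ofRealHom * (p.map Complex.ofRealHom).reverse =
      q.map Complex.ofRealHom * (q.map Complex.ofRealHom).reverse := by
  rw [map_ofReal_reverse, map_ofReal_reverse, ← Polynomial.map_mul, ← Polynomial.map_mul, h]

theorem algebraicIndependent_ofReal_iff {ι : Type*} {x : ι → ℝ} :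
    AlgebraicIndependent ℚ (fun i => Complex.ofRealHom (x i)) ↔ AlgebraicIndependent ℚ x :=
  (Complex.ofRealHom.toRatAlgHom).algebraicIndependent_iff Complex.ofRealHom.injective

theorem real_eq_or_coeff_ne_zero_of_mul_reverse_eq (he : Function.Injective e)
    (h0 : e i₀ = 0) (ht : ∀ i, e i ≤ e t) (hgcd : ∀ d : ℕ, (∀ i, d ∣ e i) → d = 1)
    (hm0 : e m ≠ 0) (hmt : e m < e t) (h3 : 3 ≤ e t) (hx : AlgebraicIndependent ℚ x)
    {q : Polynomial ℝ} (hq : q.coeff 0 ≠ 0)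
    (h : sparsePoly e x * (sparsePoly e x).reverse = q * q.reverse) :
    (q = sparsePoly e x ∨ q = -sparsePoly e x ∨ q = (sparsePoly e x).reverse ∨
      q = -(sparsePoly e x).reverse) ∨ ∀ j ≤ e t, q.coeff j ≠ 0 := by
  have hinj : Function.Injective (Polynomial.map Complex.ofRealHom) :=
    map_injective _ Complex.ofRealHom.injective
  have h1 := map_ofReal_mul_reverse_eq h
  rw [map_sparsePoly] at h1
  have h2 := eq_or_coeff_ne_zero_of_mul_reverse_eq he h0 ht hgcd hm0 hmt h3
    (algebraicIndependent_ofReal_iff.mpr hx) (by simpa using hq) h1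
  rw [← map_sparsePoly, map_ofReal_reverse] at h2
  rcases h2 with h | h | h | h | h
  · exact Or.inl (Or.inl (hinj h))
  · exact Or.inl (Or.inr (Or.inl (hinj (by rw [h, Polynomial.map_neg]))))
  · exact Or.inl (Or.inr (Or.inr (Or.inl (hinj h))))
  · exact Or.inl (Or.inr (Or.inr (Or.inr (hinj (by rw [h, Polynomial.map_neg])))))
  · refine Or.inr fun j hj h0 => h j hj ?_
    rw [coeff_map, h0, map_zero]

theorem expand_reverse {R : Type*} [CommSemiring R] {d : ℕ} (hd : d ≠ 0) (p : Polynomial R) :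
    (expand R d p).reverse = expand R d p.reverse := by
  have hd' := Nat.pos_of_ne_zero hd
  ext i
  rw [coeff_reverse, natDegree_expand, coeff_expand hd', coeff_expand hd', coeff_reverse]
  rcases le_or_gt i (p.natDegree * d) with hi | hi
  · have hiff : d ∣ p.natDegree * d - i ↔ d ∣ i :=
      Nat.dvd_sub_iff_right hi (Dvd.intro_left _ rfl)
    simp only [revAt_le hi, hiff]
    split_ifs with h
    · obtain ⟨j, rfl⟩ := h
      have hj : j ≤ p.natDegree := by
        rw [mul_comm] at hi; exact Nat.le_of_mul_le_mul_right hi hd'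
      rw [Nat.mul_div_cancel_left _ hd', revAt_le hj, mul_comm d j, ← Nat.sub_mul,
        Nat.mul_div_cancel _ hd']
    · rfl
  · rw [revAt_eq_self_of_lt hi]
    split_ifs with h
    · obtain ⟨j, rfl⟩ := h
      have hj : p.natDegree < j := by
        rw [mul_comm] at hi; exact Nat.lt_of_mul_lt_mul_left hi
      rw [Nat.mul_div_cancel_left _ hd', revAt_eq_self_of_lt hj]
    · rfl

theorem expand_contract_of_dvd {R : Type*} [CommSemiring R] {d : ℕ} (hd : d ≠ 0) {Q : Polynomial R}
    (h : ∀ n ∈ Q.support, d ∣ n) : expand R d (contract d Q) = Q := by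
  ext n
  rw [coeff_expand (Nat.pos_of_ne_zero hd), coeff_contract hd]
  split_ifs with hn
  · rw [Nat.div_mul_cancel hn]
  · by_contra hne
    exact hn (h n (mem_support_iff.mpr (Ne.symm hne)))

end RealRecovery

/-! ### Algebraic dependence of a signal on its competitors. -/

section AlgebraicCoefficients

open Polynomial

/-- The roots of `P` are roots of `Q * Q.reverse`, hence algebraic over the coefficients of `Q`;
only the leading coefficient remains to be found. -/
theorem coeff_mem_algCl_of_mul_reverse_eq {Ω : Type*} [Field Ω] [CharZero Ω] [IsAlgClosed Ω]
    {P Q : Polynomial Ω} (hP : P.coeff 0 ≠ 0) (hQ : Q.coeff 0 ≠ 0)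
    (h : P * P.reverse = Q * Q.reverse) (j : ℕ) : P.coeff j ∈ algCl (Set.range Q.coeff) := by
  set M := algCl (Set.range Q.coeff) with hM
  have hP0 : P ≠ 0 := fun h => hP (by simp [h])
  have hQ0 : Q ≠ 0 := fun h => hQ (by simp [h])
  have hQM : ∀ j, Q.coeff j ∈ M := fun j => subset_algCl _ ⟨j, rfl⟩
  have hQQ : ∀ j, (Q * Q.reverse).coeff j ∈ M := fun j => by
    rw [coeff_mul]
    refine sum_mem fun k _ => mul_mem (hQM _) ?_
    rw [coeff_reverse]
    exact hQM _
  have hroot : ∀ r ∈ P.roots, r ∈ M := fun r hr =>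
    mem_algCl_of_eval_eq_zero (mul_ne_zero hQ0 (by simpa using hQ0)) hQQ (by
      rw [← h, eval_mul, isRoot_of_mem_roots hr, zero_mul])
  set W := (P.roots.map (X - C ·)).prod with hW
  have hWM : ∀ j, W.coeff j ∈ M := by
    have h1 : W ∈ lifts (algebraMap M Ω) := by
      refine multiset_prod_mem _ fun q hq => ?_
      obtain ⟨r, hr, rfl⟩ := Multiset.mem_map.mp hq
      exact ⟨X - C ⟨r, hroot r hr⟩, by simp⟩
    intro j
    obtain ⟨a, ha⟩ := (lifts_iff_coeff_lifts W).mp h1 j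
    rw [← ha]
    exact a.2
  have hPW : P = C P.leadingCoeff * W := (IsAlgClosed.splits P).eq_prod_roots
  have hW0 : W.coeff 0 ≠ 0 := fun h0 => hP (by rw [hPW, coeff_C_mul, h0, mul_zero])
  -- The constant term of `P * P.reverse` is the square of the leading coefficient times `W.coeff
  -- 0`.
  have h2 : P.leadingCoeff * P.leadingCoeff ∈ M := by
    have h3 := hQQ 0
    rw [← h, mul_coeff_zero, coeff_zero_reverse] at h3
    nth_rw 1 [hPW] at h3
    rw [coeff_C_mul] at h3
    have h4 := mul_mem h3 (inv_mem (hWM 0))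
    rwa [show P.leadingCoeff * W.coeff 0 * P.leadingCoeff * (W.coeff 0)⁻¹ =
      P.leadingCoeff * P.leadingCoeff by field_simp] at h4
  have h5 : P.leadingCoeff ∈ M := by
    refine mem_algCl_of_eval_eq_zero (q := X ^ 2 - C (P.leadingCoeff * P.leadingCoeff))
      (X_pow_sub_C_ne_zero two_pos _) (fun i => ?_) (by simp [sq])
    rw [coeff_sub, coeff_X_pow, coeff_C]
    refine sub_mem ?_ ?_
    · split_ifs
      exacts [one_mem _, zero_mem _]
    · split_ifs
      exacts [h2, zero_mem _]
  rw [hPW, coeff_C_mul]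
  exact mul_mem h5 (hWM j)

end AlgebraicCoefficients

/-! ### Size and differences of the support of a competitor. -/

section Supports

theorem exists_of_autocorr_ne_zero {f : Signal} {i : ℤ} (h : autocorr f i ≠ 0) :
    ∃ j ∈ f.support, j + i ∈ f.support := by
  obtain ⟨j, hj, hne⟩ := Finset.exists_ne_zero_of_sum_ne_zero
    (s := f.support) (f := fun j => f j * f (j + i)) h
  refine ⟨j, hj, Finsupp.mem_support_iff.mpr fun h0 => hne ?_⟩
  rw [h0, mul_zero]

/-- This value is a polynomial in the entries with non-negative coefficients containing the monomial
of `l` and `l'`; evaluation at all ones shows that it is not the zero polynomial. -/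
theorem autocorr_sub_ne_zero {g : Signal}
    (hg : AlgebraicIndependent ℚ fun i : g.support => g i) {l l' : ℤ} (hl : l ∈ g.support)
    (hl' : l' ∈ g.support) : autocorr g (l - l') ≠ 0 := by
  classical
  intro h
  let Φ : MvPolynomial g.support ℚ := ∑ j : g.support,
    if hj : (j : ℤ) + (l - l') ∈ g.support then .X j * .X ⟨_, hj⟩ else 0
  have h1 : MvPolynomial.aeval (fun i : g.support => g i) Φ = autocorr g (l - l') := by
    have h0 : autocorr g (l - l') = ∑ j : g.support, g j * g (j + (l - l')) :=
      (Finset.sum_coe_sort g.support fun j => g j * g (j + (l - l'))).symm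
    rw [h0, map_sum]
    refine Finset.sum_congr rfl fun j _ => ?_
    split_ifs with hj
    · simp
    · rw [map_zero, Finsupp.notMem_support_iff.mp hj, mul_zero]
  have h2 : Φ = 0 := algebraicIndependent_iff.mp hg Φ (h1.trans h)
  have h3 := congrArg (MvPolynomial.eval fun _ => (1 : ℚ)) h2
  rw [map_sum, map_zero, Finset.sum_eq_zero_iff_of_nonneg] at h3
  · have h4 := h3 ⟨l', hl'⟩ (Finset.mem_univ _)
    rw [dif_pos (by simpa using hl)] at h4
    simp at h4
  · intro j _
    split_ifs <;> simp

theorem signalOn_apply {I : Finset ℤ} (x : I → ℝ) (i : I) : signalOn I x i = x i := by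
  classical
  rw [signalOn, Finsupp.finsetSum_apply]
  simp [Finsupp.single_apply]

theorem signalOn_apply_of_notMem {I : Finset ℤ} (x : I → ℝ) {i : ℤ} (hi : i ∉ I) :
    signalOn I x i = 0 := by
  classical
  rw [signalOn, Finsupp.finsetSum_apply]
  refine Finset.sum_eq_zero fun j _ => ?_
  rw [Finsupp.single_apply, if_neg]
  rintro rfl
  exact hi j.2

theorem support_signalOn {I : Finset ℤ} {x : I → ℝ} (hx : ∀ i, x i ≠ 0) :
    (signalOn I x).support = I := by
  ext i
  rw [Finsupp.mem_support_iff]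
  refine ⟨fun h => ?_, fun h => by rw [signalOn_apply x ⟨i, h⟩]; exact hx _⟩
  by_contra hi
  exact h (signalOn_apply_of_notMem x hi)

theorem laurent_ne_zero {f : Signal} (hf : f ≠ 0) : laurent f ≠ 0 := fun h =>
  hf (laurent_injective (h.trans rfl))

theorem ne_zero_of_autocorr_eq {f g : Signal} (hf : f ≠ 0) (h : autocorr g = autocorr f) :
    g ≠ 0 := by
  rintro rfl
  rw [autocorr_eq_iff, eq_comm] at h
  have h0 : laurent 0 = 0 := rfl
  rw [h0, zero_mul, mul_eq_zero, EmbeddingLike.map_eq_zero_iff, or_self] at h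
  exact laurent_ne_zero hf h

/-- The generic entries of f are algebraic over the entries of `g`, so transcendence degree bounds
the sparsity of `g` from below. -/
theorem card_le_card_support_of_autocorr_eq {I : Finset ℤ} [Nonempty I] {x : I → ℝ}
    (hx : AlgebraicIndependent ℚ x)
    {g : Signal} (h : autocorr g = autocorr (signalOn I x)) : I.card ≤ g.support.card ∧
      (g.support.card ≤ I.card → AlgebraicIndependent ℚ fun i : g.support => g i) := by
  have hx0 : ∀ i, x i ≠ 0 := fun i => hx.ne_zero i
  set f := signalOn I x with hf
  have hf0 : f ≠ 0 := fun h0 => by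
    obtain ⟨i⟩ := ‹Nonempty I›
    have := signalOn_apply x i
    rw [← hf, h0] at this
    exact hx0 i this.symm
  have hg0 : g ≠ 0 := ne_zero_of_autocorr_eq hf0 h
  obtain ⟨P, a, hP, hfP⟩ := exists_laurent_eq hf0
  obtain ⟨Q, b, hQ, hgQ⟩ := exists_laurent_eq hg0
  have hPQ := map_ofReal_mul_reverse_eq
    ((autocorr_eq_iff_mul_reverse_eq hfP hgQ hP hQ).mp h.symm)
  let y : g.support → ℂ := fun i => Complex.ofRealHom (g i)
  have hQy : algCl (Set.range (Q.map Complex.ofRealHom).coeff) ≤ algCl (Set.range y) := by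
    refine algCl_le ?_
    rintro _ ⟨n, rfl⟩
    rw [Polynomial.coeff_map, ← apply_add_of_laurent_eq hgQ]
    by_cases hn : b + (n : ℤ) ∈ g.support
    · exact subset_algCl _ ⟨⟨_, hn⟩, rfl⟩
    · rw [Finsupp.notMem_support_iff.mp hn, map_zero]
      exact zero_mem _
  have hxy : ∀ i, Complex.ofRealHom (x i) ∈ algCl (Set.range y) := by
    intro i
    have hi : (i : ℤ) ∈ f.support := by rw [support_signalOn hx0]; exact i.2
    rw [support_of_laurent_eq hfP, Finset.mem_image] at hi
    obtain ⟨n, _, hn⟩ := hi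
    rw [← signalOn_apply x i, ← hf, ← hn, apply_add_of_laurent_eq hfP, ← Polynomial.coeff_map]
    exact hQy (coeff_mem_algCl_of_mul_reverse_eq (by simpa using hP) (by simpa using hQ) hPQ n)
  have h1 := card_le_of_forall_mem_algCl (algebraicIndependent_ofReal_iff.mpr hx) hxy
  rw [Fintype.card_coe, Fintype.card_coe] at h1
  exact ⟨h1.1, fun h2 => algebraicIndependent_ofReal_iff.mp (h1.2 h2)⟩

end Supports

/-! ### Shifting and rescaling the support. -/

section Normalization

theorem card_image_progression (a : ℤ) {d : ℕ} (hd : d ≠ 0) (N : ℕ) :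
    ((Finset.range N).image fun j : ℕ => a + (j : ℤ) * d).card = N := by
  rw [Finset.card_image_of_injective, Finset.card_range]
  intro i j h
  have hd' : (d : ℤ) ≠ 0 := by exact_mod_cast hd
  exact_mod_cast mul_right_cancel₀ hd' (add_left_cancel h)

theorem isUniform_image_progression (a : ℤ) {d : ℕ} (hd : d ≠ 0) (N : ℕ) :
    IsUniform ((Finset.range N).image fun j : ℕ => a + (j : ℤ) * d) :=
  ⟨a, d, by rw [card_image_progression a hd]⟩

theorem exists_normalization {I : Finset ℤ} (hI : I.Nonempty) (h2 : 2 ≤ I.card) :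
    ∃ (a : ℤ) (d : ℕ) (e : I → ℕ) (i₀ t : I), d ≠ 0 ∧ (∀ i : I, (i : ℤ) = a + (e i : ℤ) * d) ∧
      Function.Injective e ∧ e i₀ = 0 ∧ (∀ i, e i ≤ e t) ∧
      ∀ c : ℕ, (∀ i, c ∣ e i) → c = 1 := by
  set a := I.min' hI with ha
  let d := I.gcd fun i => (i - a).natAbs
  have hdvd : ∀ i : I, d ∣ ((i : ℤ) - a).natAbs := fun i => Finset.gcd_dvd i.2
  have hd : d ≠ 0 := by
    intro h
    rw [Finset.gcd_eq_zero_iff] at h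
    have : I ⊆ {a} := fun i hi => by
      have := h i hi
      rw [Finset.mem_singleton]
      omega
    have := Finset.card_le_card this
    rw [Finset.card_singleton] at this
    omega
  let e : I → ℕ := fun i => ((i : ℤ) - a).natAbs / d
  have hmul : ∀ i, e i * d = ((i : ℤ) - a).natAbs := fun i => Nat.div_mul_cancel (hdvd i)
  have he : ∀ i : I, (i : ℤ) = a + (e i : ℤ) * d := by
    intro i
    have h1 : a ≤ i := Finset.min'_le I i i.2
    have h2 : ((e i * d : ℕ) : ℤ) = i - a := by rw [hmul]; omega
    push_cast at h2
    omega
  have : Nonempty I := hI.to_subtype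
  obtain ⟨t, ht⟩ := Finite.exists_max e
  refine ⟨a, d, e, ⟨a, I.min'_mem hI⟩, t, hd, he, fun i j h => ?_, ?_, ht, fun c hc => ?_⟩
  · exact Subtype.ext (by rw [he i, he j, h])
  · simp [e]
  · have h1 : c * d ∣ d := Finset.dvd_gcd fun i hi => by
      rw [← hmul ⟨i, hi⟩]
      exact Nat.mul_dvd_mul_right (hc _) d
    obtain ⟨b, hb⟩ := h1
    have h3 : d * (c * b) = d * 1 := by rw [mul_one]; nth_rw 2 [hb]; ring
    exact Nat.eq_one_of_mul_eq_one_right (Nat.eq_of_mul_eq_mul_left (Nat.pos_of_ne_zero hd) h3)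

theorem two_le_card_of_not_isUniform {I : Finset ℤ} (hI : ¬ IsUniform I) : 2 ≤ I.card := by
  by_contra! h
  rcases (by omega : I.card = 0 ∨ I.card = 1) with h0 | h1
  · exact hI ⟨0, 0, by rw [Finset.card_eq_zero.mp h0]; rfl⟩
  · obtain ⟨a, rfl⟩ := Finset.card_eq_one.mp h1
    exact hI ⟨a, 0, by simp⟩

variable {I : Finset ℤ} {a : ℤ} {d : ℕ} {e : I → ℕ} {i₀ t : I}

theorem exists_forall_ne_of_not_isUniform (hI : ¬ IsUniform I) (hd : d ≠ 0)
    (he : ∀ i : I, (i : ℤ) = a + (e i : ℤ) * d) (ht : ∀ i, e i ≤ e t) :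
    ∃ j ≤ e t, ∀ i, e i ≠ j := by
  by_contra! h
  refine hI ?_
  have : I = (Finset.range (e t + 1)).image fun j : ℕ => a + (j : ℤ) * d := by
    ext i
    rw [Finset.mem_image]
    constructor
    · intro hi
      exact ⟨e ⟨i, hi⟩, Finset.mem_range_succ_iff.mpr (ht _), (he ⟨i, hi⟩).symm⟩
    · rintro ⟨j, hj, rfl⟩
      obtain ⟨i, rfl⟩ := h j (Finset.mem_range_succ_iff.mp hj)
      rw [← he]
      exact i.2
  rw [this]
  exact isUniform_image_progression a hd _

/-- With 0 and `e t` as the only exponents, gcd 1 forces `e t = 1`, which leaves no room for a gap.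
A gap and an exponent strictly between then need `e t ≥ 3`. -/
theorem exists_middle {ι : Type*} {e : ι → ℕ} {i₀ t : ι} (h0 : e i₀ = 0) (ht : ∀ i, e i ≤ e t)
    (hgcd : ∀ c : ℕ, (∀ i, c ∣ e i) → c = 1) (hgap : ∃ j ≤ e t, ∀ i, e i ≠ j) :
    3 ≤ e t ∧ ∃ m, e m ≠ 0 ∧ e m < e t := by
  obtain ⟨j, hj, hji⟩ := hgap
  have hj0 := hji i₀
  have hjt := hji t
  have hm : ∃ m, e m ≠ 0 ∧ e m < e t := by
    by_contra! h
    have := hgcd (e t) fun i => by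
      by_cases hi : e i = 0
      · simp [hi]
      · rw [le_antisymm (ht i) (h i hi)]
    omega
  obtain ⟨m, hm0, hmt⟩ := hm
  have := hji m
  exact ⟨by omega, m, hm0, hmt⟩

open Polynomial LaurentPolynomial in
theorem laurent_signalOn (he : ∀ i : I, (i : ℤ) = a + (e i : ℤ) * d) (x : I → ℝ) :
    laurent (signalOn I x) = Polynomial.toLaurent (expand ℝ d (sparsePoly e x)) * T a := by
  rw [laurent, signalOn, AddMonoidAlgebra.ofCoeff_sum, sparsePoly, map_sum, map_sum,
    Finset.sum_mul]
  refine Finset.sum_congr rfl fun i _ => ?_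
  rw [map_mul, expand_C, map_pow, expand_X, ← pow_mul, Polynomial.toLaurent_C_mul_X_pow,
    mul_T_assoc, AddMonoidAlgebra.ofCoeff_single, single_eq_C_mul_T, he i]
  congr 2
  push_cast
  ring

end Normalization

/-! ### Recovery for non-uniform supports. -/

section Main

open Polynomial

/-- The common core of all positive results. The divisibility hypothesis makes the polynomial of `g`
a polynomial in `X ^ d`, so both sides can be contracted to exponents of gcd 1. -/
theorem triviallyEquivalent_or_isUniform {I : Finset ℤ} (hI : ¬ IsUniform I) {x : I → ℝ}
    (hx : AlgebraicIndependent ℚ x) {g : Signal} (h : autocorr g = autocorr (signalOn I x))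
    (hdvd : ∀ D : ℕ, (∀ i ∈ I, ∀ j ∈ I, (D : ℤ) ∣ i - j) →
      ∀ i ∈ g.support, ∀ j ∈ g.support, (D : ℤ) ∣ i - j) :
    TriviallyEquivalent (signalOn I x) g ∨ (IsUniform g.support ∧ I.card < g.support.card) := by
  have h2 := two_le_card_of_not_isUniform hI
  obtain ⟨a, d, e, i₀, t, hd, hae, he, h0, ht, hgcd⟩ :=
    exists_normalization (Finset.card_pos.mp (by omega)) h2
  have hgap := exists_forall_ne_of_not_isUniform hI hd hae ht
  obtain ⟨h3, m, hm0, hmt⟩ := exists_middle h0 ht hgcd hgap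
  have hf := laurent_signalOn hae x
  set p := sparsePoly e x with hp
  have hd' := Nat.pos_of_ne_zero hd
  have hp0 : p.coeff 0 ≠ 0 := by rw [← h0, hp, coeff_sparsePoly_apply he]; exact hx.ne_zero i₀
  have hP0 : (expand ℝ d p).coeff 0 ≠ 0 := by
    rw [coeff_expand hd', if_pos (dvd_zero d), Nat.zero_div]; exact hp0
  have hf0 : signalOn I x ≠ 0 := fun h0 => by
    have := signalOn_apply x i₀
    rw [h0] at this
    exact hx.ne_zero i₀ this.symm
  obtain ⟨Q, b, hQ0, hg⟩ := exists_laurent_eq (ne_zero_of_autocorr_eq hf0 h)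
  have hsupp := support_of_laurent_eq hg
  have hPQ := (autocorr_eq_iff_mul_reverse_eq hf hg hP0 hQ0).mp h.symm
  have hQd : ∀ n ∈ Q.support, d ∣ n := by
    intro n hn
    have h1 := hdvd d (fun i hi j hj => by
      have h2 := hae ⟨i, hi⟩
      have h3 := hae ⟨j, hj⟩
      simp only at h2 h3
      rw [h2, h3, add_sub_add_left_eq_sub, ← sub_mul]
      exact Dvd.intro_left _ rfl) (b + n) (by rw [hsupp]; exact Finset.mem_image_of_mem _ hn)
      (b + (0 : ℕ)) (by rw [hsupp]; exact Finset.mem_image_of_mem _ (mem_support_iff.mpr hQ0))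
    rw [add_sub_add_left_eq_sub, Nat.cast_zero, sub_zero] at h1
    exact_mod_cast h1
  obtain ⟨q, rfl⟩ : ∃ q, Q = expand ℝ d q := ⟨_, (expand_contract_of_dvd hd hQd).symm⟩
  have hcoeff : ∀ j, (expand ℝ d q).coeff (j * d) = q.coeff j := fun j => coeff_expand_mul hd' q j
  have hq0 : q.coeff 0 ≠ 0 := by rwa [← hcoeff, zero_mul]
  have hpq : p * p.reverse = q * q.reverse := by
    rw [expand_reverse hd, expand_reverse hd, ← map_mul, ← map_mul] at hPQ
    exact expand_injective hd' hPQ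
  have hqn : q.natDegree = e t := by
    rw [natDegree_eq_of_mul_reverse_eq hp0 hq0 hpq, hp, natDegree_sparsePoly he (hx.ne_zero t) ht]
  rcases real_eq_or_coeff_ne_zero_of_mul_reverse_eq he h0 ht hgcd hm0 hmt h3 hx hq0 hpq with
    h4 | h4
  · left
    refine triviallyEquivalent_of_eq hf hg ?_
    rw [expand_reverse hd, ← map_neg, ← map_neg]
    rcases h4 with h | h | h | h
    · exact Or.inl (congrArg _ h)
    · exact Or.inr (Or.inl (congrArg _ h))
    · exact Or.inr (Or.inr (Or.inl (congrArg _ h)))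
    · exact Or.inr (Or.inr (Or.inr (congrArg _ h)))
  · right
    have hgs : g.support = (Finset.range (e t + 1)).image fun j : ℕ => b + (j : ℤ) * d := by
      rw [hsupp]
      ext i
      simp only [Finset.mem_image, mem_support_iff, Finset.mem_range_succ_iff]
      constructor
      · rintro ⟨n, hn, rfl⟩
        obtain ⟨j, rfl⟩ := hQd n (mem_support_iff.mpr hn)
        rw [mul_comm d j] at hn ⊢
        rw [hcoeff] at hn
        exact ⟨j, hqn ▸ le_natDegree_of_ne_zero hn, by push_cast; rfl⟩
      · rintro ⟨j, hj, rfl⟩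
        exact ⟨j * d, by rw [hcoeff]; exact h4 j hj, by push_cast; rfl⟩
    refine ⟨hgs ▸ isUniform_image_progression b hd _, ?_⟩
    rw [hgs, card_image_progression b hd]
    obtain ⟨j, hj, hji⟩ := hgap
    -- The exponents of `I` miss the gap `j`, whereas `g` occupies all `e t + 1` places.
    have h5 : (Finset.univ.image e) ⊆ (Finset.range (e t + 1)).erase j := fun n hn => by
      obtain ⟨i, _, rfl⟩ := Finset.mem_image.mp hn
      exact Finset.mem_erase.mpr ⟨hji i, Finset.mem_range_succ_iff.mpr (ht i)⟩
    have h6 := Finset.card_le_card h5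
    rw [Finset.card_image_of_injective _ he, Finset.card_univ, Fintype.card_coe,
      Finset.card_erase_of_mem (Finset.mem_range_succ_iff.mpr hj), Finset.card_range] at h6
    have := hqn
    omega

/-- For independent entries every difference of the support is visible in the autocorrelation, hence
is a difference of the support of `f`. -/
theorem dvd_sub_of_autocorr_eq {f g : Signal} (h : autocorr g = autocorr f)
    (hg : AlgebraicIndependent ℚ fun i : g.support => g i) {D : ℤ}
    (hD : ∀ i ∈ f.support, ∀ j ∈ f.support, D ∣ i - j) {i j : ℤ} (hi : i ∈ g.support)
    (hj : j ∈ g.support) : D ∣ i - j := by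
  have h1 := autocorr_sub_ne_zero hg hi hj
  rw [h] at h1
  obtain ⟨l, hl, hl'⟩ := exists_of_autocorr_ne_zero h1
  have := hD _ hl' _ hl
  rwa [add_sub_cancel_left] at this

theorem nonempty_of_not_isUniform {I : Finset ℤ} (hI : ¬ IsUniform I) : Nonempty I :=
  (Finset.card_pos.mp (by have := two_le_card_of_not_isUniform hI; omega)).to_subtype

theorem uniquelyRecoverable_of_algebraicIndependent {I : Finset ℤ} (hI : ¬ IsUniform I)
    {x : I → ℝ} (hx : AlgebraicIndependent ℚ x) :
    UniquelyRecoverable autocorr I.card (signalOn I x) := by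
  intro g hcard hg
  have := nonempty_of_not_isUniform hI
  have hy := (card_le_card_support_of_autocorr_eq hx hg).2 hcard
  refine (triviallyEquivalent_or_isUniform hI hx hg fun D hD i hi j hj =>
    dvd_sub_of_autocorr_eq hg hy ?_ hi hj).resolve_right fun h => h.2.not_ge hcard
  rwa [support_signalOn fun i => hx.ne_zero i]

theorem triviallyEquivalent_of_gcd_eq_one {I : Finset ℤ} (hI : ¬ IsUniform I)
    (hgcd : ∀ d : ℤ, (∀ i ∈ I, ∀ j ∈ I, d ∣ i - j) → d = 1 ∨ d = -1) {x : I → ℝ}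
    (hx : AlgebraicIndependent ℚ x) {g : Signal} (hg : ¬ IsUniform g.support)
    (h : autocorr g = autocorr (signalOn I x)) : TriviallyEquivalent (signalOn I x) g := by
  refine (triviallyEquivalent_or_isUniform hI hx h fun D hD i _ j _ => ?_).resolve_right
    fun h => hg h.1
  rcases hgcd D hD with h | h <;> simp [h]

theorem triviallyEquivalent_of_algebraicIndependent {I J : Finset ℤ} (hI : ¬ IsUniform I)
    (hJ : ¬ IsUniform J) {x : I → ℝ} {y : J → ℝ} (hx : AlgebraicIndependent ℚ x)
    (hy : AlgebraicIndependent ℚ y) (h : autocorr (signalOn I x) = autocorr (signalOn J y)) :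
    TriviallyEquivalent (signalOn I x) (signalOn J y) := by
  have hyJ : (signalOn J y).support = J := support_signalOn fun i => hy.ne_zero i
  have hy' : AlgebraicIndependent ℚ fun i : (signalOn J y).support => signalOn J y i := by
    have hmem : ∀ i : (signalOn J y).support, (i : ℤ) ∈ J := fun i =>
      (Finset.ext_iff.mp hyJ i).mp i.2
    have := hy.comp (fun i : (signalOn J y).support => (⟨i, hmem i⟩ : J))
      fun i j h => Subtype.ext (congrArg (fun i : J => (i : ℤ)) h)
    convert this using 1
    ext i
    exact signalOn_apply y ⟨i, hmem i⟩
  refine (triviallyEquivalent_or_isUniform hI hx h.symm fun D hD i hi j hj =>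
    dvd_sub_of_autocorr_eq h.symm hy' ?_ hi hj).resolve_right fun h => hJ (hyJ ▸ h.1)
  rwa [support_signalOn fun i => hx.ne_zero i]

end Main

/-! ### Failure of recovery for uniform supports. -/

section Uniform

open Polynomial

theorem exists_uniform_normalization {I : Finset ℤ} (hI : IsUniform I) (h2 : 2 ≤ I.card) :
    ∃ (a : ℤ) (d : ℕ) (e : I → ℕ), d ≠ 0 ∧ (∀ i : I, (i : ℤ) = a + (e i : ℤ) * d) ∧
      Function.Injective e ∧ (∀ i, e i < I.card) ∧ ∀ j < I.card, ∃ i, e i = j := by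
  obtain ⟨a, d, had⟩ : ∃ (a : ℤ) (d : ℕ),
      I = (Finset.range I.card).image fun j : ℕ => a + (j : ℤ) * d := by
    obtain ⟨a, d, had⟩ := hI
    rcases le_total 0 d with h | h
    · exact ⟨a, d.toNat, by rwa [Int.toNat_of_nonneg h]⟩
    -- A progression with non-positive step is read backwards from its last term.
    · refine ⟨a + (I.card - 1 : ℕ) * d, (-d).toNat, ?_⟩
      rw [Int.toNat_of_nonneg (by omega)]
      conv_lhs => rw [had]
      have key : ∀ j < I.card, a + ((I.card - 1 : ℕ) : ℤ) * d + (j : ℤ) * -d =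
          a + ((I.card - 1 - j : ℕ) : ℤ) * d := fun j hj => by
        rw [Nat.cast_sub (show j ≤ I.card - 1 by omega)]; ring
      ext i
      simp only [Finset.mem_image, Finset.mem_range]
      constructor
      · rintro ⟨j, hj, rfl⟩
        refine ⟨I.card - 1 - j, by omega, ?_⟩
        rw [key _ (by omega)]
        congr 3
        omega
      · rintro ⟨j, hj, rfl⟩
        exact ⟨I.card - 1 - j, by omega, (key j hj).symm⟩
  have hd : d ≠ 0 := by
    rintro rfl
    have : I ⊆ {a} := by
      rw [had]
      intro i hi
      obtain ⟨j, _, rfl⟩ := Finset.mem_image.mp hi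
      simp
    have := Finset.card_le_card this
    rw [Finset.card_singleton] at this
    omega
  have hd' : (d : ℤ) ≠ 0 := by exact_mod_cast hd
  have hex : ∀ i : I, ∃ j < I.card, (i : ℤ) = a + (j : ℤ) * d := fun i => by
    obtain ⟨j, hj, hi⟩ := Finset.mem_image.mp ((Finset.ext_iff.mp had i).mp i.2)
    exact ⟨j, Finset.mem_range.mp hj, hi.symm⟩
  choose e he1 he2 using hex
  refine ⟨a, d, e, hd, he2, fun i j h => Subtype.ext (by rw [he2 i, he2 j, h]), he1,
    fun j hj => ?_⟩
  have hmem : a + (j : ℤ) * d ∈ I := by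
    rw [had]
    exact Finset.mem_image.mpr ⟨j, Finset.mem_range.mpr hj, rfl⟩
  refine ⟨⟨_, hmem⟩, ?_⟩
  have := mul_right_cancel₀ hd' (add_left_cancel (he2 ⟨_, hmem⟩))
  exact_mod_cast this.symm

/-- Otherwise the roots of `B` would be closed under inversion. -/
theorem mul_reverse_ne_C_mul {A B : Polynomial ℝ} (hA : A.coeff 0 ≠ 0) (hB : B.coeff 0 ≠ 0)
    (hdeg : 1 ≤ B.natDegree)
    (hr : ∀ r s : ℂ, ((A * B).map Complex.ofRealHom).eval r = 0 →
      ((A * B).map Complex.ofRealHom).eval s = 0 → r * s ≠ 1) (ε : ℝ) :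
    A * B.reverse ≠ C ε * (A * B) := by
  intro h
  have hA0 : A ≠ 0 := fun h => hA (by simp [h])
  have h1 : B.reverse = C ε * B := mul_left_cancel₀ hA0 (by rw [h]; ring)
  obtain ⟨r, hr0⟩ := IsAlgClosed.exists_root (B.map Complex.ofRealHom) (by
    rw [degree_map]
    exact (natDegree_pos_iff_degree_pos.mp hdeg).ne')
  have hrne : r ≠ 0 := by
    rintro rfl
    rw [IsRoot.def, ← coeff_zero_eq_eval_zero, coeff_map] at hr0
    exact hB (Complex.ofReal_eq_zero.mp hr0)
  have h2 : (B.map Complex.ofRealHom).eval r⁻¹ = 0 := by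
    rw [← eval_reverse_eq_zero_iff _ hrne, map_ofReal_reverse, h1, Polynomial.map_mul, eval_mul,
      hr0.eq_zero, mul_zero]
  refine hr r r⁻¹ ?_ ?_ (mul_inv_cancel₀ hrne)
  · rw [Polynomial.map_mul, eval_mul, hr0.eq_zero, mul_zero]
  · rw [Polynomial.map_mul, eval_mul, h2, mul_zero]

variable {I : Finset ℤ} {a : ℤ} {d : ℕ} {e : I → ℕ} {x : I → ℝ}

/-- The competitor reverses one factor. It has the degree of the original polynomial, so it occupies
at most the same number of places on the progression. -/
theorem not_uniquelyRecoverable_of_mul_eq (h2 : 2 ≤ I.card) (hd : d ≠ 0)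
    (hae : ∀ i : I, (i : ℤ) = a + (e i : ℤ) * d) (he : Function.Injective e)
    (hlt : ∀ i, e i < I.card) (hsurj : ∀ j < I.card, ∃ i, e i = j)
    (hx : AlgebraicIndependent ℚ x) {A B : Polynomial ℝ} (hAB : sparsePoly e x = A * B)
    (hA : 1 ≤ A.natDegree) (hB : 1 ≤ B.natDegree) :
    ¬ UniquelyRecoverable autocorr I.card (signalOn I x) := by
  intro hU
  obtain ⟨i₀, h0⟩ := hsurj 0 (by omega)
  obtain ⟨m, hm⟩ := hsurj 1 (by omega)
  have hd' := Nat.pos_of_ne_zero hd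
  have hp0 : (A * B).coeff 0 ≠ 0 := by
    rw [← hAB, ← h0, coeff_sparsePoly_apply he]; exact hx.ne_zero i₀
  have hP0 : (expand ℝ d (A * B)).coeff 0 ≠ 0 := by
    rwa [coeff_expand hd', if_pos (dvd_zero d), Nat.zero_div]
  have hAB0 := hp0
  rw [mul_coeff_zero] at hAB0
  have hA0 := left_ne_zero_of_mul hAB0
  have hB0 := right_ne_zero_of_mul hAB0
  have hAz : A ≠ 0 := fun h => hA0 (by simp [h])
  have hBz : B ≠ 0 := fun h => hB0 (by simp [h])
  have hf := laurent_signalOn hae x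
  rw [hAB] at hf
  set q := A * B.reverse with hq
  have hq0 : q.coeff 0 ≠ 0 := by
    rw [hq, mul_coeff_zero, coeff_zero_reverse]
    exact mul_ne_zero hA0 (leadingCoeff_ne_zero.mpr hBz)
  have hQ0 : (expand ℝ d q).coeff 0 ≠ 0 := by
    rwa [coeff_expand hd', if_pos (dvd_zero d), Nat.zero_div]
  let g : Signal := (Polynomial.toLaurent (expand ℝ d q) * LaurentPolynomial.T a).coeff
  have hg : laurent g = Polynomial.toLaurent (expand ℝ d q) * LaurentPolynomial.T a := rfl
  have hpq : A * B * (A * B).reverse = q * q.reverse := by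
    rw [hq, reverse_mul_of_domain, reverse_mul_of_domain,
      reverse_reverse_of_coeff_zero_ne_zero hB0]
    ring
  have hauto : autocorr g = autocorr (signalOn I x) := by
    refine ((autocorr_eq_iff_mul_reverse_eq hf hg hP0 hQ0).mpr ?_).symm
    rw [expand_reverse hd, expand_reverse hd, ← map_mul, ← map_mul, hpq]
  have hdeg : q.natDegree < I.card := by
    rw [hq, natDegree_mul hAz (by simpa using hBz), natDegree_reverse_of_coeff_zero_ne_zero hB0,
      ← natDegree_mul hAz hBz, ← hAB]
    have := natDegree_sparsePoly_le x (n := I.card - 1) fun i => Nat.le_sub_one_of_lt (hlt i)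
    omega
  have hcard : g.support.card ≤ I.card := by
    rw [support_of_laurent_eq hg]
    refine Finset.card_image_le.trans ?_
    have hsub : (expand ℝ d q).support ⊆ (Finset.range I.card).image fun j => j * d := by
      intro n hn
      rw [mem_support_iff, coeff_expand hd'] at hn
      split_ifs at hn with hdn
      · exact Finset.mem_image.mpr ⟨n / d, Finset.mem_range.mpr
          ((le_natDegree_of_ne_zero hn).trans_lt hdeg), Nat.div_mul_cancel hdn⟩
      · exact absurd rfl hn
    exact (Finset.card_le_card hsub).trans (Finset.card_image_le.trans (by rw [Finset.card_range]))
  have hroots : ∀ r s : ℂ, ((A * B).map Complex.ofRealHom).eval r = 0 →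
      ((A * B).map Complex.ofRealHom).eval s = 0 → r * s ≠ 1 := by
    intro r s hr hs
    rw [← hAB, map_sparsePoly] at hr hs
    exact mul_ne_one_of_roots he h0 (fun c hc => Nat.dvd_one.mp (hm ▸ hc m)) (by omega : e m ≠ 0)
      (algebraicIndependent_ofReal_iff.mpr hx) hr hs
  obtain ⟨ε, hε, h⟩ := eq_of_triviallyEquivalent hf hg hP0 hQ0 (hU g hcard hauto)
  rw [expand_reverse hd, ← expand_C d ε, ← map_mul, ← map_mul] at h
  rcases h with h | h
  · exact mul_reverse_ne_C_mul hA0 hB0 hB hroots ε (expand_injective hd' h)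
  -- Equivalence by time reversal is the same obstruction with the roles of `A` and `B` exchanged.
  · have h1 := expand_injective hd' h
    rw [hq, reverse_mul_of_domain, ← mul_assoc, mul_comm A, mul_comm _ B.reverse] at h1
    have h2 : A = C ε * A.reverse := mul_left_cancel₀ (by simpa using hBz) h1
    refine mul_reverse_ne_C_mul hB0 hA0 hA (by rwa [mul_comm B A]) ε⁻¹ ?_
    have h3 : (C ε⁻¹ : Polynomial ℝ) * C ε = 1 := by
      rw [← C_mul, inv_mul_cancel₀ hε, C_1]
    linear_combination (-B * A.reverse) * h3 - C ε⁻¹ * B * h2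

/-- A real irreducible polynomial has degree at most 2, while this one has degree at least 3. -/
theorem not_uniquelyRecoverable_of_isUniform (hI : IsUniform I) (h4 : 4 ≤ I.card)
    (hx : AlgebraicIndependent ℚ x) : ¬ UniquelyRecoverable autocorr I.card (signalOn I x) := by
  obtain ⟨a, d, e, hd, hae, he, hlt, hsurj⟩ := exists_uniform_normalization hI (by omega)
  obtain ⟨t, ht⟩ := hsurj (I.card - 1) (by omega)
  have hdeg : (sparsePoly e x).natDegree = I.card - 1 := by
    rw [← ht]
    exact natDegree_sparsePoly he (hx.ne_zero t) fun i => by have := hlt i; omega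
  obtain ⟨A, hA, B, hAB⟩ := exists_irreducible_of_natDegree_ne_zero
    (by omega : (sparsePoly e x).natDegree ≠ 0)
  have hp0 : sparsePoly e x ≠ 0 := fun h => by rw [h, natDegree_zero] at hdeg; omega
  rw [hAB] at hp0
  have hsum := natDegree_mul (left_ne_zero_of_mul hp0) (right_ne_zero_of_mul hp0)
  rw [← hAB, hdeg] at hsum
  have hA2 := hA.natDegree_le_two
  exact not_uniquelyRecoverable_of_mul_eq (by omega) hd hae he hlt hsurj hx hAB
    hA.natDegree_pos (by omega)

/-- Positive discriminant makes the quadratic split over ℝ; as an open condition it holds on a set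
of positive measure. -/
theorem exists_not_uniquelyRecoverable_of_card_eq_three (hI : IsUniform I) (h3 : I.card = 3) :
    ∃ U : Set (I → ℝ), IsOpen U ∧ U.Nonempty ∧ ∀ x ∈ U, AlgebraicIndependent ℚ x →
      ¬ UniquelyRecoverable autocorr I.card (signalOn I x) := by
  classical
  obtain ⟨a, d, e, hd, hae, he, hlt, hsurj⟩ := exists_uniform_normalization hI (by omega)
  obtain ⟨i₀, h0⟩ := hsurj 0 (by omega)
  obtain ⟨i₁, h1⟩ := hsurj 1 (by omega)
  obtain ⟨i₂, h2⟩ := hsurj 2 (by omega)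
  have h01 : i₀ ≠ i₁ := fun h => by rw [h] at h0; omega
  refine ⟨{x | 0 < x i₁ ^ 2 - 4 * x i₂ * x i₀}, isOpen_lt (by fun_prop) (by fun_prop),
    ⟨Pi.single i₁ 1, ?_⟩, fun x hx hx' => ?_⟩
  · simp [h01]
  · have hdeg : (sparsePoly e x).natDegree = 2 := by
      rw [← h2]
      exact natDegree_sparsePoly he (hx'.ne_zero i₂) fun i => by have := hlt i; omega
    obtain ⟨r, hr⟩ := exists_quadratic_eq_zero (hx'.ne_zero i₂)
      (b := x i₁) (c := x i₀) ⟨Real.sqrt (x i₁ ^ 2 - 4 * x i₂ * x i₀), by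
        rw [Real.mul_self_sqrt (le_of_lt hx), discrim]⟩
    have hroot : (sparsePoly e x).eval r = 0 := by
      rw [eval_eq_sum_range, hdeg, Finset.sum_range_succ, Finset.sum_range_succ,
        Finset.sum_range_one, ← hr]
      nth_rw 1 [← h0]
      nth_rw 1 [← h1]
      nth_rw 1 [← h2]
      rw [coeff_sparsePoly_apply he, coeff_sparsePoly_apply he, coeff_sparsePoly_apply he]
      ring
    obtain ⟨B, hB⟩ := dvd_iff_isRoot.mpr hroot
    have hp0 : sparsePoly e x ≠ 0 := fun h => by rw [h, natDegree_zero] at hdeg; omega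
    rw [hB] at hp0
    have hsum := natDegree_mul (left_ne_zero_of_mul hp0) (right_ne_zero_of_mul hp0)
    rw [← hB, hdeg, natDegree_X_sub_C] at hsum
    exact not_uniquelyRecoverable_of_mul_eq (by omega) hd hae he hlt hsurj hx' hB
      (by rw [natDegree_X_sub_C]) (by omega)

end Uniform

/-! ### From generic signals to almost all signals. -/

section AlmostEverywhere

variable {I : Finset ℤ}

theorem uniquelyRecoverable_fourierMagnitude_iff {k : ℕ} {f : Signal} :
    UniquelyRecoverable fourierMagnitude k f ↔ UniquelyRecoverable autocorr k f := by
  simp only [UniquelyRecoverable, autocorr_eq_iff_fourierMagnitude_eq]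

theorem almostSurelyRecoverable_autocorr_iff (h3 : 3 ≤ I.card) :
    AlmostSurelyRecoverable autocorr I ↔ ¬ IsUniform I := by
  have : Nonempty I := (Finset.card_pos.mp (by omega)).to_subtype
  have hae := ae_algebraicIndependent (ι := I)
  constructor
  · intro h hI
    obtain ⟨U, hU, hne, hbad⟩ : ∃ U : Set (I → ℝ), IsOpen U ∧ U.Nonempty ∧
        ∀ x ∈ U, AlgebraicIndependent ℚ x →
          ¬ UniquelyRecoverable autocorr I.card (signalOn I x) := by
      rcases h3.eq_or_lt with h3 | h4
      · exact exists_not_uniquelyRecoverable_of_card_eq_three hI h3.symm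
      · exact ⟨Set.univ, isOpen_univ, Set.univ_nonempty,
          fun x _ => not_uniquelyRecoverable_of_isUniform hI h4⟩
    have hmem : ∀ᵐ x : I → ℝ, x ∉ U := by
      filter_upwards [h, hae] with x hx hx' hxU
      exact hbad x hxU hx' hx
    refine (hU.measure_pos volume hne).ne' ?_
    simpa [ae_iff] using hmem
  · intro hI
    filter_upwards [hae] with x hx
    exact uniquelyRecoverable_of_algebraicIndependent hI hx

theorem dimH_lt_of_subset [Nonempty I] {s : Set (I → ℝ)}
    (hs : ∀ x ∈ s, ¬ AlgebraicIndependent ℚ x) : dimH s < (I.card : ENNReal) := by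
  have h := dimH_not_algebraicIndependent_lt (ι := I)
  rw [Fintype.card_coe] at h
  exact (dimH_mono hs).trans_lt h

end AlmostEverywhere

end PhaseRetrieval

theorem mainTheorem1 :
    -- autocorrelation and Fourier magnitudes carry the same information
    (∀ f g : PhaseRetrieval.Signal,
      PhaseRetrieval.autocorr f = PhaseRetrieval.autocorr g ↔
        PhaseRetrieval.fourierMagnitude f = PhaseRetrieval.fourierMagnitude g) ∧
    -- almost sure unique recovery if and only if the support is non-uniform
    (∀ I : Finset ℤ, 3 ≤ I.card →
      (PhaseRetrieval.AlmostSurelyRecoverable PhaseRetrieval.autocorr I ↔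
        ¬ PhaseRetrieval.IsUniform I) ∧
      (PhaseRetrieval.AlmostSurelyRecoverable PhaseRetrieval.fourierMagnitude I ↔
        ¬ PhaseRetrieval.IsUniform I)) ∧
    -- for a non-uniform support of size `k` the exceptional set has dimension less than `k`
    (∀ I : Finset ℤ, ¬ PhaseRetrieval.IsUniform I →
      dimH {x : I → ℝ | ¬ PhaseRetrieval.UniquelyRecoverable PhaseRetrieval.autocorr I.card
        (PhaseRetrieval.signalOn I x)} < (I.card : ENNReal)) ∧
    -- if moreover the differences of the support have greatest common divisor one, this holds
    -- with competing signals of arbitrary sparsity and non-uniform support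
    (∀ I : Finset ℤ, ¬ PhaseRetrieval.IsUniform I →
      (∀ d : ℤ, (∀ i ∈ I, ∀ j ∈ I, d ∣ i - j) → d = 1 ∨ d = -1) →
      dimH {x : I → ℝ | ∃ g : PhaseRetrieval.Signal, ¬ PhaseRetrieval.IsUniform g.support ∧
        PhaseRetrieval.autocorr g = PhaseRetrieval.autocorr (PhaseRetrieval.signalOn I x) ∧
        ¬ PhaseRetrieval.TriviallyEquivalent (PhaseRetrieval.signalOn I x) g} <
          (I.card : ENNReal)) ∧
    -- for a uniform support of size at least four unique recovery almost surely fails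
    (∀ I : Finset ℤ, 4 ≤ I.card → PhaseRetrieval.IsUniform I →
      ∀ᵐ x : I → ℝ, ¬ PhaseRetrieval.UniquelyRecoverable PhaseRetrieval.autocorr I.card
        (PhaseRetrieval.signalOn I x)) ∧
    -- on the class of all signals with non-uniform support, whatever their sparsity, the
    -- autocorrelation is one-to-one outside a null set
    (∃ N : (I : Finset ℤ) → Set (I → ℝ),
      (∀ I : Finset ℤ, ¬ PhaseRetrieval.IsUniform I → volume (N I) = 0) ∧
      ∀ I J : Finset ℤ, ¬ PhaseRetrieval.IsUniform I → ¬ PhaseRetrieval.IsUniform J →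
        ∀ (x : I → ℝ) (y : J → ℝ), x ∉ N I → y ∉ N J →
          PhaseRetrieval.autocorr (PhaseRetrieval.signalOn I x) =
            PhaseRetrieval.autocorr (PhaseRetrieval.signalOn J y) →
          PhaseRetrieval.TriviallyEquivalent
            (PhaseRetrieval.signalOn I x) (PhaseRetrieval.signalOn J y)) := by
  open PhaseRetrieval in
  refine ⟨autocorr_eq_iff_fourierMagnitude_eq, fun I h3 => ?_, fun I hI => ?_, fun I hI hgcd => ?_,
    fun I h4 hI => ?_, fun I => {x | ¬ AlgebraicIndependent ℚ x}, fun I hI => ?_,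
    fun I J hI hJ x y hx hy h => ?_⟩
  · refine ⟨almostSurelyRecoverable_autocorr_iff h3, ?_⟩
    rw [← almostSurelyRecoverable_autocorr_iff h3]
    simp only [AlmostSurelyRecoverable, uniquelyRecoverable_fourierMagnitude_iff]
  · have := nonempty_of_not_isUniform hI
    exact dimH_lt_of_subset fun x hx hx' => hx (uniquelyRecoverable_of_algebraicIndependent hI hx')
  · have := nonempty_of_not_isUniform hI
    exact dimH_lt_of_subset fun x ⟨g, hg, h, hne⟩ hx =>
      hne (triviallyEquivalent_of_gcd_eq_one hI hgcd hx hg h)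
  · have : Nonempty I := (Finset.card_pos.mp (by omega)).to_subtype
    filter_upwards [ae_algebraicIndependent (ι := I)] with x hx
    exact not_uniquelyRecoverable_of_isUniform hI h4 hx
  · have := nonempty_of_not_isUniform hI
    exact ae_iff.mp (ae_algebraicIndependent (ι := I))
  · exact triviallyEquivalent_of_algebraicIndependent hI hJ (not_not.mp hx) (not_not.mp hy) h
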